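/- **Conventions.** A family on a set $I$ is a set $\mathcal F$ of finite subsets of $I$; it is *compact* if it is closed in $2^I$ (sets being identified with characteristic functions) and *hereditary* if it is closed under subsets. For a non-empty compact $\mathcal F$, $\mathrm{rk}(\mathcal F)$ is the ordinal $\alpha$ such that $\alpha+1$ is the first ordinal at which the Cantor–Bendixson derivative of $\mathcal F$ is empty. An ordinal $\lambda\ge\omega$ is *exp-indecomposable* if $\beta^\gamma<\lambda$ for all $\beta,\gamma<\lambda$, and $\iota(\alpha)$ is the least exp-indecomposable $\lambda>\alpha$. Let $\mathcal P=(P,<)$ be a partial ordering. A family on chains of $\mathcal P$ is a family on $P$ consisting of chains. Its small rank $\mathrm{srk}_{\mathcal P}(\mathcal F)$ is the least rank of $\mathcal F\upharpoonright C=\{s\in\mathcal F: s\subseteq C\}$ over all infinite chains $C$. A compact hereditary family $\mathcal F$ on chains of $\mathcal P$ is *homogeneous* if $\mathcal F=\{\emptyset\}$, or if for some $1\le\alpha<\omega_1$ it contains all sets with at most one element and $\alpha=\mathrm{srk}_{\mathcal P}(\mathcal F)\le \mathrm{rk}(\mathcal F)<\iota(\alpha)$. Write $\mathcal F\sqcup_{\mathcal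 P}\mathcal G$ for the family of all chains $s\cup t$ with $s\in\mathcal F$, $t\in\mathcal G$. For an infinite $M\subseteq\omega$, the $\alpha$-uniform families on $M$ ($\alpha<\omega_1$) are defined recursively: $\mathcal F$ is a family on $M$ with $\emptyset\in\mathcal F$, and, writing $\mathcal F_{\{n\}}=\{s: n<\min s \text{ or } s=\emptyset,\ \{n\}\cup s\in\mathcal F\}$: $\mathcal F=\{\emptyset\}$ if $\alpha=0$; $\mathcal F_{\{n\}}$ is $\beta$-uniform on $M\cap(n,\infty)$ for all $n\in M$ if $\alpha=\beta+1$; and, if $\alpha$ is a limit, there are ordinals $\alpha_n<\alpha$ ($n\in M$), non-decreasing in $n$ with supremum $\alpha$, such that $\mathcal F_{\{n\}}$ is $\alpha_n$-uniform on $M\cap(n,\infty)$ for all $n\in M$. A family on $\omega$ is *spreading* if $\{m_0<\dots<m_k\}\in\mathcal F$, $n_0<\dots<n_k$ and $m_i\le n_i$ for all $i$ imply $\{n_0,\dots,n_k\}\in\mathcal F$. Let $\mathfrak S$ be the collection of all hereditary, spreading families that are $\alpha$-uniform on $\omega$ for some $\alpha$. For a homogeneous family $\mathcal F$ on chains of $\mathcal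 P$ and $\mathcal H\in\mathfrak S$, a family $\mathcal G$ on chains of $\mathcal P$ is a *multiplication of $\mathcal F$ by $\mathcal H$* if $\mathcal G$ is homogeneous, $\iota(\mathrm{srk}_{\mathcal P}(\mathcal G))=\iota(\mathrm{srk}_{\mathcal P}(\mathcal F)\cdot\mathrm{srk}_{\omega}(\mathcal H))$, and every sequence $(s_n)_{n<\omega}$ in $\mathcal F$ whose union is a chain has a subsequence $(t_n)_{n<\omega}$ with $\bigcup_{n\in x}t_n\in\mathcal G$ for all $x\in\mathcal H$. If $\mathcal P$ has an infinite chain, a *basis of families on chains of $\mathcal P$* is a pair $(\mathfrak B,\times)$ such that 1. $\mathfrak B$ consists of homogeneous families on chains of $\mathcal P$, contains for each $n<\omega$ the family of all chains with at most $n$ elements, and for each $\omega\le\alpha<\omega_1$ contains some $\mathcal F$ with $\mathrm{srk}_{\mathcal P}(\mathcal F)=\alpha$; 2. $\mathfrak B$ is closed under $\cup$ and $\sqcup_{\mathcal P}$, and if $\mathcal F\subseteq\mathcal G\in\mathfrak B$, $\mathcal F$ is homogeneous and $\iota(\mathrm{srk}_{\mathcal P}(\mathcal F))=\iota(\mathrm{srk}_{\mathcal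 P}(\mathcal G))$, then $\mathcal F\in\mathfrak B$; 3. $\times:\mathfrak B\times\mathfrak S\to\mathfrak B$, and $\mathcal F\times\mathcal H$ is a multiplication of $\mathcal F$ by $\mathcal H$ for all $\mathcal F\in\mathfrak B$, $\mathcal H\in\mathfrak S$. A *basis of families on an infinite set $I$* is a basis of families on chains of some (equivalently, any) total ordering of $I$. **Theorem.** Let $(T,<)$ be an infinite rooted tree: a partial ordering with a least element in which the set of predecessors of every node is well ordered. Suppose that $T$ is complete, in the sense that any two nodes $t,u$ have a meet $t\wedge u$, the greatest node that is $\le t$ and $\le u$. For each node $v$ fix a total ordering $<_v$ of the set of immediate successors of $v$, and let $t<_a u$ mean that, for some node $v$, both $t$ and $u$ are immediate successors of $v$ and $t<_v u$. The following are equivalent: (a) there is a basis of families on $T$; (b) if $T$ has an infinite $<$-chain, then there is a basis of families on chains of $(T,<)$; and if $T$ has an infinite $<_a$-chain, then there is a basis of families on chains of $(T,<_a)$. -/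

import Mathlib

open Set Filter Ordinal

universe u

noncomputable section

namespace FinFamily

/-! ### Families of finite sets, their topology and their rank

A family on `I` is a `Set (Finset I)`; it is topologized as a subspace of `2 ^ I`. -/

section Families

variable {I : Type u}

/-- The family `F`, each of its members being identified with its characteristic function. -/
def toCantor (F : Set (Finset I)) : Set (I → Bool) :=
  (fun s : Finset I => (s : Set I).boolIndicator) '' F

/-- `F` is a compact family: it is a compact (equivalently, closed) subset of `2 ^ I`. -/
def IsCompactFamily (F : Set (Finset I)) : Prop :=
  IsCompact (toCantor F)

/-- `F` is closed under taking subsets. -/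
def Hereditary (F : Set (Finset I)) : Prop :=
  ∀ s ∈ F, ∀ t : Finset I, t ⊆ s → t ∈ F

/-- The least `α` such that the Cantor-Bendixson derivatives of `A` of orders `α` and `α + 1`
agree. -/
def cbRank {X : Type u} [TopologicalSpace X] (A : Set X) : Ordinal.{u} :=
  sInf {α | CantorBendixson.iteratedDerivedSet A (α + 1) = CantorBendixson.iteratedDerivedSet A α}

/-- The rank of a (non-empty, compact) family: the predecessor of its Cantor-Bendixson rank. -/
def rk (F : Set (Finset I)) : Ordinal.{u} :=
  Ordinal.pred (cbRank (toCantor F))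

/-- The members of `F` that are subsets of `A`. -/
def restrict (F : Set (Finset I)) (A : Set I) : Set (Finset I) :=
  {s ∈ F | (s : Set I) ⊆ A}

end Families

/-! ### Indecomposable ordinals -/

/-- Exponentially indecomposable ordinals: `ω`, the epsilon numbers, and nothing else
(the bound `ω ≤ o` excludes the degenerate case `o = 2`). -/
def ExpIndecomposable (o : Ordinal.{u}) : Prop :=
  ω ≤ o ∧ ∀ β < o, ∀ γ < o, β ^ γ < o

/-- The least exponentially indecomposable ordinal greater than `α`. -/
def iota (α : Ordinal.{u}) : Ordinal.{u} :=
  sInf {o | α < o ∧ ExpIndecomposable o}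

/-! ### Homogeneous families

`r` is the strict order of a partial ordering on `I`; a chain is a set any two distinct members of
which are `r`-comparable (`IsChain r`). -/

section Chains

variable {I : Type u} (r : I → I → Prop)

/-- `F` consists of (finite) chains. -/
def OnChains (F : Set (Finset I)) : Prop :=
  ∀ s ∈ F, IsChain r (s : Set I)

/-- The ordering has an infinite chain. -/
def HasInfiniteChain : Prop :=
  ∃ C : Set I, C.Infinite ∧ IsChain r C

/-- The cube: all chains with at most `n` elements. -/
def cube (n : ℕ) : Set (Finset I) :=
  {s | s.card ≤ n ∧ IsChain r (s : Set I)}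

/-- The small rank: the least rank of a restriction of `F` to an infinite chain. -/
def srk (F : Set (Finset I)) : Ordinal.{u} :=
  sInf {α | ∃ C : Set I, C.Infinite ∧ IsChain r C ∧ α = rk (restrict F C)}

/-- `F` is an `(α, r)`-homogeneous family on chains. -/
structure IsHomogeneousOfRank (α : Ordinal.{u}) (F : Set (Finset I)) : Prop where
  onChains : OnChains r F
  compact : IsCompactFamily F
  hereditary : Hereditary F
  eq_of_zero : α = 0 → F = {∅}
  of_pos : 1 ≤ α → {s : Finset I | s.card ≤ 1} ⊆ F ∧ α = srk r F ∧ srk r F ≤ rk F ∧ rk F < iota α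

/-- `F` is homogeneous on chains of `r`. -/
def IsHomogeneous (F : Set (Finset I)) : Prop :=
  ∃ α < ω_ 1, IsHomogeneousOfRank r α F

/-- `F ⊔ G` relative to `r`: the chains of the form `s ∪ t` with `s ∈ F` and `t ∈ G`. -/
def chainJoin (F G : Set (Finset I)) : Set (Finset I) :=
  {w | IsChain r (w : Set I) ∧ ∃ s ∈ F, ∃ t ∈ G, (w : Set I) = (s : Set I) ∪ (t : Set I)}

end Chains

/-! ### Uniform families on `ω` -/

/-- `F_{n}`: the sets `s` with `n < s` and `{n} ∪ s ∈ F`. -/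
def section_ (F : Set (Finset ℕ)) (n : ℕ) : Set (Finset ℕ) :=
  {s | (∀ m ∈ s, n < m) ∧ insert n s ∈ F}

/-- `IsUniform α M F`: `F` is an `α`-uniform family on the set `M` of natural numbers
(to be used for infinite `M`). -/
inductive IsUniform : Ordinal.{0} → Set ℕ → Set (Finset ℕ) → Prop
  | zero (M : Set ℕ) : IsUniform 0 M {∅}
  | succ (β : Ordinal.{0}) (M : Set ℕ) (F : Set (Finset ℕ))
      (on : ∀ s ∈ F, (s : Set ℕ) ⊆ M) (empty_mem : ∅ ∈ F)
      (sec : ∀ n ∈ M, IsUniform β (M ∩ Set.Ioi n) (section_ F n)) :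
      IsUniform (β + 1) M F
  | limit (α : Ordinal.{0}) (M : Set ℕ) (F : Set (Finset ℕ)) (hα : Order.IsSuccLimit α)
      (on : ∀ s ∈ F, (s : Set ℕ) ⊆ M) (empty_mem : ∅ ∈ F)
      (a : ℕ → Ordinal.{0}) (lt : ∀ n ∈ M, a n < α) (mono : MonotoneOn a M)
      (lub : IsLUB (a '' M) α)
      (sec : ∀ n ∈ M, IsUniform (a n) (M ∩ Set.Ioi n) (section_ F n)) :
      IsUniform α M F

/-- Spreading families: if `{m_0 < ⋯ < m_{k-1}} ∈ F` and `m_i ≤ n_i` for all `i`, where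
`n_0 < ⋯ < n_{k-1}`, then `{n_0, …, n_{k-1}} ∈ F`. -/
def Spreading (F : Set (Finset ℕ)) : Prop :=
  ∀ (k : ℕ) (m n : Fin k → ℕ), StrictMono m → StrictMono n → (∀ i, m i ≤ n i) →
    Finset.univ.image m ∈ F → Finset.univ.image n ∈ F

/-- The collection of all hereditary, spreading uniform families on `ω`. -/
def spreadingUniform : Set (Set (Finset ℕ)) :=
  {H | Hereditary H ∧ Spreading H ∧ ∃ α, IsUniform α Set.univ H}

/-! ### Bases of homogeneous families -/

section Basis

variable {I : Type u} (r : I → I → Prop)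

/-- `G` is a multiplication of `F` (a family on chains of `r`) by `H` (a family on `ω`). -/
structure IsMultiplication (F : Set (Finset I)) (H : Set (Finset ℕ)) (G : Set (Finset I)) :
    Prop where
  homogeneous : IsHomogeneous r G
  iota_eq : iota (srk r G) =
    iota (srk r F * Ordinal.lift.{u} (srk (fun m n : ℕ => m < n) H))
  union_mem : ∀ s : ℕ → Finset I, (∀ n, s n ∈ F) → IsChain r (⋃ n, (s n : Set I)) →
    ∃ φ : ℕ → ℕ, StrictMono φ ∧
      ∀ x ∈ H, ∃ g ∈ G, (g : Set I) = ⋃ n ∈ x, (s (φ n) : Set I)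

/-- `(B, mul)` is a basis of homogeneous families on chains of `r`.  Only the values of `mul` on
`B × spreadingUniform` matter. -/
structure IsBasis (B : Set (Set (Finset I)))
    (mul : Set (Finset I) → Set (Finset ℕ) → Set (Finset I)) : Prop where
  homogeneous : ∀ F ∈ B, IsHomogeneous r F
  cube_mem : ∀ n : ℕ, cube r n ∈ B
  exists_srk_eq : ∀ α : Ordinal.{u}, ω ≤ α → α < ω_ 1 → ∃ F ∈ B, srk r F = α
  union_mem : ∀ F ∈ B, ∀ G ∈ B, F ∪ G ∈ B
  chainJoin_mem : ∀ F ∈ B, ∀ G ∈ B, chainJoin r F G ∈ B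
  mem_of_subset : ∀ G ∈ B, ∀ F ⊆ G, IsHomogeneous r F → iota (srk r F) = iota (srk r G) → F ∈ B
  mul_mem : ∀ F ∈ B, ∀ H ∈ spreadingUniform, mul F H ∈ B
  isMultiplication : ∀ F ∈ B, ∀ H ∈ spreadingUniform, IsMultiplication r F H (mul F H)

/-- The partial ordering with strict order `r` has an infinite chain, and there is a basis of
families on its chains. -/
def HasBasisOnChains : Prop :=
  HasInfiniteChain r ∧ ∃ B mul, IsBasis r B mul

variable (I) in
/-- There is a basis of families on the set `I`, that is, on chains of a total ordering of `I`;
by `hasBasis_iff` the choice of the total ordering is irrelevant. -/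
def HasBasis : Prop :=
  ∃ r : I → I → Prop, IsStrictTotalOrder I r ∧ HasBasisOnChains r

theorem hasBasis_iff [IsStrictTotalOrder I r] : HasBasis I ↔ HasBasisOnChains r := by
  have tot : ∀ q : I → I → Prop, IsStrictTotalOrder I q → ∀ s : Set I, IsChain q s := by
    intro q hq s x _ y _ hxy
    rcases trichotomous_of q x y with h | h | h
    · exact Or.inl h
    · exact absurd h hxy
    · exact Or.inr h
  have key : ∀ q : I → I → Prop, IsStrictTotalOrder I q → HasBasisOnChains q →
      HasBasisOnChains r := by
    intro q hq h
    have e : (IsChain q : Set I → Prop) = IsChain r := by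
      funext s
      exact propext ⟨fun _ => tot r inferInstance s, fun _ => tot q hq s⟩
    have e1 : HasInfiniteChain q = HasInfiniteChain r := by
      unfold HasInfiniteChain; rw [e]
    have e2 : cube q = cube r := by funext n; unfold cube; rw [e]
    have e3 : srk q = srk r := by funext F; unfold srk; rw [e]
    have e4 : IsHomogeneous q = IsHomogeneous r := by
      funext F
      refine propext ⟨?_, ?_⟩ <;> rintro ⟨α, hα, h1, h2, h3, h4, h5⟩
      · exact ⟨α, hα, by unfold OnChains at *; rwa [← e], h2, h3, h4, by rwa [← e3]⟩
      · exact ⟨α, hα, by unfold OnChains at *; rwa [e], h2, h3, h4, by rwa [e3]⟩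
    have e5 : chainJoin q = chainJoin r := by funext F G; unfold chainJoin; rw [e]
    obtain ⟨hi, B, mul, h1, h2, h3, h4, h5, h6, h7, h8⟩ := h
    rw [e4] at h1 h6
    rw [e2] at h2
    rw [e3] at h3 h6
    rw [e5] at h5
    refine ⟨e1 ▸ hi, B, mul, h1, h2, h3, h4, h5, h6, h7, fun F hF H hH => ?_⟩
    obtain ⟨m1, m2, m3⟩ := h8 F hF H hH
    rw [e4] at m1
    rw [e3] at m2
    exact ⟨m1, m2, fun s hs _ => m3 s hs (tot q hq _)⟩
  exact ⟨fun ⟨q, hq, h⟩ => key q hq h, fun h => ⟨r, inferInstance, h⟩⟩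

end Basis

/-! ### Trees -/

/-- A complete rooted tree: the predecessors of every node are well ordered, there is a root, and
any two nodes `t`, `u` have a meet `t ∧ u`, the greatest node that is below both of them. -/
structure IsCompleteRootedTree (T : Type u) [PartialOrder T] : Prop where
  wellOrdered : ∀ t : T, IsWellOrder (Set.Iio t) (fun a b => a < b)
  root : ∃ o : T, ∀ t, o ≤ t
  meet : ∀ t u : T, ∃ m : T, IsGreatest {v | v ≤ t ∧ v ≤ u} m

/-- The relation `<_a`: given a relation `sib v` on the set of immediate successors of every node
`v`, one has `t <_a u` if `t` and `u` are immediate successors of one node `v` and `sib v t u`. -/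
def ltA {T : Type u} [PartialOrder T] (sib : ∀ v : T, {u : T // v ⋖ u} → {u : T // v ⋖ u} → Prop)
    (t u : T) : Prop :=
  ∃ (v : T) (ht : v ⋖ t) (hu : v ⋖ u), sib v ⟨t, ht⟩ ⟨u, hu⟩

end FinFamily

end

/-!
# Bases of families on trees

A basis is rigid: homogeneity and multiplication prescribe small ranks, that is, lower bounds for
ranks on every infinite chain, and these do not survive a change of the ordering.  The proof therefore
passes to *multiplicative classes* (`IsMulClass`), which keep only upper bounds.  Such a class assigns
to each epsilon number `l` a set of hereditary families on chains of rank below `l`, closed under joins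
and, up to inclusion, under the combinatorial part of multiplication by members of
`spreadingUniform` of rank below `l`.

* By `exists_isMulClass_iff`, a multiplicative class on chains of `r` exists if and only if a basis
  exists or `r` has no infinite chain.  A basis gives a class by selecting the families whose rank is
  below `l`.  Conversely, a multiplication of a family that contains the singletons contains a copy of
  `H` inside every infinite chain, which supplies the required lower bounds automatically, and all
  homogeneous subfamilies of the right level can be collected to form a basis.  Families of a
  prescribed small rank come from spreading uniform families of every countable rank
  (`exists_isUniform`).
* A class can be restricted to any ordering with fewer chains (`IsMulClass.restrict`).  Hence a basis
  on `T`, whose total ordering makes every set a chain, gives classes for `<` and for `<_a`.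
* Conversely, let `C` and `A` be families on chains of `<` and of `<_a`.  The family `treeFamily C A`
  consists of the finite sets whose meets below each of their members form a set in `C`, and whose
  directions at each node form a set in `A`.  These families form a class on the whole of `T`
  (`IsMulClass.tree`), because of two facts.

The first fact is a rank estimate (`bounded_treeFamily`).  To a finite subtree one assigns a formal
natural sum of powers of `ω`, with one exponent for each edge and one for each node, in such a way that
the insertion of a new node replaces one power of `ω` by finitely many smaller ones.  As epsilon numbers
are closed under exponentiation, the rank of `treeFamily C A` stays below `l`.

The second fact is that `treeFamily C A` can be multiplied (`exists_unionProperty_treeFamily`).  A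
sequence of finite subtrees `w n` has a limit tree along a free ultrafilter.  By compactness of
`treeFamily C A` and of `A`, the limit tree is covered by finitely many chains, its branches.  After
thinning out the sequence, any two of the `w n` meet only inside the limit tree, and at all but finitely
many nodes one `w n` alone accounts for all but at most one direction.  What remains to be multiplied
are finitely many sequences of chains, namely projections to the branches, and finitely many sequences
of sets of siblings.
-/

set_option linter.unusedSectionVars false

noncomputable section

namespace FinFamily

/-! ### Compactness of hereditary families -/

section Topology

variable {I : Type u}

/-- No infinite set has all its finite subsets in `F`.  For hereditary families this is
compactness. -/
def NoInfinite (F : Set (Finset I)) : Prop :=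
  ∀ A : Set I, A.Infinite → ∃ s : Finset I, (s : Set I) ⊆ A ∧ s ∉ F

theorem boolIndicator_coe_injective :
    Function.Injective (fun s : Finset I => (s : Set I).boolIndicator) := by
  intro s t h
  ext x
  have := congrFun h x
  by_cases hx : x ∈ s <;> by_cases hy : x ∈ t <;> simp_all [Set.boolIndicator]

theorem mem_toCantor {F : Set (Finset I)} {s : Finset I} :
    (s : Set I).boolIndicator ∈ toCantor F ↔ s ∈ F :=
  boolIndicator_coe_injective.mem_set_image

theorem mem_nhds_pi_bool {x : I → Bool} {U : Set (I → Bool)} :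
    U ∈ nhds x ↔ ∃ J : Finset I, {y | ∀ i ∈ J, y i = x i} ⊆ U := by
  constructor
  · intro h
    rw [nhds_pi, Filter.mem_pi'] at h
    obtain ⟨J, t, ht, hU⟩ := h
    refine ⟨J, fun y hy => hU fun i hi => ?_⟩
    rw [hy i hi]
    exact mem_of_mem_nhds (ht i)
  · rintro ⟨J, hJ⟩
    refine Filter.mem_of_superset ?_ hJ
    have : (J : Set I).pi (fun i => ({x i} : Set Bool)) ∈ nhds x :=
      set_pi_mem_nhds J.finite_toSet fun i _ => by simp
    refine Filter.mem_of_superset this fun y hy i hi => ?_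
    simpa using hy i hi

theorem boolIndicator_eq_true {A : Set I} {i : I} : A.boolIndicator i = true ↔ i ∈ A := by
  by_cases h : i ∈ A <;> simp [Set.boolIndicator, h]

theorem boolIndicator_congr {A B : Set I} {i : I} :
    A.boolIndicator i = B.boolIndicator i ↔ (i ∈ A ↔ i ∈ B) := by
  by_cases h : i ∈ A <;> by_cases h' : i ∈ B <;> simp [Set.boolIndicator, h, h']

/-- The closure of a hereditary family in `2 ^ I` consists of all sets whose finite subsets belong to
the family; hence it is closed if and only if no such set is infinite. -/
theorem isCompactFamily_iff {F : Set (Finset I)} (hF : Hereditary F) :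
    IsCompactFamily F ↔ NoInfinite F := by
  classical
  unfold IsCompactFamily
  rw [show IsCompact (toCantor F) ↔ IsClosed (toCantor F) from
    ⟨IsCompact.isClosed, IsClosed.isCompact⟩]
  constructor
  · intro hc A hA
    by_contra! hcon
    have : A.boolIndicator ∈ closure (toCantor F) := by
      rw [mem_closure_iff_nhds]
      intro U hU
      obtain ⟨J, hJ⟩ := mem_nhds_pi_bool.1 hU
      refine ⟨((J.filter (· ∈ A) : Finset I) : Set I).boolIndicator, hJ ?_,
        mem_toCantor.2 (hcon _ ?_)⟩
      · intro i hi
        rw [boolIndicator_congr]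
        simp [hi]
      · intro i hi
        simp at hi
        exact hi.2
    rw [hc.closure_eq] at this
    obtain ⟨s, -, hs⟩ := this
    have : A = s := by
      ext i
      exact (boolIndicator_congr.1 (congrFun hs i)).symm
    exact hA (this ▸ s.finite_toSet)
  · intro h
    refine isClosed_of_closure_subset fun x hx => ?_
    rw [mem_closure_iff_nhds] at hx
    set A : Set I := {i | x i = true} with hA
    have hAx : A.boolIndicator = x := by
      funext i
      by_cases hi : x i = true <;> simp [Set.boolIndicator, hA, hi]
    have key : ∀ s : Finset I, (s : Set I) ⊆ A → s ∈ F := by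
      intro s hs
      obtain ⟨y, hy, t, ht, rfl⟩ := hx _ (mem_nhds_pi_bool.2 ⟨s, Subset.rfl⟩)
      refine hF t ht s fun i hi => ?_
      have h1 := hy i hi
      rw [show x i = true from hs hi] at h1
      simpa using boolIndicator_eq_true.1 h1
    have hfin : A.Finite := by
      by_contra hinf
      obtain ⟨s, hs, hs'⟩ := h A hinf
      exact hs' (key s hs)
    refine ⟨hfin.toFinset, key _ (by simp), ?_⟩
    simpa using hAx

end Topology

/-! ### A combinatorial description of the rank -/

section Rank

variable {I : Type u}

/-- The Cantor-Bendixson derivative of order `α` of a hereditary family, described without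
topology: `s` survives to the stage `α` if at every earlier stage `β` infinitely many one-point
extensions of `s` survive. -/
def der (F : Set (Finset I)) (α : Ordinal.{u}) : Set (Finset I) :=
  {s | s ∈ F ∧ ∀ β : Set.Iio α, {x | ∃ h : x ∉ s, s.cons x h ∈ der F β.1}.Infinite}
termination_by α
decreasing_by exact β.2

theorem mem_der {F : Set (Finset I)} {α : Ordinal.{u}} {s : Finset I} :
    s ∈ der F α ↔ s ∈ F ∧ ∀ β < α, {x | ∃ h : x ∉ s, s.cons x h ∈ der F β}.Infinite := by
  rw [der]
  exact ⟨fun h => ⟨h.1, fun β hβ => h.2 ⟨β, hβ⟩⟩, fun h => ⟨h.1, fun β => h.2 β.1 β.2⟩⟩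

theorem der_zero (F : Set (Finset I)) : der F 0 = F := by
  ext s
  rw [mem_der]
  simp

theorem der_antitone (F : Set (Finset I)) : Antitone (der F) := by
  intro α β h s hs
  rw [mem_der] at hs ⊢
  exact ⟨hs.1, fun γ hγ => hs.2 γ (hγ.trans_le h)⟩

theorem der_subset (F : Set (Finset I)) (α : Ordinal.{u}) : der F α ⊆ F :=
  fun _ hs => (mem_der.1 hs).1

theorem der_mono {F G : Set (Finset I)} (h : F ⊆ G) (α : Ordinal.{u}) : der F α ⊆ der G α := by
  induction α using WellFoundedLT.induction with
  | ind α ih =>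
    intro s hs
    rw [mem_der] at hs ⊢
    refine ⟨h hs.1, fun β hβ => (hs.2 β hβ).mono ?_⟩
    rintro x ⟨hx, hx'⟩
    exact ⟨hx, ih β hβ hx'⟩

theorem mem_der_add_one {F : Set (Finset I)} {α : Ordinal.{u}} {s : Finset I} :
    s ∈ der F (α + 1) ↔ s ∈ F ∧ {x | ∃ h : x ∉ s, s.cons x h ∈ der F α}.Infinite := by
  rw [mem_der]
  refine and_congr_right fun _ => ⟨fun h => h α (by simp), fun h β hβ => h.mono ?_⟩
  rintro x ⟨hx, hx'⟩
  exact ⟨hx, der_antitone F (Order.lt_add_one_iff.1 hβ) hx'⟩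

theorem Hereditary.der {F : Set (Finset I)} (hF : Hereditary F) (α : Ordinal.{u}) :
    Hereditary (der F α) := by
  classical
  induction α using WellFoundedLT.induction with
  | ind α ih =>
    intro s hs t hts
    rw [mem_der] at hs ⊢
    refine ⟨hF s hs.1 t hts, fun β hβ => ((hs.2 β hβ).sdiff s.finite_toSet).mono ?_⟩
    rintro x ⟨⟨hx, hx'⟩, hxs⟩
    refine ⟨fun h => hx (hts h), ih β hβ _ hx' _ ?_⟩
    simp only [Finset.cons_eq_insert]
    exact Finset.insert_subset_insert _ hts

theorem relDerivedSet_toCantor {D : Set (Finset I)} (hD : Hereditary D) :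
    relDerivedSet (toCantor D) =
      toCantor {s | s ∈ D ∧ {x | ∃ h : x ∉ s, s.cons x h ∈ D}.Infinite} := by
  classical
  ext y
  rw [relDerivedSet_apply]
  constructor
  · rintro ⟨hy, s, hs, rfl⟩
    refine mem_toCantor.2 ⟨hs, fun hfin => ?_⟩
    rw [mem_derivedSet, accPt_iff_nhds] at hy
    obtain ⟨z, ⟨hz, t, ht, rfl⟩, hne⟩ :=
      hy _ (mem_nhds_pi_bool.2 ⟨s ∪ hfin.toFinset, Subset.rfl⟩)
    have hst : s ⊆ t := by
      intro i hi
      have := boolIndicator_congr.1 (hz i (by simp [hi]))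
      simpa using this.2 (by simpa using hi)
    obtain ⟨x, hxt, hxs⟩ : ∃ x ∈ t, x ∉ s := by
      by_contra! hcon
      exact hne (by rw [Finset.Subset.antisymm hst hcon])
    have hx : x ∈ {x | ∃ h : x ∉ s, s.cons x h ∈ D} := by
      refine ⟨hxs, hD t ht _ ?_⟩
      rw [Finset.cons_eq_insert]
      exact Finset.insert_subset hxt hst
    have := boolIndicator_congr.1 (hz x (Finset.mem_union_right _ (hfin.mem_toFinset.2 hx)))
    exact hxs (by simpa using this.1 (by simpa using hxt))
  · rintro ⟨s, ⟨hs, hinf⟩, rfl⟩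
    refine ⟨?_, mem_toCantor.2 hs⟩
    rw [mem_derivedSet, accPt_iff_nhds]
    intro U hU
    obtain ⟨J, hJ⟩ := mem_nhds_pi_bool.1 hU
    obtain ⟨x, ⟨hx, hx'⟩, hxJ⟩ := hinf.exists_notMem_finset J
    refine ⟨((s.cons x hx : Finset I) : Set I).boolIndicator, ⟨hJ ?_, mem_toCantor.2 hx'⟩, ?_⟩
    · intro i hi
      rw [boolIndicator_congr]
      have : i ≠ x := fun h => hxJ (h ▸ hi)
      simp [this]
    · intro h
      have := boolIndicator_coe_injective h
      exact hx (this ▸ Finset.mem_cons_self x s)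

theorem iteratedDerivedSet_toCantor {F : Set (Finset I)} (hF : Hereditary F) (α : Ordinal.{u}) :
    CantorBendixson.iteratedDerivedSet (toCantor F) α = toCantor (der F α) := by
  induction α using Ordinal.limitRecOn with
  | zero => rw [CantorBendixson.iteratedDerivedSet_zero, der_zero]
  | add_one α ih =>
    rw [CantorBendixson.iteratedDerivedSet_succ, ih, relDerivedSet_toCantor (hF.der α)]
    congr 1
    ext s
    rw [mem_der_add_one]
    constructor
    · rintro ⟨h1, h2⟩
      exact ⟨der_subset _ _ h1, h2⟩
    · rintro ⟨h1, h2⟩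
      refine ⟨?_, h2⟩
      obtain ⟨x, hx, hx'⟩ := h2.nonempty
      exact hF.der α _ hx' _ (Finset.subset_cons hx)
  | limit α hα ih =>
    rw [CantorBendixson.iteratedDerivedSet_limit hα]
    ext y
    simp only [Set.mem_iInter, Subtype.forall, Set.mem_Iio]
    constructor
    · intro h
      have h0 := h 0 hα.bot_lt
      rw [CantorBendixson.iteratedDerivedSet_zero] at h0
      obtain ⟨s, hs, rfl⟩ := h0
      refine mem_toCantor.2 (mem_der.2 ⟨hs, fun β hβ => ?_⟩)
      have h1 := h (β + 1) (hα.add_one_lt hβ)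
      rw [ih _ (hα.add_one_lt hβ)] at h1
      exact (mem_der_add_one.1 (mem_toCantor.1 h1)).2
    · rintro ⟨s, hs, rfl⟩ β hβ
      rw [ih β hβ]
      exact mem_toCantor.2 (der_antitone F hβ.le hs)

theorem toCantor_injective : Function.Injective (toCantor (I := I)) :=
  boolIndicator_coe_injective.image_injective

/-- A compact family has a maximal member, since otherwise one point after another could be added
forever. -/
theorem NoInfinite.exists_maximal {D : Set (Finset I)} (hD : Hereditary D) (h : NoInfinite D)
    (hne : D.Nonempty) : ∃ s ∈ D, ∀ x, ∀ hx : x ∉ s, s.cons x hx ∉ D := by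
  classical
  by_contra! hcon
  obtain ⟨s₀, hs₀⟩ := hne
  choose x hx hx' using hcon
  let f : ℕ → {s // s ∈ D} := fun n =>
    Nat.rec ⟨s₀, hs₀⟩ (fun _ s => ⟨s.1.cons (x s.1 s.2) (hx s.1 s.2), hx' s.1 s.2⟩) n
  have hf : ∀ n, (f (n + 1)).1 = (f n).1.cons (x (f n).1 (f n).2) (hx _ (f n).2) := fun n => rfl
  have hmono : Monotone (fun n => (f n).1) := by
    refine monotone_nat_of_le_succ fun n => ?_
    rw [hf]
    exact Finset.subset_cons _
  have hcard : ∀ n, n ≤ (f n).1.card := by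
    intro n
    induction n with
    | zero => simp
    | succ n ih => rw [hf, Finset.card_cons]; omega
  obtain ⟨s, hs, hs'⟩ := h (⋃ n, ((f n).1 : Set I)) (by
    intro hfin
    have := hcard (hfin.toFinset.card + 1)
    have h2 : (f (hfin.toFinset.card + 1)).1 ⊆ hfin.toFinset := by
      intro i hi
      rw [Set.Finite.mem_toFinset]
      exact Set.mem_iUnion.2 ⟨hfin.toFinset.card + 1, hi⟩
    have := Finset.card_le_card h2
    omega)
  obtain ⟨n, hn⟩ : ∃ n, s ⊆ (f n).1 := by
    choose g hg using fun i : s => Set.mem_iUnion.1 (hs i.2)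
    exact ⟨Finset.univ.sup g, fun i hi =>
      hmono (Finset.le_sup (f := g) (Finset.mem_univ ⟨i, hi⟩)) (hg ⟨i, hi⟩)⟩
  exact hs' (hD _ (f n).2 _ hn)

theorem NoInfinite.mono {F G : Set (Finset I)} (h : NoInfinite G) (hFG : F ⊆ G) :
    NoInfinite F := fun A hA => by
  obtain ⟨s, hs, hs'⟩ := h A hA
  exact ⟨s, hs, fun h => hs' (hFG h)⟩

/-- The rank of a compact hereditary family is the last stage at which `∅` survives. -/
theorem le_rk_iff {F : Set (Finset I)} (hF : Hereditary F) (hc : NoInfinite F) (h0 : ∅ ∈ F)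
    {β : Ordinal.{u}} : β ≤ rk F ↔ ∅ ∈ der F β := by
  set X : Set Ordinal.{u} := {α | CantorBendixson.iteratedDerivedSet (toCantor F) (α + 1) =
    CantorBendixson.iteratedDerivedSet (toCantor F) α} with hX
  have hXmem : ∀ α, α ∈ X ↔ der F (α + 1) = der F α := by
    intro α
    simp only [hX, Set.mem_ofPred_eq, iteratedDerivedSet_toCantor hF]
    exact toCantor_injective.eq_iff
  -- The derivatives stabilize only at the empty family, because a non-empty compact family has a
  -- maximal member, which is isolated.
  have hXempty : ∀ α, α ∈ X ↔ ∅ ∉ der F α := by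
    intro α
    rw [hXmem]
    constructor
    · intro h h1
      obtain ⟨s, hs, hs'⟩ := NoInfinite.exists_maximal (hF.der α) (hc.mono (der_subset F α)) ⟨_, h1⟩
      rw [← h, mem_der_add_one] at hs
      obtain ⟨x, hx, hx'⟩ := hs.2.nonempty
      exact hs' x hx hx'
    · intro h
      have e : der F α = ∅ := by
        by_contra hne
        obtain ⟨s, hs⟩ := Set.nonempty_iff_ne_empty.2 hne
        exact h (hF.der α s hs ∅ (by simp))
      refine Set.Subset.antisymm (der_antitone F (by simp)) (by rw [e]; simp)
  have hXne : X.Nonempty := by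
    obtain ⟨a, ha⟩ := CantorBendixson.iteratedDerivedSet_mem_fixedPoints (toCantor F)
    refine ⟨a, ?_⟩
    rw [hX, Set.mem_ofPred_eq, CantorBendixson.iteratedDerivedSet_succ]
    exact ha
  have hκ : ∀ α, α < cbRank (toCantor F) ↔ ∅ ∈ der F α := by
    intro α
    constructor
    · intro h
      by_contra h1
      exact notMem_of_lt_csInf' h ((hXempty α).2 h1)
    · intro h
      by_contra! h1
      have : cbRank (toCantor F) ∈ X := csInf_mem hXne
      exact (hXempty _).1 this (der_antitone F h1 h)
  -- The first stage that misses `∅` is a successor: at a limit stage `∅` would have survived.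
  have hsucc : ¬ Order.IsSuccPrelimit (cbRank (toCantor F)) := by
    intro hlim
    have h1 : ∅ ∉ der F (cbRank (toCantor F)) := fun h => lt_irrefl _ ((hκ _).2 h)
    refine h1 (mem_der.2 ⟨h0, fun β hβ => ?_⟩)
    have h2 := (hκ _).1 (hlim.succ_lt hβ)
    rw [Order.succ_eq_add_one] at h2
    exact (mem_der_add_one.1 h2).2
  rw [← hκ, rk, ← Order.lt_succ_iff, Ordinal.succ_pred_eq_iff_not_isSuccPrelimit.2 hsucc]

theorem rk_mono {F G : Set (Finset I)} (hF : Hereditary F) (h0 : ∅ ∈ F)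
    (hG : Hereditary G) (hGc : NoInfinite G) (h : F ⊆ G) : rk F ≤ rk G := by
  rw [le_rk_iff hG hGc (h h0)]
  exact der_mono h _ ((le_rk_iff hF (hGc.mono h) h0).1 le_rfl)

end Rank

/-! ### Bounded families -/

section Bounded

variable {I : Type u}

/-- A combinatorial form of the assertion that the rank of `F` is small, which is easier to verify
than a bound on `rk F` and, for epsilon numbers `l` and non-empty compact hereditary families,
equivalent to `rk F < l` (see `Bounded.rk_lt` and `bounded_of_rk`).  Some ordinal-valued function decreases strictly whenever a point is added to a member of `F`,
and its value at `∅` is less than `l`. -/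
def Bounded (F : Set (Finset I)) (l : Ordinal.{u}) : Prop :=
  ∃ o : Finset I → Ordinal.{u},
    (∀ s x, ∀ h : x ∉ s, s.cons x h ∈ F → o (s.cons x h) < o s) ∧ o ∅ < l

theorem Bounded.mono {F G : Set (Finset I)} {l m : Ordinal.{u}} (h : Bounded G l) (hFG : F ⊆ G)
    (hlm : l ≤ m) : Bounded F m := by
  obtain ⟨o, ho, h0⟩ := h
  exact ⟨o, fun s x hx hs => ho s x hx (hFG hs), h0.trans_le hlm⟩

/-- A decreasing function is antitone on a hereditary family. -/
theorem antitone_of_decreasing {F : Set (Finset I)} (hF : Hereditary F)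
    {o : Finset I → Ordinal.{u}}
    (ho : ∀ s x, ∀ h : x ∉ s, s.cons x h ∈ F → o (s.cons x h) < o s) {s t : Finset I}
    (hst : s ⊆ t) (ht : t ∈ F) : o t ≤ o s := by
  classical
  induction t using Finset.strongInduction with
  | H t ih =>
    by_cases h : s = t
    · rw [h]
    · obtain ⟨x, hxt, hxs⟩ := Finset.exists_of_ssubset (hst.ssubset_of_ne h)
      have h1 : s ⊆ t.erase x := fun i hi =>
        Finset.mem_erase.2 ⟨fun h => hxs (h ▸ hi), hst hi⟩
      have h2 := ih (t.erase x) (Finset.erase_ssubset hxt) h1 (hF t ht _ (Finset.erase_subset _ _))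
      have h3 := ho (t.erase x) x (Finset.notMem_erase x t)
      rw [Finset.cons_eq_insert, Finset.insert_erase hxt] at h3
      exact (h3 ht).le.trans h2

theorem Bounded.noInfinite {F : Set (Finset I)} {l : Ordinal.{u}} (h : Bounded F l) :
    NoInfinite F := by
  classical
  obtain ⟨o, ho, -⟩ := h
  intro A hA
  by_contra! hcon
  let e := hA.natEmbedding
  let f : ℕ → Finset I := fun n => (Finset.range n).image (fun i => (e i : I))
  have hinj : Function.Injective (fun i => (e i : I)) := Subtype.val_injective.comp e.injective
  have hlt : ∀ n, o (f (n + 1)) < o (f n) := by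
    intro n
    have hn : (e n : I) ∉ f n := by
      simp only [f, Finset.mem_image, Finset.mem_range, not_exists, not_and]
      intro i hi h
      have := hinj h
      omega
    have : f (n + 1) = (f n).cons _ hn := by
      rw [Finset.cons_eq_insert]
      simp only [f, Finset.range_add_one, Finset.image_insert]
    rw [this]
    refine ho _ _ _ (this ▸ hcon _ ?_)
    intro i hi
    simp only [f, Finset.coe_image, Set.mem_image] at hi
    obtain ⟨k, -, rfl⟩ := hi
    exact (e k).2
  exact (RelEmbedding.natGT (fun n => o (f n)) hlt).not_wellFounded wellFounded_lt

theorem le_of_mem_der {F : Set (Finset I)} {o : Finset I → Ordinal.{u}}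
    (ho : ∀ s x, ∀ h : x ∉ s, s.cons x h ∈ F → o (s.cons x h) < o s) {s : Finset I}
    {β : Ordinal.{u}} (hs : s ∈ der F β) : β ≤ o s := by
  induction β using WellFoundedLT.induction generalizing s with
  | ind β ih =>
    by_contra! hlt
    obtain ⟨x, hx, hx'⟩ := ((mem_der.1 hs).2 _ hlt).nonempty
    exact (ih _ hlt hx').not_gt (ho s x hx (der_subset _ _ hx'))

theorem Bounded.rk_lt {F : Set (Finset I)} {l : Ordinal.{u}} (h : Bounded F l)
    (hF : Hereditary F) (h0 : ∅ ∈ F) : rk F < l := by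
  have hc := h.noInfinite
  obtain ⟨o, ho, hl⟩ := h
  exact (le_of_mem_der ho ((le_rk_iff hF hc h0).1 le_rfl)).trans_lt hl

/-- A compact hereditary family is bounded by any ordinal above `ω * (rk F + 1)`: add to `ω` times
the rank of `s` in `F` the finite number of one-point extensions of `s` that have the same rank. -/
theorem bounded_of_rk {F : Set (Finset I)} (hF : Hereditary F) (hc : NoInfinite F) (h0 : ∅ ∈ F)
    {l : Ordinal.{u}} (hl : ω * (rk F + 1) < l) : Bounded F l := by
  classical
  have hbdd : ∀ s, BddAbove {β | s ∈ der F β} := fun s => ⟨rk F, fun β hβ =>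
    (le_rk_iff hF hc h0).2 (hF.der β s hβ ∅ (by simp))⟩
  -- `ρ s` is the last stage at which `s` survives, and `E s` collects the one-point extensions of `s`
  -- that survive equally long.
  let ρ : Finset I → Ordinal.{u} := fun s => sSup {β | s ∈ der F β}
  have hρ : ∀ s ∈ F, ∀ β, s ∈ der F β ↔ β ≤ ρ s := by
    intro s hs β
    refine ⟨fun h => le_csSup (hbdd s) h, fun h => der_antitone F h ?_⟩
    rw [mem_der]
    refine ⟨hs, fun γ hγ => ?_⟩
    obtain ⟨δ, hδ, hγδ⟩ := exists_lt_of_lt_csSup ⟨0, show s ∈ der F 0 by rwa [der_zero]⟩ hγ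
    exact (mem_der.1 hδ).2 γ hγδ
  let E : Finset I → Set I := fun s => {x | ∃ h : x ∉ s, s.cons x h ∈ der F (ρ s)}
  have hE : ∀ s ∈ F, (E s).Finite := by
    intro s hs
    by_contra hinf
    have h1 : s ∈ der F (ρ s + 1) := mem_der_add_one.2 ⟨hs, hinf⟩
    have := (hρ s hs _).1 h1
    exact absurd this (by simp)
  refine ⟨fun s => ω * ρ s + (E s).ncard, fun s x hx hs => ?_, ?_⟩
  · have hsF : s ∈ F := hF _ hs _ (Finset.subset_cons hx)
    have hle : ρ (s.cons x hx) ≤ ρ s := by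
      rw [← hρ s hsF]
      exact hF.der _ _ ((hρ _ hs _).2 le_rfl) _ (Finset.subset_cons hx)
    rcases hle.lt_or_eq with hlt | heq
    · calc ω * ρ (s.cons x hx) + ((E (s.cons x hx)).ncard : Ordinal)
          < ω * ρ (s.cons x hx) + ω := by
            gcongr
            exact natCast_lt_omega0 _
        _ = ω * (ρ (s.cons x hx) + 1) := by rw [mul_add, mul_one]
        _ ≤ ω * ρ s := by
            gcongr
            exact Order.add_one_le_of_lt hlt
        _ ≤ _ := le_self_add
    · simp only [heq]
      gcongr
      refine Set.ncard_lt_ncard ⟨?_, ?_⟩ (hE s hsF)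
      · rintro y ⟨hy, hy'⟩
        rw [heq] at hy'
        have hys : y ∉ s := fun h => hy (Finset.mem_cons_of_mem h)
        refine ⟨hys, hF.der _ _ hy' _ ?_⟩
        intro i hi
        simp only [Finset.mem_cons] at hi ⊢
        tauto
      · intro h
        have hx1 : x ∈ E s := ⟨hx, by rw [← heq]; exact (hρ _ hs _).2 le_rfl⟩
        obtain ⟨h2, -⟩ := h hx1
        exact h2 (Finset.mem_cons_self x s)
  · refine lt_of_lt_of_le ?_ hl.le
    have : ρ ∅ ≤ rk F := (le_rk_iff hF hc h0).2 ((hρ ∅ h0 _).2 le_rfl)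
    calc ω * ρ ∅ + ((E ∅).ncard : Ordinal) < ω * ρ ∅ + ω := by
            gcongr
            exact natCast_lt_omega0 _
        _ = ω * (ρ ∅ + 1) := by rw [mul_add, mul_one]
        _ ≤ _ := by gcongr

end Bounded

/-! ### Arithmetic of exponentially indecomposable ordinals -/

section Iota

theorem ExpIndecomposable.mul_lt {o β γ : Ordinal.{u}} (ho : ExpIndecomposable o) (hβ : β < o)
    (hγ : γ < o) : β * γ < o := by
  have h2 : (2 : Ordinal.{u}) < o := (natCast_lt_omega0 2).trans_le ho.1
  calc β * γ ≤ max β γ * max β γ := mul_le_mul' (le_max_left _ _) (le_max_right _ _)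
    _ = max β γ ^ (2 : Ordinal) := by
      rw [show (2 : Ordinal.{u}) = ((2 : ℕ) : Ordinal) from rfl, opow_natCast, pow_two]
    _ < o := ho.2 _ (max_lt hβ hγ) _ h2

theorem ExpIndecomposable.add_lt {o β γ : Ordinal.{u}} (ho : ExpIndecomposable o) (hβ : β < o)
    (hγ : γ < o) : β + γ < o := by
  have h2 : (2 : Ordinal.{u}) < o := (natCast_lt_omega0 2).trans_le ho.1
  calc β + γ ≤ max β γ + max β γ := add_le_add (le_max_left _ _) (le_max_right _ _)
    _ = max β γ * 2 := by rw [← one_add_one_eq_two, mul_add, mul_one]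
    _ < o := ho.mul_lt (max_lt hβ hγ) h2

theorem ExpIndecomposable.add_one_lt {o β : Ordinal.{u}} (ho : ExpIndecomposable o) (hβ : β < o) :
    β + 1 < o :=
  ho.add_lt hβ (one_lt_omega0.trans_le ho.1)

theorem expIndecomposable_omega0 : ExpIndecomposable (ω : Ordinal.{u}) :=
  ⟨le_rfl, fun _ hβ _ hγ => isPrincipal_opow_omega0 hβ hγ⟩

/-- An exponentially indecomposable ordinal above `ω`, that is, an epsilon number. -/
def IsEps (l : Ordinal.{u}) : Prop :=
  ExpIndecomposable l ∧ ω < l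

theorem isEps_omega_one : IsEps (ω_ 1 : Ordinal.{u}) :=
  ⟨⟨omega0_lt_omega_one.le, fun _ hβ _ hγ => isPrincipal_opow_omega 1 hβ hγ⟩, omega0_lt_omega_one⟩

theorem iota_le {α o : Ordinal.{u}} (h : α < o) (ho : ExpIndecomposable o) : iota α ≤ o :=
  csInf_le' ⟨h, ho⟩

theorem iota_spec {α : Ordinal.{u}} (h : α < ω_ 1) : α < iota α ∧ ExpIndecomposable (iota α) :=
  csInf_mem (s := {o | α < o ∧ ExpIndecomposable o}) ⟨ω_ 1, h, isEps_omega_one.1⟩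

theorem iota_le_omega_one {α : Ordinal.{u}} (h : α < ω_ 1) : iota α ≤ ω_ 1 :=
  iota_le h isEps_omega_one.1

theorem iota_mono {α β : Ordinal.{u}} (h : α ≤ β) (hβ : β < ω_ 1) : iota α ≤ iota β :=
  iota_le (h.trans_lt (iota_spec hβ).1) (iota_spec hβ).2

theorem iota_le_iota {α β : Ordinal.{u}} (h : α < iota β) (hβ : β < ω_ 1) : iota α ≤ iota β :=
  iota_le h (iota_spec hβ).2

theorem iota_of_lt_omega0 {α : Ordinal.{u}} (h : α < ω) : iota α = ω :=
  (iota_le h expIndecomposable_omega0).antisymm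
    (iota_spec (h.trans omega0_lt_omega_one)).2.1

theorem isEps_iota {α : Ordinal.{u}} (h : ω ≤ α) (hα : α < ω_ 1) : IsEps (iota α) :=
  ⟨(iota_spec hα).2, h.trans_lt (iota_spec hα).1⟩

theorem IsEps.mul_omega0_lt {l β : Ordinal.{u}} (hl : IsEps l) (hβ : β < l) :
    ω * (β + 1) < l :=
  hl.1.mul_lt hl.2 (hl.1.add_one_lt hβ)

end Iota

/-! ### The small rank -/

section SmallRank

variable {I : Type u} {r : I → I → Prop}

theorem Hereditary.restrict {F : Set (Finset I)} (hF : Hereditary F) (C : Set I) :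
    Hereditary (restrict F C) := fun s hs t hts =>
  ⟨hF s hs.1 t hts, (Finset.coe_subset.2 hts).trans hs.2⟩

theorem restrict_subset (F : Set (Finset I)) (C : Set I) : restrict F C ⊆ F := fun _ hs => hs.1

theorem empty_mem_restrict {F : Set (Finset I)} (h0 : ∅ ∈ F) (C : Set I) : ∅ ∈ restrict F C :=
  ⟨h0, by simp⟩

theorem srk_le {F : Set (Finset I)} {C : Set I} (hC : C.Infinite) (hr : IsChain r C) :
    srk r F ≤ rk (restrict F C) :=
  csInf_le' ⟨C, hC, hr, rfl⟩

theorem le_srk (hi : HasInfiniteChain r) {F : Set (Finset I)} {β : Ordinal.{u}}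
    (h : ∀ C : Set I, C.Infinite → IsChain r C → β ≤ rk (restrict F C)) : β ≤ srk r F := by
  obtain ⟨C, hC, hr⟩ := hi
  refine le_csInf ⟨_, C, hC, hr, rfl⟩ ?_
  rintro _ ⟨D, hD, hrD, rfl⟩
  exact h D hD hrD

theorem srk_le_rk (hi : HasInfiniteChain r) {F : Set (Finset I)} (hF : Hereditary F)
    (hc : NoInfinite F) (h0 : ∅ ∈ F) : srk r F ≤ rk F := by
  obtain ⟨C, hC, hr⟩ := hi
  exact (srk_le hC hr).trans (rk_mono (hF.restrict C) (empty_mem_restrict h0 C) hF hc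
    (restrict_subset F C))

theorem srk_mono (hi : HasInfiniteChain r) {F G : Set (Finset I)} (hF : Hereditary F)
    (h0 : ∅ ∈ F) (hG : Hereditary G) (hGc : NoInfinite G) (h : F ⊆ G) : srk r F ≤ srk r G :=
  le_srk hi fun C hC hr => (srk_le hC hr).trans <|
    rk_mono (hF.restrict C) (empty_mem_restrict h0 C) (hG.restrict C)
      (hGc.mono (restrict_subset G C)) fun _ hs => ⟨h hs.1, hs.2⟩

theorem one_le_srk (hi : HasInfiniteChain r) {F : Set (Finset I)} (hF : Hereditary F)
    (hc : NoInfinite F) (h1 : {s : Finset I | s.card ≤ 1} ⊆ F) : 1 ≤ srk r F := by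
  refine le_srk hi fun C hC hr => ?_
  have h0 : ∅ ∈ F := h1 (by simp)
  rw [le_rk_iff (hF.restrict C) (hc.mono (restrict_subset F C)) (empty_mem_restrict h0 C),
    ← zero_add (1 : Ordinal), mem_der_add_one]
  refine ⟨empty_mem_restrict h0 C, hC.mono fun x hx => ⟨by simp, ?_⟩⟩
  rw [der_zero]
  exact ⟨h1 (by simp), by simpa using hx⟩

theorem srk_singleton_empty (hi : HasInfiniteChain r) : srk r ({∅} : Set (Finset I)) = 0 := by
  obtain ⟨C, hC, hr⟩ := hi
  have hF : Hereditary ({∅} : Set (Finset I)) := by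
    rintro s rfl t ht
    exact Finset.subset_empty.1 ht
  have hc : NoInfinite ({∅} : Set (Finset I)) := fun A hA => by
    obtain ⟨x, hx⟩ := hA.nonempty
    exact ⟨{x}, by simpa using hx, by simp⟩
  refine nonpos_iff_eq_zero.1 ((srk_le_rk ⟨C, hC, hr⟩ hF hc rfl).trans ?_)
  by_contra! h
  have := (le_rk_iff hF hc rfl).1 (Order.one_le_iff_pos.2 h)
  rw [← zero_add (1 : Ordinal), mem_der_add_one, der_zero] at this
  obtain ⟨x, hx, hx'⟩ := this.2.nonempty
  simp at hx'

/-- A compact hereditary family that contains the singletons and whose rank is countable and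
smaller than `iota` of its small rank is homogeneous. -/
theorem isHomogeneous_of_rk_lt (hi : HasInfiniteChain r) {F : Set (Finset I)} (hr : OnChains r F)
    (hF : Hereditary F) (hc : NoInfinite F) (h1 : {s : Finset I | s.card ≤ 1} ⊆ F)
    (hω : rk F < ω_ 1) (hlt : rk F < iota (srk r F)) : IsHomogeneous r F := by
  have hle := srk_le_rk hi hF hc (h1 (by simp))
  refine ⟨srk r F, hle.trans_lt hω, hr, (isCompactFamily_iff hF).2 hc, hF, fun h => ?_,
    fun _ => ⟨h1, rfl, hle, hlt⟩⟩
  have := one_le_srk hi hF hc h1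
  rw [h] at this
  exact absurd this (by simp)

theorem isHomogeneous_singleton_empty : IsHomogeneous r ({∅} : Set (Finset I)) := by
  have hF : Hereditary ({∅} : Set (Finset I)) := by
    rintro s rfl t ht
    exact Finset.subset_empty.1 ht
  have hc : NoInfinite ({∅} : Set (Finset I)) := fun A hA => by
    obtain ⟨x, hx⟩ := hA.nonempty
    exact ⟨{x}, by simpa using hx, by simp⟩
  exact ⟨0, (omega_pos 1), by rintro s rfl; simp, (isCompactFamily_iff hF).2 hc, hF, fun _ => rfl,
    fun h => absurd h (by simp)⟩

/-- The two shapes of a homogeneous family. -/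
theorem IsHomogeneous.cases {F : Set (Finset I)} (h : IsHomogeneous r F) :
    F = {∅} ∨ ({s : Finset I | s.card ≤ 1} ⊆ F ∧ srk r F ≤ rk F ∧ rk F < iota (srk r F) ∧
      1 ≤ srk r F ∧ srk r F < ω_ 1) := by
  obtain ⟨α, hα, h⟩ := h
  rcases eq_or_ne α 0 with h0 | h0
  · exact Or.inl (h.eq_of_zero h0)
  · have h1 := Order.one_le_iff_ne_zero.2 h0
    obtain ⟨h2, h3, h4, h5⟩ := h.of_pos h1
    exact Or.inr ⟨h2, h4, h3 ▸ h5, h3 ▸ h1, h3 ▸ hα⟩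

theorem IsHomogeneous.onChains {F : Set (Finset I)} (h : IsHomogeneous r F) : OnChains r F := by
  obtain ⟨α, hα, h⟩ := h
  exact h.onChains

theorem IsHomogeneous.hereditary {F : Set (Finset I)} (h : IsHomogeneous r F) : Hereditary F := by
  obtain ⟨α, hα, h⟩ := h
  exact h.hereditary

theorem IsHomogeneous.noInfinite {F : Set (Finset I)} (h : IsHomogeneous r F) : NoInfinite F := by
  obtain ⟨α, hα, h⟩ := h
  exact (isCompactFamily_iff h.hereditary).1 h.compact

theorem IsHomogeneous.empty_mem {F : Set (Finset I)} (h : IsHomogeneous r F) : ∅ ∈ F := by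
  rcases h.cases with rfl | h
  · rfl
  · exact h.1 (by simp)

theorem IsHomogeneous.srk_lt (hi : HasInfiniteChain r) {F : Set (Finset I)}
    (h : IsHomogeneous r F) : srk r F < ω_ 1 := by
  rcases h.cases with rfl | h
  · rw [srk_singleton_empty hi]
    exact omega_pos 1
  · exact h.2.2.2.2

theorem IsHomogeneous.rk_lt (hi : HasInfiniteChain r) {F : Set (Finset I)}
    (h : IsHomogeneous r F) : rk F < iota (srk r F) := by
  rcases h.cases with rfl | h'
  · refine lt_of_le_of_lt ?_ (iota_spec (h.srk_lt hi)).1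
    rw [srk_singleton_empty hi]
    by_contra! h1
    have := (le_rk_iff h.hereditary h.noInfinite rfl).1 (Order.one_le_iff_pos.2 h1)
    rw [← zero_add (1 : Ordinal), mem_der_add_one, der_zero] at this
    obtain ⟨x, hx, hx'⟩ := this.2.nonempty
    simp at hx'
  · exact h'.2.2.1

/-- Homogeneity bounds a family by every epsilon number above its small rank. -/
theorem IsHomogeneous.bounded (hi : HasInfiniteChain r) {F : Set (Finset I)}
    (h : IsHomogeneous r F) {l : Ordinal.{u}} (hl : IsEps l) (hsrk : iota (srk r F) ≤ l) :
    Bounded F l :=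
  bounded_of_rk h.hereditary h.noInfinite h.empty_mem
    (hl.mul_omega0_lt ((h.rk_lt hi).trans_le hsrk))

end SmallRank

/-! ### Copies of families on `ω` -/

section Copies

variable {I : Type u}

/-- The copy of a family on `ω` under an injection. -/
def copy (e : ℕ ↪ I) (H : Set (Finset ℕ)) : Set (Finset I) :=
  Finset.map e '' H

theorem mem_copy {e : ℕ ↪ I} {H : Set (Finset ℕ)} {s : Finset ℕ} : s.map e ∈ copy e H ↔ s ∈ H :=
  (Finset.map_injective e).mem_set_image

theorem mem_der_copy {e : ℕ ↪ I} {H : Set (Finset ℕ)} {β : Ordinal.{0}} {s : Finset ℕ} :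
    s.map e ∈ der (copy e H) (Ordinal.lift.{u} β) ↔ s ∈ der H β := by
  induction β using WellFoundedLT.induction generalizing s with
  | ind β ih =>
    have key : ∀ γ < β, {x | ∃ h : x ∉ s.map e, (s.map e).cons x h ∈
        der (copy e H) (Ordinal.lift.{u} γ)} = e '' {x | ∃ h : x ∉ s, s.cons x h ∈ der H γ} := by
      intro γ hγ
      ext x
      constructor
      · rintro ⟨hx, hx'⟩
        obtain ⟨t, ht, hte⟩ := der_subset _ _ hx'
        have : x ∈ t.map e := by rw [hte]; exact Finset.mem_cons_self x _
        obtain ⟨y, hy, rfl⟩ := Finset.mem_map.1 this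
        have hys : y ∉ s := fun h => hx (Finset.mem_map_of_mem e h)
        refine ⟨y, ⟨hys, (ih γ hγ).1 ?_⟩, rfl⟩
        rwa [Finset.map_cons]
      · rintro ⟨y, ⟨hy, hy'⟩, rfl⟩
        refine ⟨by simpa using hy, ?_⟩
        have := (ih γ hγ).2 hy'
        rwa [Finset.map_cons] at this
    rw [mem_der, mem_der, mem_copy]
    refine and_congr_right fun _ => ⟨fun h γ hγ => ?_, fun h γ hγ => ?_⟩
    · have := h _ (Ordinal.lift_lt.2 hγ)
      rw [key γ hγ] at this
      exact this.of_image
    · obtain ⟨δ, rfl⟩ := Ordinal.mem_range_lift_of_le hγ.le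
      rw [key δ (Ordinal.lift_lt.1 hγ)]
      exact (h δ (Ordinal.lift_lt.1 hγ)).image e.injective.injOn

theorem Hereditary.copy {H : Set (Finset ℕ)} (hH : Hereditary H) (e : ℕ ↪ I) :
    Hereditary (copy e H) := by
  classical
  rintro _ ⟨s, hs, rfl⟩ t ht
  obtain ⟨u, hu, rfl⟩ := Finset.subset_map_iff.1 ht
  exact mem_copy.2 (hH s hs u hu)

theorem NoInfinite.copy {H : Set (Finset ℕ)} (hH : NoInfinite H) (e : ℕ ↪ I) :
    NoInfinite (copy e H) := by
  intro A hA
  by_cases hAr : A ⊆ Set.range e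
  · obtain ⟨s, hs, hs'⟩ := hH (e ⁻¹' A) (hA.preimage hAr)
    refine ⟨s.map e, ?_, fun h => hs' (mem_copy.1 h)⟩
    rw [Finset.coe_map]
    exact Set.image_subset_iff.2 hs
  · obtain ⟨a, ha, ha'⟩ := Set.not_subset.1 hAr
    refine ⟨{a}, by simpa using ha, ?_⟩
    rintro ⟨t, ht, hte⟩
    have : a ∈ t.map e := by rw [hte]; simp
    obtain ⟨y, -, rfl⟩ := Finset.mem_map.1 this
    exact ha' ⟨y, rfl⟩

theorem rk_copy {H : Set (Finset ℕ)} (hH : Hereditary H) (hc : NoInfinite H) (h0 : ∅ ∈ H)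
    (e : ℕ ↪ I) : rk (copy e H) = Ordinal.lift.{u} (rk H) := by
  have h0' : ∅ ∈ copy e H := ⟨∅, h0, rfl⟩
  have key : ∀ β : Ordinal.{0}, Ordinal.lift.{u} β ≤ rk (copy e H) ↔ β ≤ rk H := by
    intro β
    rw [le_rk_iff (hH.copy e) (hc.copy e) h0', le_rk_iff hH hc h0, ← mem_der_copy (e := e),
      Finset.map_empty]
  refine le_antisymm ?_ ((key _).2 le_rfl)
  by_contra! h
  have h2 := (key (rk H + 1)).1 (by
    rw [Ordinal.lift_add, Ordinal.lift_one]
    exact Order.add_one_le_of_lt h)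
  exact absurd h2 (by simp)

end Copies

/-! ### Joins -/

section Join

variable {I : Type u} {r : I → I → Prop}

theorem mem_chainJoin_of_subset [DecidableEq I] {F G : Set (Finset I)} (hF : Hereditary F)
    (hG : Hereditary G) {s t w : Finset I} (hs : s ∈ F) (ht : t ∈ G) (hw : IsChain r (w : Set I))
    (h : w ⊆ s ∪ t) : w ∈ chainJoin r F G := by
  refine ⟨hw, w ∩ s, hF s hs _ Finset.inter_subset_right, w ∩ t,
    hG t ht _ Finset.inter_subset_right, ?_⟩
  rw [← Finset.coe_union, ← Finset.inter_union_distrib_left, Finset.inter_eq_left.2 h]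

theorem chainJoin_hereditary {F G : Set (Finset I)} (hF : Hereditary F) (hG : Hereditary G) :
    Hereditary (chainJoin r F G) := by
  classical
  rintro w ⟨hw, s, hs, t, ht, h⟩ v hv
  refine mem_chainJoin_of_subset hF hG hs ht (hw.mono (Finset.coe_subset.2 hv)) (hv.trans ?_)
  rw [← Finset.coe_subset, h, Finset.coe_union]

theorem subset_chainJoin_left {F G : Set (Finset I)} (hF : OnChains r F) (h0 : ∅ ∈ G) :
    F ⊆ chainJoin r F G := fun s hs => ⟨hF s hs, s, hs, ∅, h0, by simp⟩

theorem subset_chainJoin_right {F G : Set (Finset I)} (hG : OnChains r G) (h0 : ∅ ∈ F) :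
    G ⊆ chainJoin r F G := fun s hs => ⟨hG s hs, ∅, h0, s, hs, by simp⟩

theorem chainJoin_mono {F G F' G' : Set (Finset I)} (hF : F ⊆ F') (hG : G ⊆ G') :
    chainJoin r F G ⊆ chainJoin r F' G' := by
  rintro w ⟨hw, s, hs, t, ht, h⟩
  exact ⟨hw, s, hF hs, t, hG ht, h⟩

/-- `k * max a b + min a b` is strictly increasing in the pair `(a, b)` of ordinals below `k`. -/
theorem mul_max_add_min_lt {k a b a' b' : Ordinal.{u}} (ha : a ≤ a') (hb : b ≤ b')
    (h : a < a' ∨ b < b') (ha' : a' < k) :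
    k * max a b + min a b < k * max a' b' + min a' b' := by
  have hmax : max a b ≤ max a' b' := max_le_max ha hb
  have hmin : min a b ≤ min a' b' := min_le_min ha hb
  rcases hmax.lt_or_eq with hlt | heq
  · calc k * max a b + min a b < k * max a b + k := by
          gcongr
          exact (min_le_left _ _).trans_lt (ha.trans_lt ha')
      _ = k * (max a b + 1) := by rw [mul_add, mul_one]
      _ ≤ k * max a' b' := by
          gcongr
          exact Order.add_one_le_of_lt hlt
      _ ≤ _ := le_self_add
  · rw [heq]
    gcongr
    grind

/-- A bound for a join: combine bounds `a` and `b` of the two families into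
`k * max (a f) (b g) + min (a f) (b g)` and take the greatest of these values over all the finitely
many decompositions `s = f ∪ g`. -/
theorem bounded_chainJoin {F G : Set (Finset I)} (hF : Hereditary F) (hG : Hereditary G)
    {l : Ordinal.{u}} (hl : IsEps l) (hFl : Bounded F l) (hGl : Bounded G l) :
    Bounded (chainJoin r F G) l := by
  classical
  obtain ⟨a, ha, ha0⟩ := hFl
  obtain ⟨b, hb, hb0⟩ := hGl
  set k := max (a ∅) (b ∅) + 1 with hk
  have hak : ∀ f ∈ F, a f < k := fun f hf => Order.lt_add_one_iff.2 <|
    (antitone_of_decreasing hF ha (Finset.empty_subset f) hf).trans (le_max_left _ _)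
  have hbk : ∀ f ∈ G, b f < k := fun f hf => Order.lt_add_one_iff.2 <|
    (antitone_of_decreasing hG hb (Finset.empty_subset f) hf).trans (le_max_right _ _)
  let v : Finset I × Finset I → Ordinal.{u} := fun p =>
    k * max (a p.1) (b p.2) + min (a p.1) (b p.2)
  let Q : Finset I → Finset (Finset I × Finset I) := fun s =>
    (s.powerset ×ˢ s.powerset).filter fun p => p.1 ∈ F ∧ p.2 ∈ G ∧ p.1 ∪ p.2 = s
  have hQ : ∀ s f g, (f, g) ∈ Q s ↔ f ∈ F ∧ g ∈ G ∧ f ∪ g = s := by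
    intro s f g
    simp only [Q, Finset.mem_filter, Finset.mem_product, Finset.mem_powerset]
    refine ⟨fun h => h.2, fun h => ⟨?_, h⟩⟩
    rw [← h.2.2]
    exact ⟨Finset.subset_union_left, Finset.subset_union_right⟩
  have hkl : k < l := hl.1.add_one_lt (max_lt ha0 hb0)
  refine ⟨fun s => (Q s).sup v, fun s x hx hs => ?_, ?_⟩
  -- Deleting `x` from the best decomposition of `s ∪ {x}` gives a decomposition of `s` with a greater
  -- value.
  · obtain ⟨-, f₀, hf₀, g₀, hg₀, h₀⟩ := hs
    have hne : (Q (s.cons x hx)).Nonempty := ⟨(f₀, g₀), (hQ _ _ _).2 ⟨hf₀, hg₀, by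
      rw [← Finset.coe_inj, Finset.coe_union, h₀]⟩⟩
    obtain ⟨⟨f, g⟩, hfg, hsup⟩ := Finset.exists_mem_eq_sup _ hne v
    change (Q (s.cons x hx)).sup v < _
    rw [hsup]
    obtain ⟨hf, hg, hfgs⟩ := (hQ _ _ _).1 hfg
    have hf' : f.erase x ∈ F := hF f hf _ (Finset.erase_subset _ _)
    have hg' : g.erase x ∈ G := hG g hg _ (Finset.erase_subset _ _)
    refine lt_of_lt_of_le ?_ (Finset.le_sup (f := v) ((hQ s (f.erase x) (g.erase x)).2
      ⟨hf', hg', ?_⟩))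
    · refine mul_max_add_min_lt
        (antitone_of_decreasing hF ha (Finset.erase_subset _ _) hf)
        (antitone_of_decreasing hG hb (Finset.erase_subset _ _) hg) ?_ (hak _ hf')
      have hxfg : x ∈ f ∪ g := by rw [hfgs]; exact Finset.mem_cons_self x s
      rcases Finset.mem_union.1 hxfg with h | h
      · have := ha (f.erase x) x (Finset.notMem_erase x f)
        rw [Finset.cons_eq_insert, Finset.insert_erase h] at this
        exact Or.inl (this hf)
      · have := hb (g.erase x) x (Finset.notMem_erase x g)
        rw [Finset.cons_eq_insert, Finset.insert_erase h] at this
        exact Or.inr (this hg)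
    · rw [← Finset.erase_union_distrib, hfgs, Finset.cons_eq_insert, Finset.erase_insert hx]
  · have hlpos : (⊥ : Ordinal.{u}) < l := (bot_le).trans_lt ha0
    rw [Finset.sup_lt_iff hlpos]
    rintro ⟨f, g⟩ hfg
    obtain ⟨hf, hg, -⟩ := (hQ _ _ _).1 hfg
    have h1 : a f < l := (hak f hf).trans hkl
    have h2 : b g < l := (hbk g hg).trans hkl
    exact hl.1.add_lt (hl.1.mul_lt hkl (max_lt h1 h2)) ((min_le_left _ _).trans_lt h1)

end Join

/-! ### Uniform families -/

section Uniform

theorem IsUniform.empty_mem {α : Ordinal.{0}} {M : Set ℕ} {F : Set (Finset ℕ)}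
    (h : IsUniform α M F) : ∅ ∈ F := by
  cases h with
  | zero => rfl
  | succ β M F on h0 => exact h0
  | limit α M F hα on h0 => exact h0

theorem IsUniform.eq_singleton {M : Set ℕ} {F : Set (Finset ℕ)} (h : IsUniform 0 M F) :
    F = {∅} := by
  generalize h0 : (0 : Ordinal.{0}) = α at h
  cases h with
  | zero => rfl
  | succ β M F on h0' => exact absurd h0.symm (by simp)
  | limit α M F hα on => exact absurd h0.symm hα.ne_bot

theorem IsUniform.singleton_mem {α : Ordinal.{0}} {M : Set ℕ} {F : Set (Finset ℕ)}
    (h : IsUniform α M F) (hα : α ≠ 0) {n : ℕ} (hn : n ∈ M) : {n} ∈ F := by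
  cases h with
  | zero => exact absurd rfl hα
  | succ β M F on h0 sec => exact (sec n hn).empty_mem.2
  | limit α M F hα on h0 a lt mono lub sec => exact (sec n hn).empty_mem.2

theorem infinite_inter_Ioi {M : Set ℕ} (hM : M.Infinite) (n : ℕ) : (M ∩ Set.Ioi n).Infinite := by
  have : M ∩ Set.Ioi n = M \ Set.Iic n := by ext; simp
  rw [this]
  exact hM.sdiff (Set.finite_Iic n)

theorem section_restrict {F : Set (Finset ℕ)} {N : Set ℕ} {n : ℕ} (hn : n ∈ N) :
    section_ (restrict F N) n = restrict (section_ F n) (N ∩ Set.Ioi n) := by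
  ext s
  simp only [section_, restrict, Set.mem_ofPred_eq, Finset.coe_insert, Set.insert_subset_iff,
    Set.subset_inter_iff, hn, true_and]
  constructor
  · rintro ⟨h1, h2, h3⟩
    exact ⟨⟨h1, h2⟩, h3, h1⟩
  · rintro ⟨⟨h1, h2⟩, h3, -⟩
    exact ⟨h1, h2, h3⟩

theorem IsUniform.restrict {α : Ordinal.{0}} {M : Set ℕ} {F : Set (Finset ℕ)}
    (h : IsUniform α M F) {N : Set ℕ} (hN : N ⊆ M) (hNi : N.Infinite) :
    IsUniform α N (FinFamily.restrict F N) := by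
  induction h generalizing N with
  | zero M =>
    have : FinFamily.restrict ({∅} : Set (Finset ℕ)) N = {∅} := by
      ext s
      constructor
      · exact fun h => h.1
      · rintro rfl
        exact ⟨rfl, by simp⟩
    rw [this]
    exact .zero N
  | succ β M F on h0 sec ih =>
    refine .succ β N _ (fun s hs => hs.2) (empty_mem_restrict h0 N) fun n hn => ?_
    rw [section_restrict hn]
    exact ih n (hN hn) (Set.inter_subset_inter_left _ hN) (infinite_inter_Ioi hNi n)
  | limit α M F hα on h0 a lt mono lub sec ih =>
    refine .limit α N _ hα (fun s hs => hs.2) (empty_mem_restrict h0 N) a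
      (fun n hn => lt n (hN hn)) (mono.mono hN) ⟨?_, ?_⟩ fun n hn => ?_
    · rintro _ ⟨n, hn, rfl⟩
      exact (lt n (hN hn)).le
    · intro b hb
      refine lub.2 ?_
      rintro _ ⟨m, hm, rfl⟩
      obtain ⟨n, hn, hmn⟩ := hNi.exists_gt m
      exact (mono hm (hN hn) hmn.le).trans (hb ⟨n, hn, rfl⟩)
    · rw [section_restrict hn]
      exact ih n (hN hn) (Set.inter_subset_inter_left _ hN) (infinite_inter_Ioi hNi n)

theorem noInfinite_of_section {M : Set ℕ} {F : Set (Finset ℕ)} (on : ∀ s ∈ F, (s : Set ℕ) ⊆ M)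
    (h : ∀ n ∈ M, NoInfinite (section_ F n)) : NoInfinite F := by
  intro A hA
  by_cases hAM : A ⊆ M
  · obtain ⟨n, hn⟩ := hA.nonempty
    obtain ⟨s, hs, hs'⟩ := h n (hAM hn) _ (infinite_inter_Ioi hA n)
    refine ⟨insert n s, ?_, fun hF => hs' ⟨fun m hm => (hs hm).2, hF⟩⟩
    rw [Finset.coe_insert]
    exact Set.insert_subset hn fun m hm => (hs hm).1
  · obtain ⟨a, ha, haM⟩ := Set.not_subset.1 hAM
    exact ⟨{a}, by simpa using ha, fun h => haM (on _ h (by simp))⟩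

theorem IsUniform.noInfinite {α : Ordinal.{0}} {M : Set ℕ} {F : Set (Finset ℕ)}
    (h : IsUniform α M F) : NoInfinite F := by
  induction h with
  | zero M =>
    intro A hA
    obtain ⟨x, hx⟩ := hA.nonempty
    exact ⟨{x}, by simpa using hx, by simp⟩
  | succ β M F on h0 sec ih => exact noInfinite_of_section on ih
  | limit α M F hα on h0 a lt mono lub sec ih => exact noInfinite_of_section on ih

/-- Derivatives commute with sections, as only finitely many points lie below `n`. -/
theorem insert_mem_der_iff {F : Set (Finset ℕ)} {n : ℕ} {β : Ordinal.{0}} {s : Finset ℕ}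
    (hs : ∀ m ∈ s, n < m) : insert n s ∈ der F β ↔ s ∈ der (section_ F n) β := by
  induction β using WellFoundedLT.induction generalizing s with
  | ind β ih =>
    rw [mem_der, mem_der]
    refine and_congr ⟨fun h => ⟨hs, h⟩, fun h => h.2⟩ (forall₂_congr fun γ hγ => ?_)
    have key : ∀ x, n < x → ((∃ h : x ∉ insert n s, (insert n s).cons x h ∈ der F γ) ↔
        ∃ h : x ∉ s, s.cons x h ∈ der (section_ F n) γ) := by
      intro x hx
      have hxn : x ∉ insert n s ↔ x ∉ s := by
        simp [hx.ne']
      constructor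
      · rintro ⟨h, h'⟩
        refine ⟨hxn.1 h, (ih γ hγ ?_).1 ?_⟩
        · intro m hm
          rcases Finset.mem_cons.1 hm with rfl | hm
          exacts [hx, hs m hm]
        · rwa [Finset.cons_eq_insert, Finset.insert_comm, ← Finset.cons_eq_insert _ _ h]
      · rintro ⟨h, h'⟩
        have := (ih γ hγ (s := s.cons x h) (by
          intro m hm
          rcases Finset.mem_cons.1 hm with rfl | hm
          exacts [hx, hs m hm])).2 h'
        refine ⟨hxn.2 h, ?_⟩
        rwa [Finset.cons_eq_insert, Finset.insert_comm, ← Finset.cons_eq_insert _ _ h]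
    constructor
    · intro h
      refine (infinite_inter_Ioi h n).mono ?_
      rintro x ⟨hx, hxn⟩
      exact (key x hxn).1 hx
    · intro h
      refine h.mono ?_
      rintro x ⟨hx, hx'⟩
      have hnx : n < x := (der_subset _ _ hx').1 x (Finset.mem_cons_self x s)
      exact (key x hnx).2 ⟨hx, hx'⟩

theorem empty_mem_der_iff {F : Set (Finset ℕ)} {M : Set ℕ} (on : ∀ s ∈ F, (s : Set ℕ) ⊆ M)
    (h0 : ∅ ∈ F) {β : Ordinal.{0}} :
    ∅ ∈ der F β ↔ ∀ γ < β, {n | n ∈ M ∧ ∅ ∈ der (section_ F n) γ}.Infinite := by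
  rw [mem_der]
  simp only [h0, true_and]
  refine forall₂_congr fun γ hγ => ?_
  have : {x | ∃ h : x ∉ (∅ : Finset ℕ), (∅ : Finset ℕ).cons x h ∈ der F γ} =
      {n | n ∈ M ∧ ∅ ∈ der (section_ F n) γ} := by
    ext n
    simp only [Set.mem_ofPred_eq]
    rw [← insert_mem_der_iff (by simp)]
    constructor
    · rintro ⟨h, h'⟩
      rw [Finset.cons_eq_insert] at h'
      exact ⟨on _ (der_subset _ _ h') (by simp), h'⟩
    · rintro ⟨-, h'⟩
      exact ⟨by simp, by rwa [Finset.cons_eq_insert]⟩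
  rw [this]

/-- An `α`-uniform family on an infinite set has rank `α`. -/
theorem IsUniform.empty_mem_der {α : Ordinal.{0}} {M : Set ℕ} {F : Set (Finset ℕ)}
    (h : IsUniform α M F) (hM : M.Infinite) {β : Ordinal.{0}} : ∅ ∈ der F β ↔ β ≤ α := by
  induction h generalizing β with
  | zero M =>
    rw [nonpos_iff_eq_zero]
    constructor
    · intro h
      by_contra hβ
      obtain ⟨x, hx, hx'⟩ := ((mem_der.1 h).2 0 (pos_iff_ne_zero.2 hβ)).nonempty
      have := der_subset _ _ hx'
      simp at this
    · rintro rfl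
      rw [der_zero]
      rfl
  | succ α M F on h0 sec ih =>
    rw [empty_mem_der_iff on h0]
    have key : ∀ γ, {n | n ∈ M ∧ ∅ ∈ der (section_ F n) γ}.Infinite ↔ γ ≤ α := by
      intro γ
      constructor
      · intro h
        obtain ⟨n, hn, hn'⟩ := h.nonempty
        exact (ih n hn (infinite_inter_Ioi hM n)).1 hn'
      · intro h
        exact hM.mono fun n hn => ⟨hn, (ih n hn (infinite_inter_Ioi hM n)).2 h⟩
    simp only [key]
    constructor
    · intro h
      by_contra! hlt
      exact absurd (h (α + 1) hlt) (by simp)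
    · intro h γ hγ
      exact Order.lt_add_one_iff.1 (hγ.trans_le h)
  | limit α M F hα on h0 a lt mono lub sec ih =>
    rw [empty_mem_der_iff on h0]
    have key : ∀ γ, {n | n ∈ M ∧ ∅ ∈ der (section_ F n) γ}.Infinite ↔ γ < α := by
      intro γ
      constructor
      · intro h
        obtain ⟨n, hn, hn'⟩ := h.nonempty
        exact ((ih n hn (infinite_inter_Ioi hM n)).1 hn').trans_lt (lt n hn)
      · intro h
        obtain ⟨_, ⟨m, hm, rfl⟩, hγ⟩ := (lt_isLUB_iff lub).1 h
        refine (infinite_inter_Ioi hM m).mono fun n hn => ⟨hn.1, ?_⟩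
        exact (ih n hn.1 (infinite_inter_Ioi hM n)).2 (hγ.le.trans (mono hm hn.1 (le_of_lt hn.2)))
    simp only [key]
    constructor
    · intro h
      by_contra! hlt
      exact lt_irrefl _ (h α hlt)
    · intro h γ hγ
      exact hγ.trans_le h

theorem rk_restrict_of_isUniform {α : Ordinal.{0}} {H : Set (Finset ℕ)} (hH : Hereditary H)
    (h : IsUniform α Set.univ H) {N : Set ℕ} (hN : N.Infinite) : rk (restrict H N) = α := by
  have h' := h.restrict (Set.subset_univ N) hN
  refine eq_of_forall_le_iff fun β => ?_
  rw [le_rk_iff (hH.restrict N) h'.noInfinite h'.empty_mem, h'.empty_mem_der hN]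

theorem isChain_lt_nat (s : Set ℕ) : IsChain (fun m n : ℕ => m < n) s :=
  fun _ _ _ _ h => lt_or_gt_of_ne h

theorem srk_of_isUniform {α : Ordinal.{0}} {H : Set (Finset ℕ)} (hH : Hereditary H)
    (h : IsUniform α Set.univ H) : srk (fun m n : ℕ => m < n) H = α := by
  refine le_antisymm ((srk_le Set.infinite_univ (isChain_lt_nat _)).trans_eq
    (rk_restrict_of_isUniform hH h Set.infinite_univ)) ?_
  exact le_srk ⟨_, Set.infinite_univ, isChain_lt_nat _⟩ fun C hC _ =>
    (rk_restrict_of_isUniform hH h hC).ge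

theorem rk_of_isUniform {α : Ordinal.{0}} {H : Set (Finset ℕ)} (hH : Hereditary H)
    (h : IsUniform α Set.univ H) : rk H = α := by
  have := rk_restrict_of_isUniform hH h Set.infinite_univ
  rwa [show restrict H Set.univ = H by ext s; simp [restrict]] at this

theorem IsUniform.card_le {α : Ordinal.{0}} {M : Set ℕ} {F : Set (Finset ℕ)}
    (h : IsUniform α M F) {k : ℕ} (hk : α ≤ k) : ∀ s ∈ F, s.card ≤ k := by
  induction h generalizing k with
  | zero M => rintro s rfl; simp
  | succ β M F on h0 sec ih =>
    intro s hs
    rcases s.eq_empty_or_nonempty with rfl | hne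
    · simp
    · obtain _ | k := k
      · exact absurd hk (by simp)
      · have hmem := s.min'_mem hne
        have h1 : s.erase (s.min' hne) ∈ section_ F (s.min' hne) :=
          ⟨fun m hm => s.min'_lt_of_mem_erase_min' hne hm, by rwa [Finset.insert_erase hmem]⟩
        have hβ : β ≤ (k : Ordinal) := by
          rw [Nat.cast_succ] at hk
          rwa [← Order.succ_eq_add_one, ← Order.succ_eq_add_one, Order.succ_le_succ_iff] at hk
        have := ih _ (on s hs hmem) hβ _ h1
        rw [Finset.card_erase_of_mem hmem] at this
        omega
  | limit α M F hα on h0 a lt mono lub sec ih =>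
    exact absurd ((omega0_le_of_isSuccLimit hα).trans hk) (natCast_lt_omega0 k).not_ge

end Uniform

/-! ### Existence of spreading uniform families -/

section Existence

/-- Spreading families in terms of functions that move the elements of a set to the right while
preserving their order. -/
theorem spreading_iff {F : Set (Finset ℕ)} : Spreading F ↔ ∀ s ∈ F, ∀ σ : ℕ → ℕ,
    StrictMonoOn σ s → (∀ m ∈ s, m ≤ σ m) → s.image σ ∈ F := by
  constructor
  · intro h s hs σ hσ hle
    have himg : Finset.univ.image (s.orderEmbOfFin rfl) = s := by
      ext i
      simp
    have := h s.card (s.orderEmbOfFin rfl) (σ ∘ s.orderEmbOfFin rfl)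
      (s.orderEmbOfFin rfl).strictMono
      (fun i j hij => hσ (s.orderEmbOfFin_mem rfl i) (s.orderEmbOfFin_mem rfl j)
        ((s.orderEmbOfFin rfl).strictMono hij))
      (fun i => hle _ (s.orderEmbOfFin_mem rfl i)) (by rwa [himg])
    rwa [← Finset.image_image, himg] at this
  · intro h k m n hm hn hle hF
    have hext : ∀ i, Function.extend m n id (m i) = n i := fun i => hm.injective.extend_apply _ _ i
    have := h _ hF (Function.extend m n id) (by
      intro a ha b hb hab
      simp only [Finset.coe_image, Finset.coe_univ, Set.image_univ, Set.mem_range] at ha hb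
      obtain ⟨i, rfl⟩ := ha
      obtain ⟨j, rfl⟩ := hb
      rw [hext, hext]
      exact hn (hm.lt_iff_lt.1 hab)) (by
      intro a ha
      simp only [Finset.mem_image, Finset.mem_univ, true_and] at ha
      obtain ⟨i, rfl⟩ := ha
      rw [hext]
      exact hle i)
    rw [Finset.image_image] at this
    convert this using 2
    funext i
    exact (hext i).symm

/-- All sets `s ∪ t` with `s ∈ D`, `t ∈ A` and `s < t`. -/
def blockJoin (A D : Set (Finset ℕ)) : Set (Finset ℕ) :=
  {w | ∃ s ∈ D, ∃ t ∈ A, (∀ i ∈ s, ∀ j ∈ t, i < j) ∧ w = s ∪ t}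

theorem blockJoin_hereditary {A D : Set (Finset ℕ)} (hA : Hereditary A) (hD : Hereditary D) :
    Hereditary (blockJoin A D) := by
  rintro _ ⟨s, hs, t, ht, hst, rfl⟩ w hw
  refine ⟨w ∩ s, hD s hs _ Finset.inter_subset_right, w ∩ t, hA t ht _ Finset.inter_subset_right,
    fun i hi j hj => hst i (Finset.mem_inter.1 hi).2 j (Finset.mem_inter.1 hj).2, ?_⟩
  rw [← Finset.inter_union_distrib_left, Finset.inter_eq_left.2 hw]

theorem blockJoin_spreading {A D : Set (Finset ℕ)} (hA : Spreading A) (hD : Spreading D) :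
    Spreading (blockJoin A D) := by
  rw [spreading_iff] at *
  rintro _ ⟨s, hs, t, ht, hst, rfl⟩ σ hσ hle
  rw [Finset.coe_union] at hσ
  refine ⟨s.image σ, hD s hs σ (hσ.mono Set.subset_union_left)
      fun m hm => hle m (Finset.mem_union_left _ hm), t.image σ,
    hA t ht σ (hσ.mono Set.subset_union_right) fun m hm => hle m (Finset.mem_union_right _ hm),
    ?_, Finset.image_union _ _⟩
  intro i hi j hj
  obtain ⟨i, hi', rfl⟩ := Finset.mem_image.1 hi
  obtain ⟨j, hj', rfl⟩ := Finset.mem_image.1 hj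
  exact hσ (Or.inl hi') (Or.inr hj') (hst i hi' j hj')

theorem subset_blockJoin {A D : Set (Finset ℕ)} (h0 : ∅ ∈ D) : A ⊆ blockJoin A D :=
  fun t ht => ⟨∅, h0, t, ht, by simp, by simp⟩

theorem section_blockJoin {A D : Set (Finset ℕ)} (hA : Hereditary A) {M : Set ℕ} {n : ℕ}
    (hn : {n} ∈ D) : section_ (blockJoin (restrict A M) D) n =
      blockJoin (restrict A (M ∩ Set.Ioi n)) (section_ D n) := by
  ext w
  constructor
  · rintro ⟨hw, s, hs, t, ht, hst, h⟩
    have hnw : n ∉ w := fun h => lt_irrefl _ (hw n h)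
    have hmem : ∀ i, i ∈ s ∨ i ∈ t ↔ i = n ∨ i ∈ w := by
      intro i
      rw [← Finset.mem_union, ← h, Finset.mem_insert]
    by_cases hns : n ∈ s
    · have hnt : n ∉ t := fun h => lt_irrefl _ (hst n hns n h)
      refine ⟨s.erase n, ⟨fun m hm => ?_, by rwa [Finset.insert_erase hns]⟩, t,
        ⟨ht.1, fun j hj => ⟨ht.2 hj, hst n hns j hj⟩⟩,
        fun i hi j hj => hst i (Finset.mem_of_mem_erase hi) j hj, ?_⟩
      · obtain ⟨hmn, hms⟩ := Finset.mem_erase.1 hm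
        exact hw m (((hmem m).1 (Or.inl hms)).resolve_left hmn)
      · ext i
        have := hmem i
        simp only [Finset.mem_union, Finset.mem_erase]
        by_cases hin : i = n
        · subst hin
          simp [hnw, hnt]
        · simp only [hin, false_or] at this
          simp [hin, this]
    · have hnt : n ∈ t := ((hmem n).2 (Or.inl rfl)).resolve_left hns
      have hs0 : s = ∅ := by
        by_contra hne
        obtain ⟨i, hi⟩ := Finset.nonempty_iff_ne_empty.2 hne
        have h1 := hst i hi n hnt
        rcases (hmem i).1 (Or.inl hi) with rfl | h2
        · exact lt_irrefl _ h1
        · exact lt_asymm h1 (hw i h2)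
      subst hs0
      have hwt : w ⊆ t := fun i hi => ((hmem i).2 (Or.inr hi)).resolve_left (by simp)
      refine ⟨∅, ⟨by simp, hn⟩, w, ⟨hA t ht.1 w hwt, fun i hi => ⟨ht.2 (hwt hi), hw i hi⟩⟩,
        by simp, by simp⟩
  · rintro ⟨s, ⟨hs1, hs2⟩, t, ⟨ht1, ht2⟩, hst, rfl⟩
    refine ⟨?_, insert n s, hs2, t, ⟨ht1, fun i hi => (ht2 hi).1⟩, ?_, ?_⟩
    · intro m hm
      rcases Finset.mem_union.1 hm with hm | hm
      exacts [hs1 m hm, (ht2 hm).2]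
    · intro i hi j hj
      rcases Finset.mem_insert.1 hi with rfl | hi
      exacts [(ht2 hj).2, hst i hi j hj]
    · rw [Finset.insert_union]

theorem blockJoin_on {A D : Set (Finset ℕ)} {M : Set ℕ} (hD : ∀ s ∈ D, (s : Set ℕ) ⊆ M) :
    ∀ s ∈ blockJoin (restrict A M) D, (s : Set ℕ) ⊆ M := by
  rintro _ ⟨s, hs, t, ht, -, rfl⟩
  rw [Finset.coe_union]
  exact Set.union_subset (hD s hs) ht.2

/-- Sums of ordinals are realized by block joins: if `A` is `α`-uniform and `D` is `δ`-uniform,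
then the block join is `(α + δ)`-uniform. -/
theorem IsUniform.blockJoin {α δ : Ordinal.{0}} {A D : Set (Finset ℕ)} (hA : Hereditary A)
    (hAu : IsUniform α Set.univ A) {M : Set ℕ} (hD : IsUniform δ M D) (hM : M.Infinite) :
    IsUniform (α + δ) M (FinFamily.blockJoin (FinFamily.restrict A M) D) := by
  induction hD with
  | zero M =>
    have : FinFamily.blockJoin (FinFamily.restrict A M) {∅} = FinFamily.restrict A M := by
      ext w
      constructor
      · rintro ⟨_, rfl, t, ht, -, rfl⟩
        simpa using ht
      · exact fun hw => subset_blockJoin (Set.mem_singleton _) hw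
    rw [this, add_zero]
    exact hAu.restrict (Set.subset_univ M) hM
  | succ β M D on h0 sec ih =>
    rw [← add_assoc]
    refine .succ _ M _ (blockJoin_on on)
      (subset_blockJoin h0 (empty_mem_restrict hAu.empty_mem M)) fun n hn => ?_
    rw [section_blockJoin hA (sec n hn).empty_mem.2]
    exact ih n hn (infinite_inter_Ioi hM n)
  | limit δ M D hδ on h0 a lt mono lub sec ih =>
    refine .limit _ M _ (isSuccLimit_add α hδ) (blockJoin_on on)
      (subset_blockJoin h0 (empty_mem_restrict hAu.empty_mem M)) (fun n => α + a n)
      (fun n hn => (add_lt_add_iff_left α).2 (lt n hn))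
      (fun m hm n hn hmn => (add_le_add_iff_left α).2 (mono hm hn hmn)) ⟨?_, ?_⟩ fun n hn => ?_
    · rintro _ ⟨n, hn, rfl⟩
      exact (add_le_add_iff_left α).2 (lt n hn).le
    · intro b hb
      by_contra! hlt
      obtain ⟨γ, hγ, hbγ⟩ := (lt_add_iff_of_isSuccLimit hδ).1 hlt
      obtain ⟨_, ⟨m, hm, rfl⟩, hγm⟩ := (lt_isLUB_iff lub).1 hγ
      have : α + a m ≤ b := hb ⟨m, hm, rfl⟩
      exact absurd (hbγ.trans_le (((add_le_add_iff_left α).2 hγm.le).trans this)) (lt_irrefl _)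
    · rw [section_blockJoin hA (sec n hn).empty_mem.2]
      exact ih n hn (infinite_inter_Ioi hM n)

/-- The family whose section at each `n` is the part of `F n` above `n`. -/
def ofSections (F : ℕ → Set (Finset ℕ)) : Set (Finset ℕ) :=
  {w | w = ∅ ∨ ∃ n, ∃ s ∈ F n, (∀ m ∈ s, n < m) ∧ w = insert n s}

theorem section_ofSections (F : ℕ → Set (Finset ℕ)) (n : ℕ) :
    section_ (ofSections F) n = restrict (F n) (Set.univ ∩ Set.Ioi n) := by
  ext s
  constructor
  · rintro ⟨hs, h | ⟨m, t, ht, hmt, h⟩⟩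
    · exact absurd h (Finset.insert_ne_empty _ _)
    · have hns : n ∉ s := fun h => lt_irrefl _ (hs n h)
      have hmt' : m ∉ t := fun h => lt_irrefl _ (hmt m h)
      have hnm : n = m := by
        have h1 : n ∈ insert m t := h ▸ Finset.mem_insert_self n s
        have h2 : m ∈ insert n s := h ▸ Finset.mem_insert_self m t
        rcases Finset.mem_insert.1 h1 with h1 | h1
        · exact h1
        · rcases Finset.mem_insert.1 h2 with h2 | h2
          · exact h2.symm
          · exact absurd (hs m h2) (hmt n h1).le.not_gt
      subst hnm
      have : s = t := by
        rw [← Finset.erase_insert hns, h, Finset.erase_insert hmt']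
      subst this
      exact ⟨ht, fun i hi => ⟨trivial, hs i hi⟩⟩
  · rintro ⟨hs, h⟩
    exact ⟨fun m hm => (h hm).2, Or.inr ⟨n, s, hs, fun m hm => (h hm).2, rfl⟩⟩

theorem ofSections_hereditary {F : ℕ → Set (Finset ℕ)} (hF : ∀ n, Hereditary (F n))
    (hmono : Monotone F) : Hereditary (ofSections F) := by
  rintro w (rfl | ⟨n, s, hs, hns, rfl⟩) t ht
  · exact Or.inl (Finset.subset_empty.1 ht)
  · by_cases hnt : n ∈ t
    · refine Or.inr ⟨n, t.erase n, hF n s hs _ ?_, fun m hm => ?_, (Finset.insert_erase hnt).symm⟩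
      · exact Finset.subset_insert_iff.1 ht
      · exact hns m (Finset.subset_insert_iff.1 ht hm)
    · have hts : t ⊆ s := (Finset.subset_insert_iff_of_notMem hnt).1 ht
      rcases t.eq_empty_or_nonempty with rfl | hne
      · exact Or.inl rfl
      · have hmem := t.min'_mem hne
        refine Or.inr ⟨t.min' hne, t.erase (t.min' hne), ?_,
          fun m hm => t.min'_lt_of_mem_erase_min' hne hm, (Finset.insert_erase hmem).symm⟩
        exact hmono (hns _ (hts hmem)).le (hF n s hs _ ((Finset.erase_subset _ _).trans hts))

theorem ofSections_spreading {F : ℕ → Set (Finset ℕ)} (hF : ∀ n, Spreading (F n))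
    (hmono : Monotone F) : Spreading (ofSections F) := by
  rw [spreading_iff]
  rintro w (rfl | ⟨n, s, hs, hns, rfl⟩) σ hσ hle
  · exact Or.inl rfl
  · refine Or.inr ⟨σ n, s.image σ, hmono (hle n (Finset.mem_insert_self n s))
      (spreading_iff.1 (hF n) s hs σ (hσ.mono (by simp))
        fun m hm => hle m (Finset.mem_insert_of_mem hm)), ?_, Finset.image_insert _ _ _⟩
    intro m hm
    obtain ⟨m, hm', rfl⟩ := Finset.mem_image.1 hm
    exact hσ (by simp) (by simp [hm']) (hns m hm')

theorem restrict_univ {I : Type u} (F : Set (Finset I)) : restrict F Set.univ = F := by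
  ext s
  simp [restrict]

theorem exists_monotone_isLUB {α : Ordinal.{0}} (hlim : Order.IsSuccLimit α) (hα : α < ω_ 1) :
    ∃ a : ℕ → Ordinal.{0}, (∀ n, a n < α) ∧ Monotone a ∧ IsLUB (Set.range a) α := by
  have hcount : Countable (Set.Iio α) := by
    rw [← Cardinal.mk_le_aleph0_iff, Cardinal.mk_Iio_ordinal, Cardinal.lift_le_aleph0]
    rw [Cardinal.lt_omega_iff_card_lt] at hα
    rwa [← Order.lt_succ_iff, Cardinal.succ_aleph0]
  have hne : Nonempty (Set.Iio α) := ⟨⟨0, hlim.bot_lt⟩⟩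
  obtain ⟨f, hf⟩ := exists_surjective_nat (Set.Iio α)
  refine ⟨fun n => partialSups (fun i => (f i).1) n, fun n => ?_, (partialSups _).monotone, ?_, ?_⟩
  · induction n with
    | zero => exact (f 0).2
    | succ n ih =>
      simp only [partialSups_add_one]
      exact max_lt ih (f (n + 1)).2
  · rintro _ ⟨n, rfl⟩
    induction n with
    | zero => exact (f 0).2.le
    | succ n ih =>
      simp only [partialSups_add_one]
      exact max_le ih (f (n + 1)).2.le
  · intro b hb
    by_contra! hlt
    obtain ⟨n, hn⟩ := hf ⟨b + 1, hlim.add_one_lt hlt⟩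
    have h1 : (f n).1 ≤ b := (le_partialSups (fun i => (f i).1) n).trans (hb ⟨n, rfl⟩)
    rw [hn] at h1
    exact absurd h1 (by simp)

/-- Every countable ordinal is the rank of some hereditary spreading uniform family.  At a limit
`α` one takes `a n` increasing to `α` and, by block joins, an increasing sequence of
`a n`-uniform families. -/
theorem exists_isUniform {α : Ordinal.{0}} (hα : α < ω_ 1) :
    ∃ H, Hereditary H ∧ Spreading H ∧ IsUniform α Set.univ H := by
  induction α using WellFoundedLT.induction with
  | ind α ih =>
    rcases Ordinal.zero_or_succ_or_isSuccLimit α with rfl | ⟨β, rfl⟩ | hlim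
    · refine ⟨{∅}, ?_, ?_, .zero _⟩
      · rintro s rfl t ht
        exact Finset.subset_empty.1 ht
      · rw [spreading_iff]
        rintro s rfl σ - -
        simp
    · have hβ : β < Order.succ β := Order.lt_succ β
      obtain ⟨S, hS1, hS2, hS3⟩ := ih β hβ (hβ.trans hα)
      refine ⟨ofSections fun _ => S, ofSections_hereditary (fun _ => hS1) monotone_const,
        ofSections_spreading (fun _ => hS2) monotone_const,
        .succ β _ _ (fun _ _ => Set.subset_univ _) (Or.inl rfl) fun n _ => ?_⟩
      rw [section_ofSections]
      exact hS3.restrict (Set.subset_univ _) (infinite_inter_Ioi Set.infinite_univ n)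
    · obtain ⟨a, ha, hmono, hlub⟩ := exists_monotone_isLUB hlim hα
      choose S hS1 hS2 hS3 using fun β (hβ : β < α) => ih β hβ (hβ.trans hα)
      have hδ : ∀ n, a (n + 1) - a n < α := fun n => (Ordinal.sub_le_self _ _).trans_lt (ha (n + 1))
      let F : ℕ → Set (Finset ℕ) := fun n =>
        Nat.rec (S (a 0) (ha 0)) (fun n A => blockJoin A (S _ (hδ n))) n
      have hF : ∀ n, F (n + 1) = blockJoin (F n) (S _ (hδ n)) := fun n => rfl
      have hF1 : ∀ n, Hereditary (F n) := fun n => by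
        induction n with
        | zero => exact hS1 _ _
        | succ n ih => exact blockJoin_hereditary ih (hS1 _ _)
      have hF2 : ∀ n, Spreading (F n) := fun n => by
        induction n with
        | zero => exact hS2 _ _
        | succ n ih => exact blockJoin_spreading ih (hS2 _ _)
      have hF3 : ∀ n, IsUniform (a n) Set.univ (F n) := fun n => by
        induction n with
        | zero => exact hS3 _ _
        | succ n ih =>
          have := ih.blockJoin (hF1 n) (hS3 _ (hδ n)) Set.infinite_univ
          rwa [restrict_univ, Ordinal.add_sub_cancel_of_le (hmono n.le_succ)] at this
      have hF4 : Monotone F := monotone_nat_of_le_succ fun n =>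
        subset_blockJoin (hS3 _ (hδ n)).empty_mem
      refine ⟨ofSections F, ofSections_hereditary hF1 hF4, ofSections_spreading hF2 hF4,
        .limit α _ _ hlim (fun _ _ => Set.subset_univ _) (Or.inl rfl) a (fun n _ => ha n)
          (hmono.monotoneOn _) (by rwa [Set.image_univ]) fun n _ => ?_⟩
      rw [section_ofSections]
      exact (hF3 n).restrict (Set.subset_univ _) (infinite_inter_Ioi Set.infinite_univ n)

end Existence

/-! ### Multiplicative classes of families -/

section MulClass

variable {I : Type u} {r : I → I → Prop}

/-- The combinatorial requirement on a multiplication of `F` by `H`. -/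
def UnionProperty (r : I → I → Prop) (F : Set (Finset I)) (H : Set (Finset ℕ))
    (G : Set (Finset I)) : Prop :=
  ∀ s : ℕ → Finset I, (∀ n, s n ∈ F) → IsChain r (⋃ n, (s n : Set I)) →
    ∃ φ : ℕ → ℕ, StrictMono φ ∧ ∀ x ∈ H, ∃ g ∈ G, (g : Set I) = ⋃ n ∈ x, (s (φ n) : Set I)

theorem UnionProperty.mono {F F' : Set (Finset I)} {H : Set (Finset ℕ)} {G G' : Set (Finset I)}
    (h : UnionProperty r F H G) (hF : F' ⊆ F) (hG : G ⊆ G') : UnionProperty r F' H G' := by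
  intro s hs hc
  obtain ⟨φ, hφ, h⟩ := h s (fun n => hF (hs n)) hc
  refine ⟨φ, hφ, fun x hx => ?_⟩
  obtain ⟨g, hg, hg'⟩ := h x hx
  exact ⟨g, hG hg, hg'⟩

/-- A system of families, indexed by ordinals of which only the epsilon numbers matter, that retains of a basis only what can be
transported easily between partial orderings: the members of `C l` have ranks below `l`, but no
lower bounds on ranks are required. -/
structure IsMulClass (r : I → I → Prop) (C : Ordinal.{u} → Set (Set (Finset I))) : Prop where
  mono : Monotone C
  onChains : ∀ l, ∀ F ∈ C l, OnChains r F
  hereditary : ∀ l, ∀ F ∈ C l, Hereditary F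
  singleton_mem : ∀ l, ∀ F ∈ C l, {s : Finset I | s.card ≤ 1} ⊆ F
  bounded : ∀ l, IsEps l → ∀ F ∈ C l, Bounded F l
  nonempty : ∀ l, IsEps l → (C l).Nonempty
  join : ∀ l, IsEps l → ∀ F ∈ C l, ∀ G ∈ C l, ∃ K ∈ C l, chainJoin r F G ⊆ K
  mul : ∀ l, IsEps l → ∀ F ∈ C l, ∀ H ∈ spreadingUniform,
    Ordinal.lift.{u} (srk (fun m n : ℕ => m < n) H) < l → ∃ G ∈ C l, UnionProperty r F H G

theorem cube_hereditary (n : ℕ) : Hereditary (cube r n) := fun _ hs _ hts =>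
  ⟨(Finset.card_le_card hts).trans hs.1, hs.2.mono (Finset.coe_subset.2 hts)⟩

theorem cube_onChains (n : ℕ) : OnChains r (cube r n) := fun _ hs => hs.2

theorem isChain_of_card_le_one {s : Finset I} (hs : s.card ≤ 1) : IsChain r (s : Set I) :=
  (Finset.card_le_one_iff_subsingleton.1 hs).isChain

theorem subset_cube {n : ℕ} (hn : 1 ≤ n) : {s : Finset I | s.card ≤ 1} ⊆ cube r n :=
  fun _ hs => ⟨le_trans hs hn, isChain_of_card_le_one hs⟩

theorem bounded_cube (n : ℕ) {l : Ordinal.{u}} (hl : ω ≤ l) : Bounded (cube r n) l := by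
  refine ⟨fun s => ((n - s.card : ℕ) : Ordinal), fun s x hx hs => ?_,
    (natCast_lt_omega0 _).trans_le hl⟩
  have := hs.1
  rw [Finset.card_cons] at this
  simp only [Finset.card_cons, Nat.cast_lt]
  omega

theorem chainJoin_cube (m n : ℕ) : chainJoin r (cube r m) (cube r n) ⊆ cube r (m + n) := by
  classical
  rintro w ⟨hw, s, hs, t, ht, h⟩
  rw [← Finset.coe_union, Finset.coe_inj] at h
  refine ⟨?_, hw⟩
  rw [h]
  exact (Finset.card_union_le s t).trans (add_le_add hs.1 ht.1)

theorem cube_zero : cube r 0 = {∅} := by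
  ext s
  constructor
  · intro h
    simpa using h.1
  · rintro rfl
    exact ⟨by simp, by simp⟩

theorem empty_mem_cube (n : ℕ) : ∅ ∈ cube r n := ⟨by simp, by simp⟩

/-- A basis yields a multiplicative class. -/
theorem IsBasis.isMulClass (hi : HasInfiniteChain r) {B : Set (Set (Finset I))}
    {mul : Set (Finset I) → Set (Finset ℕ) → Set (Finset I)} (hB : IsBasis r B mul) :
    IsMulClass r fun l => {F ∈ B | {s : Finset I | s.card ≤ 1} ⊆ F ∧ Bounded F l} where
  mono _ _ h _ hF := ⟨hF.1, hF.2.1, hF.2.2.mono Subset.rfl h⟩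
  onChains _ F hF := (hB.homogeneous F hF.1).onChains
  hereditary _ F hF := (hB.homogeneous F hF.1).hereditary
  singleton_mem _ F hF := hF.2.1
  bounded _ _ F hF := hF.2.2
  nonempty l hl := ⟨cube r 1, hB.cube_mem 1, subset_cube le_rfl, bounded_cube 1 hl.2.le⟩
  join l hl F hF G hG := ⟨chainJoin r F G, ⟨hB.chainJoin_mem F hF.1 G hG.1, hF.2.1.trans
      (subset_chainJoin_left (hB.homogeneous F hF.1).onChains (hG.2.1 (by simp))),
      bounded_chainJoin (hB.homogeneous F hF.1).hereditary
        (hB.homogeneous G hG.1).hereditary hl hF.2.2 hG.2.2⟩, Subset.rfl⟩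
  mul l hl F hF H hH hHl := by
    have hm := hB.isMultiplication F hF.1 H hH
    have hF' := hB.homogeneous F hF.1
    refine ⟨mul F H ∪ cube r 1, ⟨hB.union_mem _ (hB.mul_mem F hF.1 H hH) _ (hB.cube_mem 1),
      (subset_cube le_rfl).trans Set.subset_union_right, ?_⟩,
      UnionProperty.mono hm.union_mem Subset.rfl Set.subset_union_left⟩
    have h3 : srk r F < l := (srk_le_rk hi hF'.hereditary hF'.noInfinite hF'.empty_mem).trans_lt
      (hF.2.2.rk_lt hF'.hereditary hF'.empty_mem)
    have h4 : Bounded (mul F H) l := hm.homogeneous.bounded hi hl (by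
      rw [hm.iota_eq]
      exact iota_le (hl.1.mul_lt h3 hHl) hl.1)
    refine (bounded_chainJoin (r := r) hm.homogeneous.hereditary (cube_hereditary (r := r) 1) hl h4
      (bounded_cube 1 hl.2.le)).mono ?_ le_rfl
    exact Set.union_subset (subset_chainJoin_left hm.homogeneous.onChains (empty_mem_cube 1))
      (subset_chainJoin_right (cube_onChains 1) hm.homogeneous.empty_mem)

/-- If there is no infinite chain, then the cubes are a multiplicative class: a sequence of sets
with union a chain has a constant subsequence. -/
theorem isMulClass_cubes (hi : ¬ HasInfiniteChain r) :
    IsMulClass r fun _ => {F | ∃ n : ℕ, 1 ≤ n ∧ F = cube r n} where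
  mono _ _ _ _ h := h
  onChains := by
    rintro _ _ ⟨n, -, rfl⟩
    exact cube_onChains n
  hereditary := by
    rintro _ _ ⟨n, -, rfl⟩
    exact cube_hereditary n
  singleton_mem := by
    rintro _ _ ⟨n, hn, rfl⟩
    exact subset_cube hn
  bounded := by
    rintro l hl _ ⟨n, -, rfl⟩
    exact bounded_cube n hl.2.le
  nonempty _ _ := ⟨_, 1, le_rfl, rfl⟩
  join := by
    rintro _ _ _ ⟨m, hm, rfl⟩ _ ⟨n, hn, rfl⟩
    exact ⟨_, ⟨m + n, by omega, rfl⟩, chainJoin_cube m n⟩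
  mul := by
    classical
    rintro _ _ _ ⟨n, hn, rfl⟩ H - -
    refine ⟨_, ⟨n, hn, rfl⟩, fun s hs hc => ?_⟩
    have hfin : (⋃ n, (s n : Set I)).Finite := by
      by_contra hinf
      exact hi ⟨_, hinf, hc⟩
    let f : ℕ → hfin.toFinset.powerset := fun n => ⟨s n, by
      rw [Finset.mem_powerset]
      intro i hi
      rw [Set.Finite.mem_toFinset]
      exact Set.mem_iUnion.2 ⟨n, hi⟩⟩
    obtain ⟨t, ht⟩ := Finite.exists_infinite_fiber f
    have : Infinite (f ⁻¹' {t}) := ht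
    let φ := Nat.orderEmbeddingOfSet (f ⁻¹' {t})
    have hφ : ∀ n, s (φ n) = t := fun n => by
      have h1 : φ n ∈ f ⁻¹' {t} := Nat.orderEmbeddingOfSet_range (f ⁻¹' {t}) ▸ ⟨n, rfl⟩
      exact congrArg Subtype.val h1
    refine ⟨φ, φ.strictMono, fun x _ => ?_⟩
    rcases x.eq_empty_or_nonempty with rfl | ⟨m, hm⟩
    · exact ⟨∅, empty_mem_cube _, by simp⟩
    · refine ⟨t, hφ 0 ▸ hs _, ?_⟩
      ext i
      simp only [hφ, Set.mem_iUnion]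
      exact ⟨fun h => ⟨m, hm, h⟩, fun ⟨_, _, h⟩ => h⟩

/-- Multiplicative classes can be restricted to an ordering with fewer chains. -/
theorem IsMulClass.restrict {q : I → I → Prop} (hqr : ∀ s : Set I, IsChain r s → IsChain q s)
    {C : Ordinal.{u} → Set (Set (Finset I))} (hC : IsMulClass q C) :
    IsMulClass r fun l => (fun F => {s ∈ F | IsChain r (s : Set I)}) '' C l where
  mono _ _ h := Set.image_mono (hC.mono h)
  onChains := by
    rintro l _ ⟨F, hF, rfl⟩ s hs
    exact hs.2
  hereditary := by
    rintro l _ ⟨F, hF, rfl⟩ s hs t ht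
    exact ⟨hC.hereditary l F hF s hs.1 t ht, hs.2.mono (Finset.coe_subset.2 ht)⟩
  singleton_mem := by
    rintro l _ ⟨F, hF, rfl⟩ s hs
    exact ⟨hC.singleton_mem l F hF hs, isChain_of_card_le_one hs⟩
  bounded := by
    rintro l hl _ ⟨F, hF, rfl⟩
    exact (hC.bounded l hl F hF).mono (fun _ hs => hs.1) le_rfl
  nonempty l hl := (hC.nonempty l hl).image _
  join := by
    rintro l hl _ ⟨F, hF, rfl⟩ _ ⟨G, hG, rfl⟩
    obtain ⟨K, hK, hsub⟩ := hC.join l hl F hF G hG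
    refine ⟨_, ⟨K, hK, rfl⟩, ?_⟩
    rintro w ⟨hw, s, hs, t, ht, h⟩
    exact ⟨hsub ⟨hqr _ hw, s, hs.1, t, ht.1, h⟩, hw⟩
  mul := by
    rintro l hl _ ⟨F, hF, rfl⟩ H hH hHl
    obtain ⟨G, hG, hU⟩ := hC.mul l hl F hF H hH hHl
    refine ⟨_, ⟨G, hG, rfl⟩, fun s hs hc => ?_⟩
    obtain ⟨φ, hφ, h⟩ := hU s (fun n => (hs n).1) (hqr _ hc)
    refine ⟨φ, hφ, fun x hx => ?_⟩
    obtain ⟨g, hg, hg'⟩ := h x hx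
    refine ⟨g, ⟨hg, hc.mono ?_⟩, hg'⟩
    rw [hg']
    exact Set.iUnion₂_subset fun n _ => Set.subset_iUnion (fun n => (s n : Set I)) (φ n)

theorem IsMulClass.exists_cube_subset {C : Ordinal.{u} → Set (Set (Finset I))}
    (hC : IsMulClass r C) {l : Ordinal.{u}} (hl : IsEps l) (n : ℕ) : ∃ G ∈ C l, cube r n ⊆ G := by
  classical
  induction n with
  | zero =>
    obtain ⟨G, hG⟩ := hC.nonempty l hl
    refine ⟨G, hG, ?_⟩
    rw [cube_zero, Set.singleton_subset_iff]
    exact hC.singleton_mem l G hG (by simp)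
  | succ n ih =>
    obtain ⟨G, hG, hGn⟩ := ih
    obtain ⟨S, hS⟩ := hC.nonempty l hl
    obtain ⟨K, hK, hK'⟩ := hC.join l hl G hG S hS
    refine ⟨K, hK, fun w hw => hK' ?_⟩
    rcases w.eq_empty_or_nonempty with rfl | ⟨x, hx⟩
    · exact ⟨hw.2, ∅, hGn (empty_mem_cube n), ∅, hC.singleton_mem l S hS (by simp), by simp⟩
    · refine ⟨hw.2, w.erase x, hGn ⟨?_, hw.2.mono (by simp)⟩, {x},
        hC.singleton_mem l S hS (by simp), ?_⟩
      · have := hw.1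
        rw [Finset.card_erase_of_mem hx]
        omega
      · rw [← Finset.coe_union, Finset.coe_inj]
        ext i
        simp only [Finset.mem_union, Finset.mem_erase, Finset.mem_singleton]
        grind

end MulClass

/-! ### From multiplicative classes to bases -/

section ToBasis

variable {I : Type u} {r : I → I → Prop}

theorem IsUniform.lt_omega_one {α : Ordinal.{0}} {M : Set ℕ} {F : Set (Finset ℕ)}
    (h : IsUniform α M F) (hM : M.Infinite) : α < ω_ 1 := by
  induction h with
  | zero => exact omega_pos 1
  | succ β M F on h0 sec ih =>
    obtain ⟨n, hn⟩ := hM.nonempty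
    exact isEps_omega_one.1.add_one_lt (ih n hn (infinite_inter_Ioi hM n))
  | limit α M F hα on h0 a lt mono lub sec ih =>
    have h1 : ⨆ n : M, a n < ω_ 1 :=
      Ordinal.iSup_lt_omega_one fun n => ih n n.2 (infinite_inter_Ioi hM n)
    refine lt_of_le_of_lt (lub.2 ?_) h1
    rintro _ ⟨n, hn, rfl⟩
    exact Ordinal.le_iSup (fun n : M => a n) ⟨n, hn⟩

theorem IsUniform.mem_of_card_le_one {α : Ordinal.{0}} {H : Set (Finset ℕ)}
    (h : IsUniform α Set.univ H) (hα : α ≠ 0) {s : Finset ℕ} (hs : s.card ≤ 1) : s ∈ H := by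
  rcases Finset.card_le_one_iff_subset_singleton.1 hs with ⟨n, hn⟩
  rcases Finset.subset_singleton_iff.1 hn with rfl | rfl
  · exact h.empty_mem
  · exact h.singleton_mem hα (Set.mem_univ n)

/-- A multiplication of a family that contains the singletons contains a copy of `H` inside
every infinite chain. -/
theorem UnionProperty.exists_copy {F : Set (Finset I)} {H : Set (Finset ℕ)} {G : Set (Finset I)}
    (h : UnionProperty r F H G) (h1 : {s : Finset I | s.card ≤ 1} ⊆ F) {C : Set I}
    (hC : C.Infinite) (hr : IsChain r C) : ∃ e : ℕ ↪ I, Set.range e ⊆ C ∧ copy e H ⊆ G := by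
  let y : ℕ ↪ I := (Set.Infinite.natEmbedding C hC).trans (Function.Embedding.subtype _)
  have hy : ∀ n, y n ∈ C := fun n => (Set.Infinite.natEmbedding C hC n).2
  obtain ⟨φ, hφ, h⟩ := h (fun n => {y n}) (fun n => h1 (by simp)) (hr.mono (by
    refine Set.iUnion_subset fun n => ?_
    simpa using hy n))
  refine ⟨⟨fun n => y (φ n), y.injective.comp hφ.injective⟩, ?_, ?_⟩
  · rintro _ ⟨n, rfl⟩
    exact hy _
  · rintro _ ⟨x, hx, rfl⟩
    obtain ⟨g, hg, hg'⟩ := h x hx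
    convert hg using 1
    ext i
    rw [← Finset.mem_coe (s := g), hg']
    simp [eq_comm]

theorem le_srk_of_copy (hi : HasInfiniteChain r) {H : Set (Finset ℕ)} (hH : Hereditary H)
    (hHc : NoInfinite H) (h0 : ∅ ∈ H) {G : Set (Finset I)} (hG : Hereditary G)
    (hGc : NoInfinite G) (h : ∀ C : Set I, C.Infinite → IsChain r C →
      ∃ e : ℕ ↪ I, Set.range e ⊆ C ∧ copy e H ⊆ G) : Ordinal.lift.{u} (rk H) ≤ srk r G := by
  refine le_srk hi fun C hC hr => ?_
  obtain ⟨e, heC, he⟩ := h C hC hr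
  rw [← rk_copy hH hHc h0 e]
  refine rk_mono (hH.copy e) ⟨∅, h0, rfl⟩ (hG.restrict C) (hGc.mono (restrict_subset G C)) ?_
  intro s hs
  refine ⟨he hs, ?_⟩
  obtain ⟨x, -, rfl⟩ := hs
  rw [Finset.coe_map]
  exact (Set.image_subset_range _ _).trans heC

theorem UnionProperty.subset {F : Set (Finset I)} {H : Set (Finset ℕ)} {G : Set (Finset I)}
    (h : UnionProperty r F H G) (hF : OnChains r F) (h0 : {0} ∈ H) : F ⊆ G := by
  intro s hs
  obtain ⟨φ, -, h⟩ := h (fun _ => s) (fun _ => hs) (by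
    rw [Set.iUnion_const]
    exact hF s hs)
  obtain ⟨g, hg, hg'⟩ := h _ h0
  have : g = s := by
    rw [← Finset.coe_inj, hg']
    simp
  exact this ▸ hg

/-- The basis generated by a multiplicative class: homogeneous families of finite rank consisting
of sets of bounded size, and homogeneous families of infinite rank inside a member of the class of
the appropriate level. -/
def basisOf (r : I → I → Prop) (C : Ordinal.{u} → Set (Set (Finset I))) :
    Set (Set (Finset I)) :=
  {F | IsHomogeneous r F ∧ ((∃ n, F ⊆ cube r n) ∨
    (ω ≤ srk r F ∧ ∃ G ∈ C (iota (srk r F)), F ⊆ G))}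

variable {C : Ordinal.{u} → Set (Set (Finset I))}

theorem rk_lt_omega0_of_subset_cube {F : Set (Finset I)} (hF : Hereditary F) (h0 : ∅ ∈ F) {n : ℕ}
    (h : F ⊆ cube r n) : rk F < ω :=
  ((bounded_cube n le_rfl).mono h le_rfl).rk_lt hF h0

theorem noInfinite_of_subset_cube {F : Set (Finset I)} {n : ℕ} (h : F ⊆ cube r n) :
    NoInfinite F :=
  ((bounded_cube n le_rfl).mono h le_rfl).noInfinite

theorem isHomogeneous_of_subset_cube (hi : HasInfiniteChain r) {F : Set (Finset I)}
    (hF : Hereditary F) (h1 : {s : Finset I | s.card ≤ 1} ⊆ F) {n : ℕ} (h : F ⊆ cube r n) :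
    IsHomogeneous r F := by
  have hlt := rk_lt_omega0_of_subset_cube hF (h1 (by simp)) h
  have hc := noInfinite_of_subset_cube h
  refine isHomogeneous_of_rk_lt hi (fun s hs => (h hs).2) hF hc h1
    (hlt.trans omega0_lt_omega_one) (hlt.trans_le ?_)
  rw [iota_of_lt_omega0 ((srk_le_rk hi hF hc (h1 (by simp))).trans_lt hlt)]

theorem cube_mem_basisOf (hi : HasInfiniteChain r) (n : ℕ) : cube r n ∈ basisOf r C := by
  refine ⟨?_, Or.inl ⟨n, Subset.rfl⟩⟩
  obtain _ | n := n
  · rw [cube_zero]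
    exact isHomogeneous_singleton_empty
  · exact isHomogeneous_of_subset_cube hi (cube_hereditary _) (subset_cube (by omega)) Subset.rfl

/-- A criterion for membership in the basis at infinite levels. -/
theorem mem_basisOf_of_subset (hC : IsMulClass r C) (hi : HasInfiniteChain r) {σ : Ordinal.{u}}
    (hσ : ω ≤ σ) (hσ' : σ < ω_ 1) {F G : Set (Finset I)} (hG : G ∈ C (iota σ)) (hFG : F ⊆ G)
    (hF : Hereditary F) (h1 : {s : Finset I | s.card ≤ 1} ⊆ F) (hle : iota σ ≤ iota (srk r F)) :
    F ∈ basisOf r C ∧ iota (srk r F) = iota σ := by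
  have hl := isEps_iota hσ hσ'
  have hb := (hC.bounded _ hl G hG).mono hFG le_rfl
  have h0 : ∅ ∈ F := h1 (by simp)
  have hrk := hb.rk_lt hF h0
  have hsrk := srk_le_rk hi hF hb.noInfinite h0
  have heq : iota (srk r F) = iota σ :=
    (iota_le_iota (hsrk.trans_lt hrk) hσ').antisymm hle
  refine ⟨⟨isHomogeneous_of_rk_lt hi (fun s hs => hC.onChains _ G hG s (hFG hs)) hF hb.noInfinite h1
    (hrk.trans_le (iota_le_omega_one hσ')) (hrk.trans_le hle), Or.inr ⟨?_, G, ?_, hFG⟩⟩, heq⟩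
  · by_contra! hlt
    have := iota_of_lt_omega0 hlt
    exact absurd (hl.2.trans_le (heq.ge.trans this.le)) (lt_irrefl _)
  · rwa [heq]

theorem exists_mem_of_mem_basisOf (hC : IsMulClass r C) {F : Set (Finset I)}
    (hF : F ∈ basisOf r C) {σ : Ordinal.{u}} (hσ : ω ≤ σ) (hσ' : σ < ω_ 1) (hle : srk r F ≤ σ) :
    ∃ G ∈ C (iota σ), F ⊆ G := by
  rcases hF.2 with ⟨n, hn⟩ | ⟨-, G, hG, hFG⟩
  · obtain ⟨G, hG, hGn⟩ := hC.exists_cube_subset (isEps_iota hσ hσ') n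
    exact ⟨G, hG, hn.trans hGn⟩
  · exact ⟨G, hC.mono (iota_mono hle hσ') hG, hFG⟩

/-- Anything between `F ∪ G` and the join of `F` and `G` stays in the basis. -/
theorem mem_basisOf_of_subset_chainJoin (hC : IsMulClass r C) (hi : HasInfiniteChain r)
    {F G J : Set (Finset I)} (hF : F ∈ basisOf r C) (hG : G ∈ basisOf r C) (hJ : Hereditary J)
    (hFJ : F ⊆ J) (hGJ : G ⊆ J) (hJFG : J ⊆ chainJoin r F G) : J ∈ basisOf r C := by
  rcases hF.1.cases with rfl | ⟨h1, -, -, -, -⟩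
  · have : J = G := by
      refine Set.Subset.antisymm (fun w hw => ?_) hGJ
      obtain ⟨-, _, rfl, t, ht, h⟩ := hJFG hw
      have : w = t := by
        rw [← Finset.coe_inj, h]
        simp
      exact this ▸ ht
    exact this ▸ hG
  have h1J := h1.trans hFJ
  have h0J : ∅ ∈ J := h1J (by simp)
  have hFs := hF.1.srk_lt hi
  have hGs := hG.1.srk_lt hi
  by_cases hfin : srk r F < ω ∧ srk r G < ω
  · obtain ⟨m, hm⟩ := hF.2.resolve_right fun h => h.1.not_gt hfin.1
    obtain ⟨n, hn⟩ := hG.2.resolve_right fun h => h.1.not_gt hfin.2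
    have hJc : J ⊆ cube r (m + n) := hJFG.trans ((chainJoin_mono hm hn).trans (chainJoin_cube m n))
    exact ⟨isHomogeneous_of_subset_cube hi hJ h1J hJc, Or.inl ⟨_, hJc⟩⟩
  · have hσ : ω ≤ max (srk r F) (srk r G) := by
      by_contra! h
      exact hfin (max_lt_iff.1 h)
    have hσ' := max_lt hFs hGs
    have hl := isEps_iota hσ hσ'
    obtain ⟨F', hF', hFF'⟩ := exists_mem_of_mem_basisOf hC hF hσ hσ' (le_max_left _ _)
    obtain ⟨G', hG', hGG'⟩ := exists_mem_of_mem_basisOf hC hG hσ hσ' (le_max_right _ _)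
    obtain ⟨K, hK, hK'⟩ := hC.join _ hl F' hF' G' hG'
    have hJK : J ⊆ K := hJFG.trans ((chainJoin_mono hFF' hGG').trans hK')
    have hb := (hC.bounded _ hl K hK).mono hJK le_rfl
    have hmax : max (srk r F) (srk r G) ≤ srk r J := max_le
      (srk_mono hi hF.1.hereditary hF.1.empty_mem hJ hb.noInfinite hFJ)
      (srk_mono hi hG.1.hereditary hG.1.empty_mem hJ hb.noInfinite hGJ)
    have hJω : srk r J < ω_ 1 := (srk_le_rk hi hJ hb.noInfinite h0J).trans_lt
      ((hb.rk_lt hJ h0J).trans_le (iota_le_omega_one hσ'))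
    exact (mem_basisOf_of_subset hC hi hσ hσ' hK hJK hJ h1J (iota_mono hmax hJω)).1

theorem union_property_cube {F : Set (Finset I)} {H : Set (Finset ℕ)} {m n : ℕ}
    (hF : ∀ s ∈ F, s.card ≤ m) (hH : ∀ x ∈ H, x.card ≤ n) :
    UnionProperty r F H (cube r (n * m)) := by
  classical
  intro s hs hc
  refine ⟨id, strictMono_id, fun x hx => ⟨x.biUnion s, ⟨?_, hc.mono ?_⟩, by simp⟩⟩
  · exact (Finset.card_biUnion_le_card_mul x s m fun i _ => hF _ (hs i)).trans
      (Nat.mul_le_mul_right m (hH x hx))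
  · rw [Finset.coe_biUnion]
    exact Set.iUnion₂_subset fun n _ => Set.subset_iUnion (fun n => (s n : Set I)) n

theorem exists_isMultiplication (hC : IsMulClass r C) (hi : HasInfiniteChain r)
    {F : Set (Finset I)} (hF : F ∈ basisOf r C) {H : Set (Finset ℕ)} (hH : H ∈ spreadingUniform) :
    ∃ G ∈ basisOf r C, IsMultiplication r F H G := by
  obtain ⟨hH1, hH2, α, hHu⟩ := hH
  have hsrkH := srk_of_isUniform hH1 hHu
  have hαω : Ordinal.lift.{u} α < ω_ 1 := by
    rw [Ordinal.lift_lt_omega_one]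
    exact hHu.lt_omega_one Set.infinite_univ
  have hFω := hF.1.srk_lt hi
  set σ := srk r F * Ordinal.lift.{u} α with hσdef
  have hσω : σ < ω_ 1 := isEps_omega_one.1.mul_lt hFω hαω
  by_cases hσ : σ < ω
  · -- The families in question consist of sets of bounded size, and a cube is a multiplication.
    obtain ⟨m, n, hm⟩ : ∃ m n : ℕ, UnionProperty r F H (cube r (n * m)) := by
      rcases hF.1.cases with rfl | ⟨h1, -, -, h2, -⟩
      · refine ⟨0, 0, ?_⟩
        intro s hs hc
        refine ⟨id, strictMono_id, fun x hx => ⟨∅, empty_mem_cube _, ?_⟩⟩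
        have : ∀ n, s n = ∅ := hs
        simp [this]
      · by_cases hα : α = 0
        · subst hα
          rw [hHu.eq_singleton]
          refine ⟨0, 0, ?_⟩
          intro s hs hc
          refine ⟨id, strictMono_id, ?_⟩
          rintro _ rfl
          exact ⟨∅, empty_mem_cube _, by simp⟩
        · have hα1 : 1 ≤ Ordinal.lift.{u} α := by
            rw [Order.one_le_iff_ne_zero, Ne, ← Ordinal.lift_zero.{0, u}, Ordinal.lift_inj]
            exact hα
          have hF' : srk r F < ω := (le_mul_of_one_le_right' hα1).trans_lt hσ
          have hα' : α < ω := by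
            rw [← Ordinal.lift_lt.{u}, Ordinal.lift_omega0]
            exact (le_mul_of_one_le_left' h2).trans_lt hσ
          obtain ⟨m, hm⟩ := hF.2.resolve_right fun h => h.1.not_gt hF'
          obtain ⟨n, rfl⟩ := lt_omega0.1 hα'
          exact ⟨m, n, union_property_cube (fun s hs => (hm hs).1) (hHu.card_le le_rfl)⟩
    have hcube := cube_mem_basisOf (C := C) hi (n * m)
    refine ⟨_, hcube, hcube.1, ?_, hm⟩
    rw [hsrkH, iota_of_lt_omega0 hσ, iota_of_lt_omega0]
    exact (srk_le_rk hi hcube.1.hereditary hcube.1.noInfinite hcube.1.empty_mem).trans_lt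
      (rk_lt_omega0_of_subset_cube hcube.1.hereditary hcube.1.empty_mem Subset.rfl)
  · -- The class supplies a multiplication at the level `iota σ`.  Its small rank is at least the small
    -- rank of `F` and at least `α`, so that it cannot stay below a smaller epsilon number.
    have hσ' : ω ≤ σ := not_lt.1 hσ
    have hl := isEps_iota hσ' hσω
    have hα : α ≠ 0 := by
      rintro rfl
      rw [hσdef, Ordinal.lift_zero, mul_zero] at hσ
      exact hσ omega0_pos
    have hα1 : 1 ≤ Ordinal.lift.{u} α := by
      rw [Order.one_le_iff_ne_zero, Ne, ← Ordinal.lift_zero.{0, u}, Ordinal.lift_inj]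
      exact hα
    have hF0 : srk r F ≠ 0 := by
      intro h
      rw [hσdef, h, zero_mul] at hσ
      exact hσ omega0_pos
    have hF1 : 1 ≤ srk r F := Order.one_le_iff_ne_zero.2 hF0
    have hFs : {s : Finset I | s.card ≤ 1} ⊆ F := by
      rcases hF.1.cases with rfl | h
      · exact absurd (srk_singleton_empty hi) hF0
      · exact h.1
    obtain ⟨G₀, hG₀, hFG₀⟩ := exists_mem_of_mem_basisOf hC hF hσ' hσω
      (le_mul_of_one_le_right' hα1)
    have hαl : Ordinal.lift.{u} α < iota σ :=
      (le_mul_of_one_le_left' hF1).trans_lt (iota_spec hσω).1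
    obtain ⟨G, hG, hU⟩ := hC.mul _ hl G₀ hG₀ H ⟨hH1, hH2, α, hHu⟩ (by rwa [hsrkH])
    have hU' := hU.mono hFG₀ Subset.rfl
    have hGh := hC.hereditary _ G hG
    have hGc := (hC.bounded _ hl G hG).noInfinite
    have hGs := hC.singleton_mem _ G hG
    have h1 : srk r F ≤ srk r G := srk_mono hi hF.1.hereditary hF.1.empty_mem hGh hGc
      (hU'.subset hF.1.onChains (hHu.mem_of_card_le_one hα (by simp)))
    have h2 : Ordinal.lift.{u} α ≤ srk r G := by
      rw [← rk_of_isUniform hH1 hHu]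
      exact le_srk_of_copy hi hH1 hHu.noInfinite hHu.empty_mem hGh hGc fun D hD hr =>
        hU'.exists_copy hFs hD hr
    have hGω : srk r G < ω_ 1 := (srk_le_rk hi hGh hGc (hGs (by simp))).trans_lt
      (((hC.bounded _ hl G hG).rk_lt hGh (hGs (by simp))).trans_le (iota_le_omega_one hσω))
    have h3 : σ < iota (srk r G) := (iota_spec hGω).2.mul_lt
      (h1.trans_lt (iota_spec hGω).1) (h2.trans_lt (iota_spec hGω).1)
    obtain ⟨h4, h5⟩ := mem_basisOf_of_subset hC hi hσ' hσω hG Subset.rfl hGh hGs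
      (iota_le_iota h3 hGω)
    exact ⟨G, h4, h4.1, by rw [h5, hsrkH], hU'⟩

/-- Families of prescribed small rank `α`: a multiplication of a family by an `α`-uniform family
has small rank at least `α`; its small rank becomes `α` when its traces on one infinite chain are
restricted to the members of a copy of the `α`-uniform family. -/
theorem exists_mem_basisOf_srk_eq (hC : IsMulClass r C) (hi : HasInfiniteChain r)
    {α : Ordinal.{u}} (hα : ω ≤ α) (hα' : α < ω_ 1) : ∃ F ∈ basisOf r C, srk r F = α := by
  classical
  obtain ⟨β, rfl⟩ := Ordinal.mem_range_lift_of_le (show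
    α ≤ Ordinal.lift.{u} (ω_ 1 : Ordinal.{0}) by simpa using hα'.le)
  obtain ⟨S, hS1, hS2, hS3⟩ := exists_isUniform (Ordinal.lift_lt_omega_one.1 hα')
  have hβ : β ≠ 0 := by
    rintro rfl
    rw [Ordinal.lift_zero] at hα
    exact absurd hα omega0_pos.not_ge
  have hl := isEps_iota hα hα'
  obtain ⟨G₀, hG₀⟩ := hC.nonempty _ hl
  obtain ⟨G, hG, hU⟩ := hC.mul _ hl G₀ hG₀ S ⟨hS1, hS2, β, hS3⟩ (by
    rw [srk_of_isUniform hS1 hS3]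
    exact (iota_spec hα').1)
  have hGh := hC.hereditary _ G hG
  have hGc := (hC.bounded _ hl G hG).noInfinite
  have hGs := hC.singleton_mem _ G hG
  obtain ⟨D, hD, hDr⟩ := hi
  have hi : HasInfiniteChain r := ⟨D, hD, hDr⟩
  obtain ⟨e, heD, he⟩ := hU.exists_copy (hC.singleton_mem _ G₀ hG₀) hD hDr
  have hGβ : Ordinal.lift.{u} β ≤ srk r G := by
    rw [← rk_of_isUniform hS1 hS3]
    exact le_srk_of_copy hi hS1 hS3.noInfinite hS3.empty_mem hGh hGc fun D hD hr =>
      hU.exists_copy (hC.singleton_mem _ G₀ hG₀) hD hr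
  let F : Set (Finset I) := {s ∈ G | s.preimage e e.injective.injOn ∈ S}
  have hFG : F ⊆ G := fun s hs => hs.1
  have hF : Hereditary F := fun s hs t ht => ⟨hGh s hs.1 t ht,
    hS1 _ hs.2 _ fun i hi => by
      rw [Finset.mem_preimage] at hi ⊢
      exact ht hi⟩
  have hFs : {s : Finset I | s.card ≤ 1} ⊆ F := fun s hs => ⟨hGs hs,
    hS3.mem_of_card_le_one hβ (by
      rw [Finset.card_preimage]
      exact (Finset.card_filter_le _ _).trans hs)⟩
  have h0 : ∅ ∈ F := hFs (by simp)
  have hFc := hGc.mono hFG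
  have hsrk : srk r F = Ordinal.lift.{u} β := by
    refine le_antisymm ?_ (le_srk hi fun A hA hr => ?_)
    · refine (srk_le (Set.infinite_range_of_injective e.injective) (hDr.mono heD)).trans ?_
      rw [← rk_of_isUniform hS1 hS3, ← rk_copy hS1 hS3.noInfinite hS3.empty_mem e]
      refine rk_mono (hF.restrict _) (empty_mem_restrict h0 _) (hS1.copy e)
        (hS3.noInfinite.copy e) ?_
      rintro s ⟨hs, hse⟩
      refine ⟨_, hs.2, ?_⟩
      ext i
      simp only [Finset.mem_map, Finset.mem_preimage]
      constructor
      · rintro ⟨n, hn, rfl⟩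
        exact hn
      · intro his
        obtain ⟨n, rfl⟩ := hse his
        exact ⟨n, his, rfl⟩
    -- An infinite chain meets the range of `e` in an infinite set, or else it has an infinite part
    -- outside that range, where `F` and `G` have the same members.
    · by_cases hAe : (e ⁻¹' A).Infinite
      · have hN := rk_restrict_of_isUniform hS1 hS3 hAe
        have hN' := hS3.restrict (Set.subset_univ _) hAe
        rw [← hN, ← rk_copy (hS1.restrict _) hN'.noInfinite hN'.empty_mem e]
        refine rk_mono ((hS1.restrict _).copy e) ⟨∅, hN'.empty_mem, rfl⟩ (hF.restrict A)
          (hFc.mono (restrict_subset F A)) ?_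
        rintro _ ⟨x, ⟨hx, hxA⟩, rfl⟩
        refine ⟨⟨he ⟨x, hx, rfl⟩, ?_⟩, ?_⟩
        · convert hx
          ext i
          simp
        · rw [Finset.coe_map]
          exact Set.image_subset_iff.2 hxA
      · have hA' : (A \ Set.range e).Infinite := by
          intro hfin
          refine hA ((hfin.union ((Set.not_infinite.1 hAe).image e)).subset fun a ha => ?_)
          by_cases hae : a ∈ Set.range e
          · obtain ⟨n, rfl⟩ := hae
            exact Or.inr ⟨n, ha, rfl⟩
          · exact Or.inl ⟨ha, hae⟩
        refine hGβ.trans ((srk_le hA' (hr.mono Set.sdiff_subset)).trans ?_)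
        refine rk_mono (hGh.restrict _) (empty_mem_restrict (hGs (by simp)) _) (hF.restrict A)
          (hFc.mono (restrict_subset F A)) ?_
        rintro s ⟨hs, hsA⟩
        refine ⟨⟨hs, ?_⟩, hsA.trans Set.sdiff_subset⟩
        convert hS3.empty_mem
        ext i
        simp only [Finset.mem_preimage, Finset.notMem_empty, iff_false]
        exact fun hi => (hsA hi).2 ⟨i, rfl⟩
  exact ⟨F, (mem_basisOf_of_subset hC hi hα hα' hG hFG hF hFs (by rw [hsrk])).1, hsrk⟩

/-- A multiplicative class generates a basis. -/
theorem IsMulClass.hasBasisOnChains (hC : IsMulClass r C) (hi : HasInfiniteChain r) :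
    HasBasisOnChains r := by
  classical
  refine ⟨hi, basisOf r C, fun F H => if h : F ∈ basisOf r C ∧ H ∈ spreadingUniform then
    (exists_isMultiplication hC hi h.1 h.2).choose else ∅, ?_⟩
  refine ⟨fun F hF => hF.1, cube_mem_basisOf hi, fun α h1 h2 => exists_mem_basisOf_srk_eq hC hi h1 h2,
    fun F hF G hG => ?_, fun F hF G hG => ?_, fun G hG F hFG hF hiota => ⟨hF, ?_⟩,
    fun F hF H hH => ?_, fun F hF H hH => ?_⟩
  · refine mem_basisOf_of_subset_chainJoin hC hi hF hG ?_ Set.subset_union_left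
      Set.subset_union_right (Set.union_subset (subset_chainJoin_left hF.1.onChains hG.1.empty_mem)
        (subset_chainJoin_right hG.1.onChains hF.1.empty_mem))
    rintro s (hs | hs) t ht
    · exact Or.inl (hF.1.hereditary s hs t ht)
    · exact Or.inr (hG.1.hereditary s hs t ht)
  · exact mem_basisOf_of_subset_chainJoin hC hi hF hG
      (chainJoin_hereditary hF.1.hereditary hG.1.hereditary)
      (subset_chainJoin_left hF.1.onChains hG.1.empty_mem)
      (subset_chainJoin_right hG.1.onChains hF.1.empty_mem) Subset.rfl
  · rcases hG.2 with ⟨n, hn⟩ | ⟨hω, K, hK, hGK⟩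
    · exact Or.inl ⟨n, hFG.trans hn⟩
    · refine Or.inr ⟨?_, K, by rwa [hiota], hFG.trans hGK⟩
      by_contra! hlt
      have h1 := (isEps_iota hω (hG.1.srk_lt hi)).2
      rw [← hiota, iota_of_lt_omega0 hlt] at h1
      exact lt_irrefl _ h1
  · simp only [hF, hH, and_self, dif_pos]
    exact (exists_isMultiplication hC hi hF hH).choose_spec.1
  · simp only [hF, hH, and_self, dif_pos]
    exact (exists_isMultiplication hC hi hF hH).choose_spec.2

/-- The existence of multiplicative classes is the same as the existence of bases, except that it
is automatic in the absence of infinite chains. -/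
theorem exists_isMulClass_iff : (∃ C, IsMulClass r C) ↔
    (HasInfiniteChain r → HasBasisOnChains r) := by
  constructor
  · rintro ⟨C, hC⟩ hi
    exact hC.hasBasisOnChains hi
  · intro h
    by_cases hi : HasInfiniteChain r
    · obtain ⟨-, B, mul, hB⟩ := h hi
      exact ⟨_, hB.isMulClass hi⟩
    · exact ⟨_, isMulClass_cubes hi⟩

end ToBasis

/-! ### Formal sums of powers of `ω` -/

section Hydra

/-- Formal natural (Hessenberg) sums of powers of `ω`: the coefficient at `e` counts the summands
`ω ^ e`. -/
abbrev Hydra : Type (u + 1) := Colex (Ordinal.{u} →₀ ℕ)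

/-- The formal power `ω ^ e`. -/
def hpow (e : Ordinal.{u}) : Hydra.{u} := toColex (Finsupp.single e 1)

theorem hpow_strictMono : StrictMono hpow.{u} := Finsupp.Colex.single_strictMono

theorem lt_hpow_iff {a : Hydra.{u}} {e : Ordinal.{u}} :
    a < hpow e ↔ ∀ j, e ≤ j → ofColex a j = 0 := by
  rw [Finsupp.Colex.lt_iff]
  change (∃ i, (∀ j, i < j → ofColex a j = Finsupp.single e 1 j) ∧
    ofColex a i < Finsupp.single e 1 i) ↔ _
  constructor
  · rintro ⟨i, h1, h2⟩
    have hi : i = e := by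
      by_contra hne
      rw [Finsupp.single_eq_of_ne hne] at h2
      exact absurd h2 (Nat.not_lt_zero _)
    subst hi
    intro j hj
    rcases hj.eq_or_lt with rfl | hj
    · simpa using h2
    · rw [h1 j hj, Finsupp.single_eq_of_ne hj.ne']
  · intro h
    refine ⟨e, fun j hj => ?_, ?_⟩
    · rw [h j hj.le, Finsupp.single_eq_of_ne hj.ne']
    · rw [h e le_rfl]
      simp

theorem zero_lt_hpow (e : Ordinal.{u}) : 0 < hpow e := lt_hpow_iff.2 fun _ _ => rfl

theorem add_lt_hpow {a b : Hydra.{u}} {e : Ordinal.{u}} (ha : a < hpow e) (hb : b < hpow e) :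
    a + b < hpow e := by
  rw [lt_hpow_iff] at *
  intro j hj
  change ofColex a j + ofColex b j = 0
  rw [ha j hj, hb j hj]

theorem sum_lt_hpow {ι : Type*} {s : Finset ι} {f : ι → Hydra.{u}} {e : Ordinal.{u}}
    (h : ∀ i ∈ s, f i < hpow e) : ∑ i ∈ s, f i < hpow e := by
  classical
  induction s using Finset.induction_on with
  | empty => exact zero_lt_hpow e
  | insert a s ha ih =>
    rw [Finset.sum_insert ha]
    exact add_lt_hpow (h a (by simp)) (ih fun i hi => h i (by simp [hi]))

/-- Cantor normal forms with finite coefficients are compared at the greatest exponent at which they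
differ. -/
theorem eval_lt_eval {f g : Ordinal.{u} →₀ Ordinal.{u}} (hf : ∀ e, f e < ω) {i : Ordinal.{u}}
    (h : ∀ j, i < j → f j = g j) (hi : f i < g i) : CNF.eval ω f < CNF.eval ω g := by
  classical
  have split : ∀ k : Ordinal.{u} →₀ Ordinal.{u}, CNF.eval ω k =
      CNF.eval ω (k.filter (i < ·)) + (ω ^ i * k i + CNF.eval ω (k.filter (· < i))) := by
    intro k
    have hk : k = k.filter (i < ·) + (Finsupp.single i (k i) + k.filter (· < i)) := by
      ext j
      rcases lt_trichotomy i j with hj | rfl | hj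
      · simp [hj, hj.not_gt, Finsupp.single_eq_of_ne hj.ne']
      · simp
      · simp [hj, hj.not_gt, Finsupp.single_eq_of_ne hj.ne]
    conv_lhs => rw [hk]
    rw [CNF.eval_add, CNF.eval_single_add]
    · intro e he
      simp only [Finsupp.support_filter, Finset.mem_filter] at he
      exact he.2.le
    · intro e₁ he₁ e₂ he₂
      simp only [Finsupp.support_filter, Finset.mem_filter] at he₁
      refine le_trans ?_ he₁.2.le
      rcases Finset.mem_union.1 (Finsupp.support_add he₂) with h | h
      · have := Finsupp.support_single_subset h
        simp only [Finset.mem_singleton] at this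
        exact this.le
      · simp only [Finsupp.support_filter, Finset.mem_filter] at h
        exact h.2.le
  have hhigh : f.filter (i < ·) = g.filter (i < ·) := by
    ext j
    by_cases hj : i < j
    · simp [hj, h j hj]
    · simp [hj]
  rw [split f, split g, hhigh]
  gcongr
  have hlow : CNF.eval ω (f.filter (· < i)) < ω ^ i := by
    refine CNF.eval_lt (fun e => ?_) fun e he => ?_
    · rw [Finsupp.filter_apply]
      split_ifs
      exacts [hf e, omega0_pos]
    · simp only [Finsupp.support_filter, Finset.mem_filter] at he
      exact he.2
  calc ω ^ i * f i + CNF.eval ω (f.filter (· < i)) < ω ^ i * f i + ω ^ i := by gcongr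
    _ = ω ^ i * (f i + 1) := by rw [mul_add, mul_one]
    _ ≤ ω ^ i * g i := by
      gcongr
      exact Order.add_one_le_of_lt hi
    _ ≤ _ := le_self_add

/-- The ordinal denoted by a formal sum. -/
def Hydra.val (a : Hydra.{u}) : Ordinal.{u} :=
  CNF.eval ω ((ofColex a).mapRange (fun n : ℕ => (n : Ordinal.{u})) Nat.cast_zero)

theorem Hydra.val_strictMono : StrictMono Hydra.val.{u} := by
  intro a b h
  obtain ⟨i, h1, h2⟩ := Finsupp.Colex.lt_iff.1 h
  refine eval_lt_eval (i := i) (fun e => ?_) (fun j hj => ?_) ?_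
  · rw [Finsupp.mapRange_apply]
    exact natCast_lt_omega0 _
  · rw [Finsupp.mapRange_apply, Finsupp.mapRange_apply]
    exact congrArg Nat.cast (h1 j hj)
  · rw [Finsupp.mapRange_apply, Finsupp.mapRange_apply]
    exact Nat.cast_lt.2 h2

theorem Hydra.val_hpow (e : Ordinal.{u}) : (hpow e).val = ω ^ e := by
  change CNF.eval ω ((Finsupp.single e 1).mapRange _ _) = _
  rw [Finsupp.mapRange_single, CNF.eval_single]
  simp

end Hydra

/-! ### Trees, meets and immediate successors -/

section Tree

/-- The elements below any given one are linearly ordered. -/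
class IsTreeOrder (T : Type u) [PartialOrder T] : Prop where
  le_or_le : ∀ {a b t : T}, a ≤ t → b ≤ t → a ≤ b ∨ b ≤ a

variable {T : Type u} [SemilatticeInf T] [WellFoundedLT T] [IsTreeOrder T]

theorem exists_covBy_le {v t : T} (h : v < t) : ∃ d, v ⋖ d ∧ d ≤ t := by
  obtain ⟨d, ⟨h1, h2⟩, h3⟩ := wellFounded_lt.has_min {a : T | v < a ∧ a ≤ t} ⟨t, h, le_rfl⟩
  exact ⟨d, ⟨h1, fun c hc hcd => h3 c ⟨hc, hcd.le.trans h2⟩ hcd⟩, h2⟩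

theorem covBy_unique {v d d' t : T} (h : v ⋖ d) (h' : v ⋖ d') (hd : d ≤ t) (hd' : d' ≤ t) :
    d = d' := by
  rcases IsTreeOrder.le_or_le hd hd' with hle | hle
  · by_contra hne
    exact h'.2 h.1 (lt_of_le_of_ne hle hne)
  · by_contra hne
    exact h.2 h'.1 (lt_of_le_of_ne hle (Ne.symm hne))

open Classical in
/-- The immediate successors of `v` that lie below some member of `s`. -/
def nextNodes (v : T) (s : Finset T) : Finset T :=
  (s.filter (v < ·)).attach.image fun t => (exists_covBy_le (Finset.mem_filter.1 t.2).2).choose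

theorem mem_nextNodes {v d : T} {s : Finset T} :
    d ∈ nextNodes v s ↔ v ⋖ d ∧ ∃ t ∈ s, d ≤ t := by
  classical
  simp only [nextNodes, Finset.mem_image, Finset.mem_attach, true_and, Subtype.exists,
    Finset.mem_filter]
  constructor
  · rintro ⟨t, ht, rfl⟩
    have := (exists_covBy_le ht.2).choose_spec
    exact ⟨this.1, t, ht.1, this.2⟩
  · rintro ⟨hd, t, ht, hdt⟩
    refine ⟨t, ⟨ht, hd.1.trans_le hdt⟩, ?_⟩
    have := (exists_covBy_le (hd.1.trans_le hdt)).choose_spec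
    exact covBy_unique this.1 hd this.2 hdt

theorem nextNodes_mono (v : T) {s t : Finset T} (h : s ⊆ t) : nextNodes v s ⊆ nextNodes v t := by
  intro d hd
  rw [mem_nextNodes] at *
  obtain ⟨h1, a, ha, h2⟩ := hd
  exact ⟨h1, a, h ha, h2⟩

open Classical in
/-- The meets of pairs of members of `s`. -/
def meets (s : Finset T) : Finset T := Finset.image₂ (· ⊓ ·) s s

theorem mem_meets {s : Finset T} {t : T} : t ∈ meets s ↔ ∃ a ∈ s, ∃ b ∈ s, a ⊓ b = t := by
  classical
  simp [meets]

theorem subset_meets (s : Finset T) : s ⊆ meets s := fun a ha =>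
  mem_meets.2 ⟨a, ha, a, ha, inf_idem a⟩

theorem meets_mono {s t : Finset T} (h : s ⊆ t) : meets s ⊆ meets t := by
  intro x hx
  obtain ⟨a, ha, b, hb, rfl⟩ := mem_meets.1 hx
  exact mem_meets.2 ⟨a, h ha, b, h hb, rfl⟩

/-- In a tree a meet of three elements is already a meet of two of them. -/
theorem inf_mem_meets {s : Finset T} {x y : T} (hx : x ∈ meets s) (hy : y ∈ meets s) :
    x ⊓ y ∈ meets s := by
  have key : ∀ x ∈ meets s, ∀ c ∈ s, x ⊓ c ∈ meets s := by
    intro x hx c hc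
    obtain ⟨a, ha, b, hb, rfl⟩ := mem_meets.1 hx
    rcases IsTreeOrder.le_or_le (inf_le_right : a ⊓ b ≤ b) (inf_le_left : b ⊓ c ≤ b) with h | h
    · rw [inf_eq_left.2 (h.trans inf_le_right)]
      exact hx
    · rw [inf_assoc, inf_eq_right.2 (h.trans inf_le_left)]
      exact mem_meets.2 ⟨b, hb, c, hc, rfl⟩
  obtain ⟨a, ha, b, hb, rfl⟩ := mem_meets.1 hy
  rw [← inf_assoc]
  exact key _ (key _ hx a ha) b hb

/-- In a tree the meets of pairs of members of `s` that lie below `l` are meets of `l` with members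
of `s`. -/
theorem exists_eq_inf {s : Finset T} {t l : T} (ht : t ∈ meets s) (htl : t ≤ l) :
    ∃ b ∈ s, l ⊓ b = t := by
  obtain ⟨a, ha, b, hb, rfl⟩ := mem_meets.1 ht
  rcases IsTreeOrder.le_or_le (inf_le_left : l ⊓ a ≤ l) (inf_le_left : l ⊓ b ≤ l) with h | h
  · exact ⟨a, ha, le_antisymm (le_inf inf_le_right (h.trans inf_le_right))
      (le_inf htl inf_le_left)⟩
  · exact ⟨b, hb, le_antisymm (le_inf (h.trans inf_le_right) inf_le_right)
      (le_inf htl inf_le_right)⟩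

open Classical in
/-- The finite sets `s` that are governed by the families `C` and `A`: below every member `l` of `s`,
the chain of the meets of `l` with members of `s` is in `C`, and at every node `v` the set of
directions in which `s` extends above `v` is in `A`. -/
def treeFamily (C A : Set (Finset T)) : Set (Finset T) :=
  {s | (∀ l ∈ s, s.image (l ⊓ ·) ∈ C) ∧ ∀ v, nextNodes v s ∈ A}

open Classical in
theorem treeFamily_hereditary {C A : Set (Finset T)} (hC : Hereditary C) (hA : Hereditary A) :
    Hereditary (treeFamily C A) := fun _ hs _ ht =>
  ⟨fun l hl => hC _ (hs.1 l (ht hl)) _ (Finset.image_subset_image ht),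
    fun v => hA _ (hs.2 v) _ (nextNodes_mono v ht)⟩

open Classical in
/-- The conditions of `treeFamily` on a set `w` that is closed under meets; the meets of a member `t`
of `w` with members of `w` are then the members of `w` below `t`. -/
structure IsGoodTree (C A : Set (Finset T)) (w : Finset T) : Prop where
  inf_mem : ∀ a ∈ w, ∀ b ∈ w, a ⊓ b ∈ w
  chain_mem : ∀ t ∈ w, w.filter (· ≤ t) ∈ C
  next_mem : ∀ v, nextNodes v w ∈ A

open Classical in
theorem isGoodTree_meets {C A : Set (Finset T)} (hC : Hereditary C) (hA : Hereditary A)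
    {s : Finset T} (hs : s ∈ treeFamily C A) : IsGoodTree C A (meets s) where
  inf_mem _ ha _ hb := inf_mem_meets ha hb
  chain_mem t ht := by
    obtain ⟨a, ha, b, hb, rfl⟩ := mem_meets.1 ht
    refine hC _ (hs.1 a ha) _ fun x hx => ?_
    obtain ⟨hx1, hx2⟩ := Finset.mem_filter.1 hx
    obtain ⟨c, hc, rfl⟩ := exists_eq_inf hx1 (hx2.trans inf_le_left)
    exact Finset.mem_image_of_mem _ hc
  next_mem v := by
    refine hA _ (hs.2 v) _ fun d hd => ?_
    obtain ⟨h1, t, ht, h2⟩ := mem_nextNodes.1 hd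
    obtain ⟨a, ha, b, hb, rfl⟩ := mem_meets.1 ht
    exact mem_nextNodes.2 ⟨h1, a, ha, h2.trans inf_le_left⟩

theorem meets_mem_treeFamily {C A : Set (Finset T)} (hC : Hereditary C) (hA : Hereditary A)
    {s : Finset T} (hs : s ∈ treeFamily C A) : meets s ∈ treeFamily C A := by
  classical
  have h := isGoodTree_meets hC hA hs
  refine ⟨fun l hl => hC _ (h.chain_mem l hl) _ fun x hx => ?_, h.next_mem⟩
  obtain ⟨b, hb, rfl⟩ := Finset.mem_image.1 hx
  exact Finset.mem_filter.2 ⟨inf_mem_meets hl hb, inf_le_left⟩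

end Tree

/-! ### The rank of a family on a tree -/

section TreeBound

variable {T : Type u} [SemilatticeInf T] [WellFoundedLT T] [IsTreeOrder T]
  (oC oA : Finset T → Ordinal.{u})

/-- An ordinal large enough for `base * a + b` to encode pairs `(a, b)` lexicographically. -/
def base : Ordinal.{u} := oC ∅ + 1 + (oA ∅ + 1)

open Classical in
/-- The least value of `oC` on an initial chain of `w` that passes through `v`. -/
def lowValue (w : Finset T) (v : T) : Ordinal.{u} :=
  sInf ((fun t => oC (w.filter (· ≤ t))) '' {t | t ∈ w ∧ v ≤ t})

open Classical in
/-- Measures how many nodes can still be inserted on the edge that ends at `v`: for a given chain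
below `v`, an insertion decreases all values of `oC` on chains through `v`, hence also the least of
them. -/
def edgeTerm (w : Finset T) (v : T) : Hydra.{u} :=
  hpow (base oC oA * oC (w.filter (· < v)) + lowValue oC w v)

open Classical in
/-- Measures how many nodes can still be placed above `v` in new directions.  The summand `oC ∅ + 1`
exceeds all values of `lowValue`, so that a node term dominates the edge terms of the nodes that come
after it. -/
def nodeTerm (w : Finset T) (v : T) : Hydra.{u} :=
  hpow (base oC oA * oC (w.filter (· ≤ v)) + (oC ∅ + 1 + oA (nextNodes v w)))

/-- A measure of the possibilities of extending `w`, for functions `oC` and `oA` that witness the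
boundedness of the families on chains and on sets of siblings. -/
def weight (w : Finset T) : Hydra.{u} :=
  ∑ v ∈ w, (edgeTerm oC oA w v + nodeTerm oC oA w v)

variable {oC oA} {C A : Set (Finset T)}

theorem base_mul_add_lt {a b c x : Ordinal.{u}} (hx : x < base oC oA) (h : a < b) :
    base oC oA * a + x < base oC oA * b + c := by
  calc base oC oA * a + x < base oC oA * a + base oC oA := by gcongr
    _ = base oC oA * (a + 1) := by rw [mul_add, mul_one]
    _ ≤ base oC oA * b := by
      gcongr
      exact Order.add_one_le_of_lt h
    _ ≤ _ := le_self_add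

open Classical in
theorem lowValue_le {w : Finset T} {v t : T} (ht : t ∈ w) (hvt : v ≤ t) :
    lowValue oC w v ≤ oC (w.filter (· ≤ t)) :=
  csInf_le' ⟨t, ⟨ht, hvt⟩, rfl⟩

open Classical in
theorem exists_lowValue_eq {w : Finset T} {v : T} (hv : v ∈ w) :
    ∃ t ∈ w, v ≤ t ∧ lowValue oC w v = oC (w.filter (· ≤ t)) := by
  obtain ⟨t, ht, h⟩ := csInf_mem (s := (fun t => oC (w.filter (· ≤ t))) '' {t | t ∈ w ∧ v ≤ t})
    ⟨_, v, ⟨hv, le_rfl⟩, rfl⟩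
  exact ⟨t, ht.1, ht.2, h.symm⟩

theorem sum_insert_lt [DecidableEq T] {w : Finset T} {y v₀ : T} (hy : y ∉ w) (hv₀ : v₀ ∈ w)
    {f f' : T → Hydra.{u}} (h : ∀ v ∈ w, v ≠ v₀ → f' v ≤ f v) (h₀ : f' y + f' v₀ < f v₀) :
    ∑ v ∈ insert y w, f' v < ∑ v ∈ w, f v := by
  rw [Finset.sum_insert hy, ← Finset.add_sum_erase w f' hv₀, ← Finset.add_sum_erase w f hv₀,
    ← add_assoc]
  refine add_lt_add_of_lt_of_le h₀ (Finset.sum_le_sum fun v hv => ?_)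
  exact h v (Finset.mem_of_mem_erase hv) (Finset.ne_of_mem_erase hv)

open Classical in
theorem oC_insert_lt (hC : Hereditary C)
    (dC : ∀ s x, ∀ h : x ∉ s, s.cons x h ∈ C → oC (s.cons x h) < oC s)
    {w : Finset T} {y : T} {p q : T → Prop} (hy : y ∉ w) (hq : q y)
    (hpq : ∀ a ∈ w, p a → q a) (hmem : (insert y w).filter q ∈ C) :
    oC ((insert y w).filter q) < oC (w.filter p) := by
  have hy' : y ∉ w.filter p := fun h => hy (Finset.mem_filter.1 h).1
  have hsub : (w.filter p).cons y hy' ⊆ (insert y w).filter q := by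
    intro a ha
    rcases Finset.mem_cons.1 ha with rfl | ha
    · exact Finset.mem_filter.2 ⟨Finset.mem_insert_self _ _, hq⟩
    · obtain ⟨h1, h2⟩ := Finset.mem_filter.1 ha
      exact Finset.mem_filter.2 ⟨Finset.mem_insert_of_mem h1, hpq a h1 h2⟩
  exact (antitone_of_decreasing hC dC hsub hmem).trans_lt (dC _ _ hy' (hC _ hmem _ hsub))

open Classical in
/-- Adding a node to a tree decreases its weight: one term is replaced by three smaller ones, and no
other term increases. -/
theorem weight_insert_lt (hC : Hereditary C) (hA : Hereditary A)
    (dC : ∀ s x, ∀ h : x ∉ s, s.cons x h ∈ C → oC (s.cons x h) < oC s)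
    (dA : ∀ s x, ∀ h : x ∉ s, s.cons x h ∈ A → oA (s.cons x h) < oA s)
    {w : Finset T} (hw : w.Nonempty) (hwinf : ∀ a ∈ w, ∀ b ∈ w, a ⊓ b ∈ w)
    {y : T} (hy : y ∉ w) (hg : IsGoodTree C A (insert y w)) :
    weight oC oA (insert y w) < weight oC oA w := by
  have hyw : y ∈ insert y w := Finset.mem_insert_self y w
  have hsub : w ⊆ insert y w := Finset.subset_insert y w
  have hle : ∀ t ∈ insert y w, (insert y w).filter (· ≤ t) ∈ C := hg.chain_mem
  have hlt : ∀ t ∈ insert y w, (insert y w).filter (· < t) ∈ C := fun t ht =>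
    hC _ (hle t ht) _ (Finset.monotone_filter_right _ fun a _ h => le_of_lt h)
  have hC0 : ∀ c ∈ C, oC c < oC ∅ + 1 := fun c hc => Order.lt_add_one_iff.2
    (antitone_of_decreasing hC dC (Finset.empty_subset c) hc)
  have hA0 : ∀ v, oA (nextNodes v (insert y w)) < oA ∅ + 1 := fun v => Order.lt_add_one_iff.2
    (antitone_of_decreasing hA dA (Finset.empty_subset _) (hg.next_mem v))
  have hlow : ∀ v ∈ insert y w, lowValue oC (insert y w) v < oC ∅ + 1 := fun v hv =>
    (lowValue_le hv le_rfl).trans_lt (hC0 _ (hle v hv))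
  have hlowbase : ∀ v ∈ insert y w, lowValue oC (insert y w) v < base oC oA := fun v hv =>
    (hlow v hv).trans_le le_self_add
  have hnodebase : ∀ v, oC ∅ + 1 + oA (nextNodes v (insert y w)) < base oC oA := fun v =>
    (add_lt_add_iff_left _).2 (hA0 v)
  -- Terms of old nodes never increase.
  have hedge : ∀ v ∈ w, edgeTerm oC oA (insert y w) v ≤ edgeTerm oC oA w v := by
    intro v hv
    refine hpow_strictMono.monotone (add_le_add ?_ ?_)
    · gcongr
      exact antitone_of_decreasing hC dC (Finset.filter_subset_filter _ hsub)
        (hlt v (hsub hv))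
    · obtain ⟨t, ht, hvt, heq⟩ := exists_lowValue_eq (oC := oC) hv
      rw [heq]
      exact (lowValue_le (hsub ht) hvt).trans (antitone_of_decreasing hC dC
        (Finset.filter_subset_filter _ hsub) (hle t (hsub ht)))
  have hnode : ∀ v ∈ w, nodeTerm oC oA (insert y w) v ≤ nodeTerm oC oA w v := by
    intro v hv
    refine hpow_strictMono.monotone (add_le_add ?_ ?_)
    · gcongr
      exact antitone_of_decreasing hC dC (Finset.filter_subset_filter _ hsub)
        (hle v (hsub hv))
    · gcongr
      exact antitone_of_decreasing hA dA (nextNodes_mono v hsub) (hg.next_mem v)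
  by_cases habove : ∃ t ∈ w, y < t
  · -- The new node splits the edge below the least node `v₀` above it.
    obtain ⟨v₀, ⟨hv₀, hyv₀⟩, hmin⟩ := wellFounded_lt.has_min {t | t ∈ w ∧ y < t} habove
    have hleast : ∀ t ∈ w, y < t → v₀ ≤ t := by
      intro t ht hyt
      have h1 : y < t ⊓ v₀ := lt_of_le_of_ne (le_inf hyt.le hyv₀.le) fun h =>
        hy (h ▸ hwinf t ht v₀ hv₀)
      have h2 := hmin (t ⊓ v₀) ⟨hwinf t ht v₀ hv₀, h1⟩
      rw [← eq_of_le_of_not_lt inf_le_right h2]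
      exact inf_le_left
    have hiff : ∀ a ∈ w, a < y ↔ a < v₀ := by
      refine fun a ha => ⟨fun h => h.trans hyv₀, fun h => ?_⟩
      rcases IsTreeOrder.le_or_le h.le hyv₀.le with h1 | h1
      · exact lt_of_le_of_ne h1 fun h2 => hy (h2 ▸ ha)
      · exact absurd h (hleast a ha (lt_of_le_of_ne h1 fun h2 => hy (h2 ▸ ha))).not_gt
    refine sum_insert_lt hy hv₀ (fun v hv _ => add_le_add (hedge v hv) (hnode v hv)) ?_
    -- the three terms dominated by the old edge at `v₀`
    have h1 : edgeTerm oC oA (insert y w) v₀ < edgeTerm oC oA w v₀ := by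
      refine hpow_strictMono (base_mul_add_lt (hlowbase v₀ (hsub hv₀)) ?_)
      exact oC_insert_lt hC dC hy hyv₀ (fun a _ h => h) (hlt v₀ (hsub hv₀))
    have h2 : edgeTerm oC oA (insert y w) y < edgeTerm oC oA w v₀ := by
      refine hpow_strictMono ?_
      have e : (insert y w).filter (· < y) = w.filter (· < v₀) := by
        ext a
        simp only [Finset.mem_filter, Finset.mem_insert]
        constructor
        · rintro ⟨rfl | ha, h⟩
          · exact absurd h (lt_irrefl _)
          · exact ⟨ha, (hiff a ha).1 h⟩
        · rintro ⟨ha, h⟩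
          exact ⟨Or.inr ha, (hiff a ha).2 h⟩
      rw [e]
      gcongr
      obtain ⟨t, ht, hvt, heq⟩ := exists_lowValue_eq (oC := oC) hv₀
      rw [heq]
      exact (lowValue_le (hsub ht) (hyv₀.le.trans hvt)).trans_lt
        (oC_insert_lt hC dC hy (hyv₀.le.trans hvt) (fun a _ h => h) (hle t (hsub ht)))
    have h3 : nodeTerm oC oA (insert y w) y < edgeTerm oC oA w v₀ := by
      refine hpow_strictMono (base_mul_add_lt (hnodebase y) ?_)
      exact oC_insert_lt hC dC hy le_rfl (fun a ha h => ((hiff a ha).2 h).le) (hle y hyw)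
    calc edgeTerm oC oA (insert y w) y + nodeTerm oC oA (insert y w) y +
          (edgeTerm oC oA (insert y w) v₀ + nodeTerm oC oA (insert y w) v₀)
        = (edgeTerm oC oA (insert y w) y + nodeTerm oC oA (insert y w) y +
          edgeTerm oC oA (insert y w) v₀) + nodeTerm oC oA (insert y w) v₀ := by abel
      _ < edgeTerm oC oA w v₀ + nodeTerm oC oA w v₀ :=
        add_lt_add_of_lt_of_le (add_lt_hpow (add_lt_hpow h2 h3) h1) (hnode v₀ hv₀)
  · -- The new node is a leaf, in a new direction above the greatest node `p` below it.
    push Not at habove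
    obtain ⟨p, hp, hmax⟩ : ∃ p ∈ w.image (y ⊓ ·), ∀ q ∈ w.image (y ⊓ ·), q ≤ p := by
      obtain ⟨p, hp, hmax⟩ := (w.image (y ⊓ ·)).exists_maximal (hw.image _)
      refine ⟨p, hp, fun q hq => ?_⟩
      have hpy : p ≤ y := by
        obtain ⟨t, -, rfl⟩ := Finset.mem_image.1 hp
        exact inf_le_left
      have hqy : q ≤ y := by
        obtain ⟨t, -, rfl⟩ := Finset.mem_image.1 hq
        exact inf_le_left
      rcases IsTreeOrder.le_or_le hpy hqy with h | h
      · exact hmax hq h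
      · exact h
    have hmax' : ∀ t ∈ w, y ⊓ t ≤ p := fun t ht => hmax _ (Finset.mem_image_of_mem _ ht)
    have hpw : p ∈ w ∧ p < y := by
      obtain ⟨t, ht, rfl⟩ := Finset.mem_image.1 hp
      have hne : y ⊓ t ≠ y := fun h =>
        habove t ht (lt_of_le_of_ne (inf_eq_left.1 h) fun h' => hy (h' ▸ ht))
      refine ⟨?_, lt_of_le_of_ne inf_le_left hne⟩
      exact (Finset.mem_insert.1 (hg.inf_mem y hyw t (hsub ht))).resolve_left hne
    obtain ⟨hpw, hpy⟩ := hpw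
    have hiff : ∀ a ∈ w, a ≤ y ↔ a ≤ p := fun a ha =>
      ⟨fun h => by simpa [h] using hmax' a ha, fun h => h.trans hpy.le⟩
    refine sum_insert_lt hy hpw (fun v hv _ => add_le_add (hedge v hv) (hnode v hv)) ?_
    -- the three terms dominated by the old node at `p`
    have h1 : nodeTerm oC oA (insert y w) p < nodeTerm oC oA w p := by
      refine hpow_strictMono (add_lt_add_of_le_of_lt ?_ ?_)
      · gcongr
        exact antitone_of_decreasing hC dC (Finset.filter_subset_filter _ hsub)
          (hle p (hsub hpw))
      · gcongr
        obtain ⟨d, hd, hdy⟩ := exists_covBy_le hpy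
        have hdw : d ∉ nextNodes p w := by
          intro h
          obtain ⟨-, t, ht, hdt⟩ := mem_nextNodes.1 h
          exact hd.1.not_ge ((le_inf hdy hdt).trans (hmax' t ht))
        have hdsub : (nextNodes p w).cons d hdw ⊆ nextNodes p (insert y w) := by
          intro a ha
          rcases Finset.mem_cons.1 ha with rfl | ha
          · exact mem_nextNodes.2 ⟨hd, y, hyw, hdy⟩
          · exact nextNodes_mono p hsub ha
        exact (antitone_of_decreasing hA dA hdsub (hg.next_mem p)).trans_lt
          (dA _ _ hdw (hA _ (hg.next_mem p) _ hdsub))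
    have h2 : edgeTerm oC oA (insert y w) y < nodeTerm oC oA w p := by
      refine hpow_strictMono ?_
      have e : (insert y w).filter (· < y) = w.filter (· ≤ p) := by
        ext a
        simp only [Finset.mem_filter, Finset.mem_insert]
        constructor
        · rintro ⟨rfl | ha, h⟩
          · exact absurd h (lt_irrefl _)
          · exact ⟨ha, (hiff a ha).1 h.le⟩
        · rintro ⟨ha, h⟩
          exact ⟨Or.inr ha, h.trans_lt hpy⟩
      rw [e]
      gcongr
      exact (hlow y hyw).trans_le le_self_add
    have h3 : nodeTerm oC oA (insert y w) y < nodeTerm oC oA w p := by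
      refine hpow_strictMono (base_mul_add_lt (hnodebase y) ?_)
      exact oC_insert_lt hC dC hy le_rfl (fun a ha h => (hiff a ha).2 h) (hle y hyw)
    calc edgeTerm oC oA (insert y w) y + nodeTerm oC oA (insert y w) y +
          (edgeTerm oC oA (insert y w) p + nodeTerm oC oA (insert y w) p)
        = edgeTerm oC oA (insert y w) p + (edgeTerm oC oA (insert y w) y +
          nodeTerm oC oA (insert y w) y + nodeTerm oC oA (insert y w) p) := by abel
      _ < edgeTerm oC oA w p + nodeTerm oC oA w p :=
        add_lt_add_of_le_of_lt (hedge p hpw) (add_lt_hpow (add_lt_hpow h2 h3) h1)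

/-- The missing nodes are added one at a time, minimal ones first, so that all intermediate sets are
closed under meets. -/
theorem weight_lt_of_ssubset (hC : Hereditary C) (hA : Hereditary A)
    (dC : ∀ s x, ∀ h : x ∉ s, s.cons x h ∈ C → oC (s.cons x h) < oC s)
    (dA : ∀ s x, ∀ h : x ∉ s, s.cons x h ∈ A → oA (s.cons x h) < oA s)
    {w w' : Finset T} (hw : w.Nonempty)
    (hwinf : ∀ a ∈ w, ∀ b ∈ w, a ⊓ b ∈ w) (hg : IsGoodTree C A w') (h : w ⊂ w') :
    weight oC oA w' < weight oC oA w := by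
  classical
  induction hn : (w' \ w).card using Nat.strong_induction_on generalizing w with
  | _ n ih =>
    have hne : (w' \ w).Nonempty := by
      rw [Finset.sdiff_nonempty]
      exact h.2
    obtain ⟨y, hy, hmin⟩ := wellFounded_lt.has_min {y | y ∈ w' \ w} hne
    obtain ⟨hyw', hyw⟩ := Finset.mem_sdiff.1 hy
    have hyinf : ∀ a ∈ w, y ⊓ a ∈ insert y w := by
      intro a ha
      rcases eq_or_lt_of_le (inf_le_left : y ⊓ a ≤ y) with h1 | h1
      · rw [h1]
        exact Finset.mem_insert_self _ _
      · refine Finset.mem_insert_of_mem ?_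
        by_contra h2
        exact hmin _ (Finset.mem_sdiff.2 ⟨hg.inf_mem y hyw' a (h.1 ha), h2⟩) h1
    have hinf : ∀ a ∈ insert y w, ∀ b ∈ insert y w, a ⊓ b ∈ insert y w := by
      intro a ha b hb
      rcases Finset.mem_insert.1 ha with ha' | ha' <;> rcases Finset.mem_insert.1 hb with hb' | hb'
      · rw [ha', hb', inf_idem]
        exact Finset.mem_insert_self _ _
      · rw [ha']
        exact hyinf b hb'
      · rw [hb', inf_comm]
        exact hyinf a ha'
      · exact Finset.mem_insert_of_mem (hwinf a ha' b hb')
    have hsub : insert y w ⊆ w' := Finset.insert_subset hyw' h.1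
    have hg' : IsGoodTree C A (insert y w) :=
      ⟨hinf, fun t ht => hC _ (hg.chain_mem t (hsub ht)) _ (by
          convert Finset.filter_subset_filter _ hsub),
        fun v => hA _ (hg.next_mem v) _ (nextNodes_mono v hsub)⟩
    have h1 := weight_insert_lt hC hA dC dA hw hwinf hyw hg'
    rcases hsub.eq_or_ssubset with heq | hss
    · rwa [heq] at h1
    · refine (ih _ ?_ (Finset.insert_nonempty y w) hinf hss rfl).trans h1
      rw [← hn]
      refine Finset.card_lt_card ⟨Finset.sdiff_subset_sdiff le_rfl (Finset.subset_insert y w),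
        fun h2 => ?_⟩
      exact (Finset.mem_sdiff.1 (h2 hy)).2 (Finset.mem_insert_self y w)

/-- The rank estimate: a family on a tree that is governed by families on chains and on sets of
siblings of ranks below an epsilon number has rank below that number. -/
theorem bounded_treeFamily (hC : Hereditary C) (hA : Hereditary A) {l : Ordinal.{u}}
    (hl : IsEps l) (hCl : Bounded C l) (hAl : Bounded A l) : Bounded (treeFamily C A) l := by
  classical
  obtain ⟨oC, dC, hCl⟩ := hCl
  obtain ⟨oA, dA, hAl⟩ := hAl
  let top : Hydra.{u} := hpow (base oC oA * (oC ∅ + 1))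
  have htop : ∀ s ∈ treeFamily C A, weight oC oA (meets s) < top := by
    intro s hs
    have hg := isGoodTree_meets hC hA hs
    have hC0 : ∀ c ∈ C, oC c < oC ∅ + 1 := fun c hc => Order.lt_add_one_iff.2
      (antitone_of_decreasing hC dC (Finset.empty_subset c) hc)
    refine sum_lt_hpow fun v hv => add_lt_hpow (hpow_strictMono ?_) (hpow_strictMono ?_)
    · rw [← add_zero (base oC oA * (oC ∅ + 1))]
      refine base_mul_add_lt ?_ (hC0 _ ?_)
      · exact (lowValue_le hv le_rfl).trans_lt
          ((hC0 _ (hg.chain_mem v hv)).trans_le le_self_add)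
      · exact hC _ (hg.chain_mem v hv) _
          (Finset.monotone_filter_right _ fun a _ h => le_of_lt h)
    · rw [← add_zero (base oC oA * (oC ∅ + 1))]
      refine base_mul_add_lt ?_ (hC0 _ (hg.chain_mem v hv))
      exact (add_lt_add_iff_left _).2 (Order.lt_add_one_iff.2
        (antitone_of_decreasing hA dA (Finset.empty_subset _) (hg.next_mem v)))
  -- When a point is added to `s` and the weight of its meet closure does not drop, then the new point
  -- was already a meet, and the number of meets outside `s` drops.
  let P : Finset T → Hydra.{u} := fun s => if s = ∅ then top else weight oC oA (meets s)
  refine ⟨fun s => ω * (P s).val + (meets s \ s).card, fun s x hx hs => ?_, ?_⟩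
  · have hsub : s ⊆ s.cons x hx := Finset.subset_cons hx
    have hs' := treeFamily_hereditary hC hA _ hs s hsub
    have hPx : P (s.cons x hx) = weight oC oA (meets (s.cons x hx)) := if_neg (by simp)
    have key : P (s.cons x hx) < P s → ω * (P (s.cons x hx)).val +
        ((meets (s.cons x hx) \ s.cons x hx).card : Ordinal.{u}) <
        ω * (P s).val + ((meets s \ s).card : Ordinal.{u}) := by
      intro h
      calc _ < ω * (P (s.cons x hx)).val + ω := by
            gcongr
            exact natCast_lt_omega0 _
        _ = ω * ((P (s.cons x hx)).val + 1) := by rw [mul_add, mul_one]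
        _ ≤ ω * (P s).val := by
          gcongr
          exact Order.add_one_le_of_lt (Hydra.val_strictMono h)
        _ ≤ _ := le_self_add
    rcases s.eq_empty_or_nonempty with rfl | hne
    · refine key ?_
      rw [hPx, show P ∅ = top from if_pos rfl]
      exact htop _ hs
    · have hPs : P s = weight oC oA (meets s) := if_neg hne.ne_empty
      rcases (meets_mono hsub).eq_or_ssubset with heq | hss
      · dsimp only
        rw [hPx, hPs, heq]
        refine (add_lt_add_iff_left _).2 (Nat.cast_lt.2 (Finset.card_lt_card
          ⟨Finset.sdiff_subset_sdiff le_rfl hsub, fun h => ?_⟩))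
        have h1 : x ∈ meets (s.cons x hx) \ s := Finset.mem_sdiff.2
          ⟨subset_meets _ (Finset.mem_cons_self x s), hx⟩
        exact (Finset.mem_sdiff.1 (h h1)).2 (Finset.mem_cons_self x s)
      · refine key ?_
        rw [hPx, hPs]
        exact weight_lt_of_ssubset hC hA dC dA (hne.mono (subset_meets s))
          (isGoodTree_meets hC hA hs').inf_mem (isGoodTree_meets hC hA hs) hss
  · have h0 : P ∅ = top := if_pos rfl
    have h1 : (meets (∅ : Finset T) \ ∅).card = 0 := by simp [meets]
    dsimp only
    rw [h0, h1, Hydra.val_hpow, Nat.cast_zero, add_zero]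
    refine hl.1.mul_lt hl.2 (hl.1.2 _ hl.2 _ (hl.1.mul_lt ?_ (hl.1.add_one_lt hCl)))
    exact hl.1.add_lt (hl.1.add_one_lt hCl) (hl.1.add_one_lt hAl)

end TreeBound

/-! ### Joins and simultaneous multiplications -/

section Tools

variable {I : Type u} {r : I → I → Prop}

theorem IsMulClass.empty_mem {C : Ordinal.{u} → Set (Set (Finset I))} (hC : IsMulClass r C)
    {l : Ordinal.{u}} {F : Set (Finset I)} (hF : F ∈ C l) : ∅ ∈ F :=
  hC.singleton_mem l F hF (by simp)

/-- Joins in the form in which they are applied: all chains that are covered by a member of `F` and a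
member of `G` belong to one family of the class. -/
theorem IsMulClass.exists_join [DecidableEq I] {C : Ordinal.{u} → Set (Set (Finset I))}
    (hC : IsMulClass r C) {l : Ordinal.{u}} (hl : IsEps l) {F G : Set (Finset I)} (hF : F ∈ C l)
    (hG : G ∈ C l) :
    ∃ K ∈ C l, ∀ s ∈ F, ∀ t ∈ G, ∀ w : Finset I, IsChain r (w : Set I) → w ⊆ s ∪ t → w ∈ K := by
  obtain ⟨K, hK, h⟩ := hC.join l hl F hF G hG
  exact ⟨K, hK, fun s hs t ht w hw hsub => h
    (mem_chainJoin_of_subset (hC.hereditary l F hF) (hC.hereditary l G hG) hs ht hw hsub)⟩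

theorem UnionProperty.exists_biUnion_mem [DecidableEq I] {F G : Set (Finset I)}
    {H : Set (Finset ℕ)} (h : UnionProperty r F H G) {s : ℕ → Finset I} (hs : ∀ n, s n ∈ F)
    (hc : IsChain r (⋃ n, (s n : Set I))) :
    ∃ φ : ℕ → ℕ, StrictMono φ ∧ ∀ x ∈ H, x.biUnion (fun n => s (φ n)) ∈ G := by
  obtain ⟨φ, hφ, h⟩ := h s hs hc
  refine ⟨φ, hφ, fun x hx => ?_⟩
  obtain ⟨g, hg, hgx⟩ := h x hx
  have : x.biUnion (fun n => s (φ n)) = g := by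
    rw [← Finset.coe_inj, hgx]
    ext i
    simp
  rwa [this]

/-- Since `H` is spreading, the property of having unions over members of `H` in `G` passes to
subsequences. -/
theorem biUnion_mem_of_strictMono [DecidableEq I] {G : Set (Finset I)} {H : Set (Finset ℕ)}
    (hH : Spreading H) {s : ℕ → Finset I} (h : ∀ x ∈ H, x.biUnion s ∈ G) {ψ : ℕ → ℕ}
    (hψ : StrictMono ψ) : ∀ x ∈ H, x.biUnion (fun n => s (ψ n)) ∈ G := by
  intro x hx
  have := h _ (spreading_iff.1 hH x hx ψ (hψ.strictMonoOn _) fun m _ => hψ.le_apply)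
  rwa [Finset.image_biUnion] at this

/-- Finitely many sequences have a common subsequence of indices with unions in `G`. -/
theorem UnionProperty.exists_forall_biUnion_mem [DecidableEq I] {F G : Set (Finset I)}
    {H : Set (Finset ℕ)} (h : UnionProperty r F H G) (hH : Spreading H) {J : Set I} (hJ : J.Finite)
    {s : I → ℕ → Finset I} (hs : ∀ j ∈ J, ∀ n, s j n ∈ F)
    (hc : ∀ j ∈ J, IsChain r (⋃ n, (s j n : Set I))) :
    ∃ φ : ℕ → ℕ, StrictMono φ ∧ ∀ j ∈ J, ∀ x ∈ H, x.biUnion (fun n => s j (φ n)) ∈ G := by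
  induction J, hJ using Set.Finite.induction_on with
  | empty => exact ⟨id, strictMono_id, by simp⟩
  | @insert a J _ _ ih =>
    obtain ⟨φ, hφ, h1⟩ := ih (fun j hj => hs j (Set.mem_insert_of_mem _ hj))
      fun j hj => hc j (Set.mem_insert_of_mem _ hj)
    have hsub : (⋃ n, (s a (φ n) : Set I)) ⊆ ⋃ n, (s a n : Set I) :=
      Set.iUnion_subset fun n => Set.subset_iUnion (fun n => (s a n : Set I)) (φ n)
    obtain ⟨ψ, hψ, h2⟩ := h.exists_biUnion_mem (fun n => hs a (Set.mem_insert _ _) (φ n))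
      ((hc a (Set.mem_insert _ _)).mono hsub)
    refine ⟨φ ∘ ψ, hφ.comp hψ, fun j hj => ?_⟩
    rcases Set.mem_insert_iff.1 hj with rfl | hj
    · exact h2
    · exact biUnion_mem_of_strictMono hH (h1 j hj) hψ

end Tools

/-! ### Limits of sequences of finite subtrees -/

section Limit

variable {T : Type u} [SemilatticeInf T] [OrderBot T] [WellFoundedLT T] [IsTreeOrder T]

/-- The root together with the nodes that lie below members of `w n` for almost all `n`, in the
sense of a free ultrafilter on `ℕ`. -/
def limitTree (w : ℕ → Finset T) : Set T :=
  {t | t = ⊥ ∨ ∀ᶠ n in (hyperfilter ℕ : Filter ℕ), ∃ b ∈ w n, t ≤ b}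

/-- The nodes that belong to almost all `w n`. -/
def limitNodes (w : ℕ → Finset T) : Set T :=
  {v | ∀ᶠ n in (hyperfilter ℕ : Filter ℕ), v ∈ w n}

/-- The immediate successors of `v` that belong to the limit tree. -/
def limitNext (w : ℕ → Finset T) (v : T) : Set T :=
  {d | v ⋖ d ∧ d ∈ limitTree w}

/-- The points at which the branches of the limit tree start: the root, and the immediate successors
of the nodes in `limitNodes`. -/
def branchStarts (w : ℕ → Finset T) : Set T :=
  insert ⊥ (⋃ v ∈ limitNodes w, limitNext w v)

/-- The part of the limit tree that is reached by way of `d` without passing through a further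
element of `limitNodes`. -/
def branch (w : ℕ → Finset T) (d : T) : Set T :=
  {t ∈ limitTree w | t ≤ d ∨ d ≤ t ∧ ∀ v ∈ limitNodes w, d ≤ v → ¬ v < t}

variable {w : ℕ → Finset T} {C A : Set (Finset T)}

theorem mem_limitTree_of_le {t a : T} (ht : t ∈ limitTree w) (h : a ≤ t) : a ∈ limitTree w := by
  rcases ht with rfl | ht
  · exact Or.inl (le_bot_iff.1 h)
  · exact Or.inr (ht.mono fun n ⟨b, hb, hle⟩ => ⟨b, hb, h.trans hle⟩)

theorem eventually_of_mem_limitNext {v d : T} (hd : d ∈ limitNext w v) :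
    ∀ᶠ n in (hyperfilter ℕ : Filter ℕ), d ∈ nextNodes v (w n) := by
  have hne : d ≠ ⊥ := (bot_le.trans_lt hd.1.lt).ne'
  exact (hd.2.resolve_left hne).mono fun n h => mem_nextNodes.2 ⟨hd.1, h⟩

/-- Only finitely many points belong to almost all members of a sequence in a compact hereditary
family, as finitely many of them always belong to a common member. -/
theorem finite_of_noInfinite {F : Set (Finset T)} (hF : NoInfinite F) {f : ℕ → Finset T}
    (hf : ∀ n, f n ∈ F) (hher : Hereditary F) {S : Set T}
    (hS : ∀ v ∈ S, ∀ᶠ n in (hyperfilter ℕ : Filter ℕ), v ∈ f n) : S.Finite := by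
  by_contra hinf
  obtain ⟨s, hs, hsF⟩ := hF S hinf
  have : ∀ᶠ n in (hyperfilter ℕ : Filter ℕ), ∀ v ∈ s, v ∈ f n :=
    (Filter.eventually_all_finset s).2 fun v hv => hS v (hs hv)
  obtain ⟨n, hn⟩ := this.exists
  exact hsF (hher _ (hf n) _ hn)

theorem inf_eq_of_covBy {v d d' b b' : T} (hd : v ⋖ d) (hd' : v ⋖ d') (hne : d ≠ d') (hb : d ≤ b)
    (hb' : d' ≤ b') : b ⊓ b' = v := by
  by_contra h
  obtain ⟨e, he, hle⟩ := exists_covBy_le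
    (lt_of_le_of_ne (le_inf (hd.le.trans hb) (hd'.le.trans hb')) (Ne.symm h))
  exact hne ((covBy_unique hd he hb (hle.trans inf_le_left)).trans
    (covBy_unique he hd' (hle.trans inf_le_right) hb'))

/-- The limit tree can branch only at nodes that belong to almost all `w n`. -/
theorem mem_limitNodes_of_ne (hinf : ∀ n, ∀ a ∈ w n, ∀ b ∈ w n, a ⊓ b ∈ w n) {v d d' : T}
    (hd : d ∈ limitNext w v) (hd' : d' ∈ limitNext w v) (hne : d ≠ d') : v ∈ limitNodes w := by
  filter_upwards [eventually_of_mem_limitNext hd, eventually_of_mem_limitNext hd'] with n h h'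
  obtain ⟨-, b, hb, hdb⟩ := mem_nextNodes.1 h
  obtain ⟨-, b', hb', hdb'⟩ := mem_nextNodes.1 h'
  rw [← inf_eq_of_covBy hd.1 hd'.1 hne hdb hdb']
  exact hinf n b hb b' hb'

theorem mem_branch_of_le {d t a : T} (ht : t ∈ branch w d) (h : a ≤ t) : a ∈ branch w d := by
  refine ⟨mem_limitTree_of_le ht.1 h, ?_⟩
  rcases ht.2 with h1 | ⟨h1, h2⟩
  · exact Or.inl (h.trans h1)
  · rcases IsTreeOrder.le_or_le h h1 with h3 | h3
    · exact Or.inl h3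
    · exact Or.inr ⟨h3, fun v hv hdv hva => h2 v hv hdv (hva.trans_le h)⟩

theorem bot_mem_branch (w : ℕ → Finset T) (d : T) : ⊥ ∈ branch w d := ⟨Or.inl rfl, Or.inl bot_le⟩

theorem le_or_le_of_mem_branch (hinf : ∀ n, ∀ a ∈ w n, ∀ b ∈ w n, a ⊓ b ∈ w n) {d t t' : T}
    (ht : t ∈ branch w d) (ht' : t' ∈ branch w d) : t ≤ t' ∨ t' ≤ t := by
  by_contra! hcon
  rcases ht.2 with h | ⟨h, hS⟩ <;> rcases ht'.2 with h' | ⟨h', -⟩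
  · exact (IsTreeOrder.le_or_le h h').elim hcon.1 hcon.2
  · exact hcon.1 (h.trans h')
  · exact hcon.2 (h'.trans h)
  · have h1 : t ⊓ t' < t := inf_lt_left.2 hcon.1
    obtain ⟨e, he, het⟩ := exists_covBy_le h1
    obtain ⟨e', he', het'⟩ := exists_covBy_le (inf_lt_right.2 hcon.2 : t ⊓ t' < t')
    refine hS _ (mem_limitNodes_of_ne hinf ⟨he, mem_limitTree_of_le ht.1 het⟩
      ⟨he', mem_limitTree_of_le ht'.1 het'⟩ ?_) (le_inf h h') h1
    rintro rfl
    exact he.lt.not_ge (le_inf het het')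

/-- The part of the limit tree below any node lies on a single branch: the one that starts above the
last member of `limitNodes w` on the way. -/
theorem exists_branch (hfin : (limitNodes w).Finite) (l : T) :
    ∃ d ∈ branchStarts w, ∀ t ∈ limitTree w, t ≤ l → t ∈ branch w d := by
  by_cases hne : {v ∈ limitNodes w | ∃ t ∈ limitTree w, t ≤ l ∧ v < t}.Nonempty
  · obtain ⟨v, ⟨hv, t, ht, htl, hvt⟩, hmax⟩ := (hfin.subset (Set.sep_subset _ _)).exists_maximal hne
    obtain ⟨d, hd, hdt⟩ := exists_covBy_le hvt
    refine ⟨d, Or.inr (Set.mem_biUnion hv ⟨hd, mem_limitTree_of_le ht hdt⟩),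
      fun t' ht' ht'l => ⟨ht', ?_⟩⟩
    refine (IsTreeOrder.le_or_le ht'l (hdt.trans htl)).imp_right fun h => ⟨h, ?_⟩
    intro v' hv' hdv' hlt
    exact (hd.lt.trans_le hdv').not_ge (hmax ⟨hv', t', ht', ht'l, hlt⟩ (hd.le.trans hdv'))
  · refine ⟨⊥, Set.mem_insert _ _, fun t ht htl => ⟨ht, Or.inr ⟨bot_le, fun v hv _ hlt => ?_⟩⟩⟩
    exact hne ⟨v, hv, t, ht, htl, hlt⟩

theorem finite_limitNodes (hw : ∀ n, w n ∈ treeFamily C A) (hC : Hereditary C) (hA : Hereditary A)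
    (hF : NoInfinite (treeFamily C A)) : (limitNodes w).Finite :=
  finite_of_noInfinite hF hw (treeFamily_hereditary hC hA) fun _ h => h

theorem finite_branchStarts (hfin : (limitNodes w).Finite) (hw : ∀ n, w n ∈ treeFamily C A)
    (hA : Hereditary A) (hF : NoInfinite A) : (branchStarts w).Finite :=
  (hfin.biUnion fun v _ => finite_of_noInfinite hF (fun n => (hw n).2 v) hA
    fun _ hd => eventually_of_mem_limitNext hd).insert _

open Classical in
/-- The greatest element of `B` that is below `b`; the root if there is none. -/
def proj (B : Set T) (b : T) : T :=
  if h : ∃ p, IsGreatest (B ∩ Set.Iic b) p then h.choose else ⊥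

theorem proj_eq {B : Set T} {b p : T} (h : IsGreatest (B ∩ Set.Iic b) p) : proj B b = p := by
  have h' : ∃ p, IsGreatest (B ∩ Set.Iic b) p := ⟨p, h⟩
  rw [proj, dif_pos h']
  exact h'.choose_spec.unique h

theorem proj_cases (B : Set T) (b : T) :
    IsGreatest (B ∩ Set.Iic b) (proj B b) ∨ proj B b = ⊥ := by
  by_cases h : ∃ p, IsGreatest (B ∩ Set.Iic b) p
  · obtain ⟨p, hp⟩ := h
    rw [proj_eq hp]
    exact Or.inl hp
  · exact Or.inr (dif_neg h)

theorem proj_mem {B : Set T} (hB : ⊥ ∈ B) (b : T) : proj B b ∈ B ∩ Set.Iic b := by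
  rcases proj_cases B b with h | h
  · exact h.1
  · rw [h]
    exact ⟨hB, bot_le⟩

theorem proj_Iic (l b : T) : proj (Set.Iic l) b = l ⊓ b :=
  proj_eq ⟨⟨inf_le_left, inf_le_right⟩, fun _ h => le_inf h.1 h.2⟩

/-- If the meet of `l` and `b` lies on a chain, then it is the projection to the chain of one of
them. -/
theorem inf_eq_proj {B : Set T} (hBc : ∀ s ∈ B, ∀ t ∈ B, s ≤ t ∨ t ≤ s) {l b : T}
    (h : l ⊓ b ∈ B) : l ⊓ b = proj B l ∨ l ⊓ b = proj B b := by
  by_contra! hcon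
  have h1 : ¬ IsGreatest (B ∩ Set.Iic l) (l ⊓ b) := fun h' => hcon.1 (proj_eq h').symm
  have h2 : ¬ IsGreatest (B ∩ Set.Iic b) (l ⊓ b) := fun h' => hcon.2 (proj_eq h').symm
  have h3 : ∃ t ∈ B, t ≤ l ∧ ¬ t ≤ l ⊓ b := by
    by_contra! h'
    exact h1 ⟨⟨h, inf_le_left⟩, fun t ht => h' t ht.1 ht.2⟩
  have h4 : ∃ t ∈ B, t ≤ b ∧ ¬ t ≤ l ⊓ b := by
    by_contra! h'
    exact h2 ⟨⟨h, inf_le_right⟩, fun t ht => h' t ht.1 ht.2⟩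
  obtain ⟨t, ht, htl, htn⟩ := h3
  obtain ⟨t', ht', htb, htn'⟩ := h4
  rcases hBc t ht t' ht' with hle | hle
  · exact htn (le_inf htl (hle.trans htb))
  · exact htn' (le_inf (hle.trans htl) htb)

/-- The projection of a finite set to a chain differs by at most two points from the set of meets
with one of its members. -/
theorem exists_image_proj_subset [DecidableEq T] {B : Set T} (hBc : ∀ s ∈ B, ∀ t ∈ B, s ≤ t ∨ t ≤ s)
    (hBd : ∀ t ∈ B, ∀ a ≤ t, a ∈ B) (hB : ⊥ ∈ B) {w : Finset T} (hw : w.Nonempty) :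
    ∃ b₀ ∈ w, ∃ p, w.image (proj B) ⊆ w.image (b₀ ⊓ ·) ∪ {⊥, p} := by
  obtain ⟨b₀, hb₀, hmax⟩ := w.exists_maximalFor (proj B) hw
  have hmax' : ∀ b ∈ w, proj B b ≤ proj B b₀ := fun b hb =>
    (hBc _ (proj_mem hB b).1 _ (proj_mem hB b₀).1).elim id fun h => hmax hb h
  refine ⟨b₀, hb₀, proj B b₀, fun x hx => ?_⟩
  obtain ⟨b, hb, rfl⟩ := Finset.mem_image.1 hx
  simp only [Finset.mem_union, Finset.mem_insert, Finset.mem_singleton]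
  rcases proj_cases B b with h | h
  · by_cases hmem : b₀ ⊓ b ∈ B
    · refine Or.inl (Finset.mem_image.2 ⟨b, hb, le_antisymm (h.2 ⟨hmem, inf_le_right⟩) ?_⟩)
      exact le_inf ((hmax' b hb).trans (proj_mem hB b₀).2) h.1.2
    · refine Or.inr (Or.inr (le_antisymm (hmax' b hb) (h.2 ⟨(proj_mem hB b₀).1, ?_⟩)))
      rcases IsTreeOrder.le_or_le (proj_mem hB b₀).2 (inf_le_left : b₀ ⊓ b ≤ b₀) with h1 | h1
      · exact h1.trans inf_le_right
      · exact absurd (hBd _ (proj_mem hB b₀).1 _ h1) hmem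
  · exact Or.inr (Or.inl h)

/-- The finite subtrees `w m` and `w n` meet only inside the limit tree, and where `w m` leaves the
limit tree at a node `v` outside `limitNodes w`, `w n` can only extend along the limit tree. -/
structure IsIndependent (w : ℕ → Finset T) (m n : ℕ) : Prop where
  inf_mem : ∀ b ∈ w m, ∀ l ∈ w n, b ⊓ l ∈ limitTree w
  next_subset : ∀ b ∈ w m, ∀ v, IsGreatest (limitTree w ∩ Set.Iic b) v → v ∉ limitNodes w →
    ∀ d ∈ limitNext w v, ∀ e ∈ nextNodes v (w n), e = d

/-- The least node `c ≤ b` outside the limit tree is avoided by almost all `w n`, whose meets with `b`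
therefore lie below `c`. -/
theorem eventually_inf_mem (b : T) :
    ∀ᶠ n in (hyperfilter ℕ : Filter ℕ), ∀ l ∈ w n, b ⊓ l ∈ limitTree w := by
  by_cases hb : b ∈ limitTree w
  · exact Eventually.of_forall fun n l _ => mem_limitTree_of_le hb inf_le_left
  · obtain ⟨c, ⟨hc, hcb⟩, hmin⟩ :=
      wellFounded_lt.has_min {c : T | c ∉ limitTree w ∧ c ≤ b} ⟨b, hb, le_rfl⟩
    have h1 : ∀ᶠ n in (hyperfilter ℕ : Filter ℕ), ¬ ∃ l ∈ w n, c ≤ l :=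
      Ultrafilter.eventually_not.2 fun h => hc (Or.inr h)
    filter_upwards [h1] with n hn l hl
    by_contra hcon
    rcases IsTreeOrder.le_or_le hcb (inf_le_left : b ⊓ l ≤ b) with h | h
    · exact hn ⟨l, hl, h.trans inf_le_right⟩
    · refine hmin _ ⟨hcon, inf_le_left⟩ (lt_of_le_of_ne h fun heq => ?_)
      exact hn ⟨l, hl, heq ▸ inf_le_right⟩

/-- If `w n` extends above `v` both in the direction `d` and in another one, then `v` is a meet, hence a
member, of `w n`. -/
theorem eventually_next_subset (hinf : ∀ n, ∀ a ∈ w n, ∀ b ∈ w n, a ⊓ b ∈ w n) {v d : T}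
    (hv : v ∉ limitNodes w) (hd : d ∈ limitNext w v) :
    ∀ᶠ n in (hyperfilter ℕ : Filter ℕ), ∀ e ∈ nextNodes v (w n), e = d := by
  filter_upwards [eventually_of_mem_limitNext hd, Ultrafilter.eventually_not.2 hv] with n h h' e he
  obtain ⟨-, b, hb, hdb⟩ := mem_nextNodes.1 h
  obtain ⟨hve, b', hb', heb⟩ := mem_nextNodes.1 he
  by_contra hne
  refine h' ?_
  rw [← inf_eq_of_covBy hve hd.1 hne heb hdb]
  exact hinf n b' hb' b hb

theorem eventually_isIndependent (hinf : ∀ n, ∀ a ∈ w n, ∀ b ∈ w n, a ⊓ b ∈ w n) (m : ℕ) :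
    ∀ᶠ n in (hyperfilter ℕ : Filter ℕ), IsIndependent w m n := by
  have h1 := (Filter.eventually_all_finset (w m)).2 fun b (_ : b ∈ w m) =>
    eventually_inf_mem (w := w) b
  have h2 : ∀ᶠ n in (hyperfilter ℕ : Filter ℕ), ∀ b ∈ w m, ∀ v,
      IsGreatest (limitTree w ∩ Set.Iic b) v → v ∉ limitNodes w →
        ∀ d ∈ limitNext w v, ∀ e ∈ nextNodes v (w n), e = d := by
    refine (Filter.eventually_all_finset (w m)).2 fun b _ => ?_
    by_cases h : ∃ v d, IsGreatest (limitTree w ∩ Set.Iic b) v ∧ v ∉ limitNodes w ∧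
        d ∈ limitNext w v
    · obtain ⟨v, d, hv, hvS, hd⟩ := h
      filter_upwards [eventually_next_subset hinf hvS hd] with n hn v' hv' _ d' hd' e he
      obtain rfl := hv.unique hv'
      by_contra hne
      refine hvS (mem_limitNodes_of_ne hinf hd hd' fun h => ?_)
      exact hne ((hn e he).trans h)
    · exact Eventually.of_forall fun n v hv hvS d hd => absurd ⟨v, d, hv, hvS, hd⟩ h
  filter_upwards [h1, h2] with n hn1 hn2 using ⟨hn1, hn2⟩

theorem exists_isIndependent (hinf : ∀ n, ∀ a ∈ w n, ∀ b ∈ w n, a ⊓ b ∈ w n) :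
    ∃ φ : ℕ → ℕ, StrictMono φ ∧ ∀ m n, m < n → IsIndependent w (φ m) (φ n) := by
  obtain ⟨φ, -, hφ⟩ := exists_seq_of_forall_finset_exists (fun _ : ℕ => True)
    (fun m n => m < n ∧ IsIndependent w m n) fun s _ => by
      have h1 : ∀ᶠ n in (hyperfilter ℕ : Filter ℕ), ∀ m ∈ s, m < n ∧ IsIndependent w m n := by
        refine (Filter.eventually_all_finset s).2 fun m _ => ?_
        have h2 : ∀ᶠ n in (hyperfilter ℕ : Filter ℕ), m < n :=
          Nat.hyperfilter_le_atTop (eventually_gt_atTop m)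
        exact h2.and (eventually_isIndependent hinf m)
      obtain ⟨n, hn⟩ := h1.exists
      exact ⟨n, trivial, hn⟩
  exact ⟨φ, fun m n h => (hφ m n h).1, fun m n h => (hφ m n h).2⟩

/-- The nodes at which infinitely many `w n` may have pairwise different directions: the members of
almost all `w n`, and the maximal nodes of the limit tree. -/
def branchingNodes (w : ℕ → Finset T) : Set T :=
  limitNodes w ∪ {v ∈ limitTree w | limitNext w v = ∅}

/-- A maximal node of the limit tree is the last node of one of the finitely many branches. -/
theorem finite_branchingNodes (hinf : ∀ n, ∀ a ∈ w n, ∀ b ∈ w n, a ⊓ b ∈ w n)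
    (hfin : (limitNodes w).Finite) (hQ : (branchStarts w).Finite) :
    (branchingNodes w).Finite := by
  refine hfin.union ((hQ.biUnion (t := fun d => {v | IsGreatest (branch w d) v}) fun d _ =>
    Set.Subsingleton.finite fun v hv v' hv' => hv.unique hv').subset ?_)
  rintro v ⟨hv, hmax⟩
  obtain ⟨d, hd, hsub⟩ := exists_branch hfin v
  refine Set.mem_biUnion hd ⟨hsub v hv le_rfl, fun t ht => ?_⟩
  rcases le_or_le_of_mem_branch hinf ht (hsub v hv le_rfl) with h | h
  · exact h
  · by_contra hlt
    obtain ⟨e, he, het⟩ := exists_covBy_le (lt_of_le_not_ge h hlt)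
    exact Set.eq_empty_iff_forall_notMem.1 hmax e ⟨he, mem_limitTree_of_le ht.1 het⟩

theorem nextNodes_biUnion [DecidableEq T] (v : T) (x : Finset ℕ) (f : ℕ → Finset T) :
    nextNodes v (x.biUnion f) = x.biUnion fun n => nextNodes v (f n) := by
  ext d
  simp only [mem_nextNodes, Finset.mem_biUnion]
  grind

/-- Away from the branching nodes, a single member of an independent sequence accounts for all but
at most one of the directions. -/
theorem exists_nextNodes_biUnion_subset [DecidableEq T]
    (hinf : ∀ n, ∀ a ∈ w n, ∀ b ∈ w n, a ⊓ b ∈ w n) {φ : ℕ → ℕ}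
    (hφ : ∀ m n, m < n → IsIndependent w (φ m) (φ n)) {v : T} (hv : v ∉ branchingNodes w)
    (x : Finset ℕ) :
    ∃ m d, nextNodes v (x.biUnion fun n => w (φ n)) ⊆ nextNodes v (w (φ m)) ∪ {d} := by
  by_cases hvL : v ∈ limitTree w
  · have hvS : v ∉ limitNodes w := fun h => hv (Or.inl h)
    obtain ⟨d, hd⟩ : (limitNext w v).Nonempty := by
      rw [Set.nonempty_iff_ne_empty]
      exact fun h => hv (Or.inr ⟨hvL, h⟩)
    by_cases h : ∃ n, ∃ e ∈ nextNodes v (w (φ n)), e ≠ d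
    · classical
      -- The first tree that extends above `v` otherwise than in the direction `d` leaves the limit tree
      -- at `v`, so that later trees extend only in the direction `d`, as do the earlier ones.
      obtain ⟨e, he, hed⟩ := Nat.find_spec h
      refine ⟨Nat.find h, d, fun a ha => ?_⟩
      obtain ⟨hva, l, hl, hal⟩ := mem_nextNodes.1 ha
      obtain ⟨n, -, hn⟩ := Finset.mem_biUnion.1 hl
      have ha' : a ∈ nextNodes v (w (φ n)) := mem_nextNodes.2 ⟨hva, l, hn, hal⟩
      rcases lt_trichotomy n (Nat.find h) with hlt | rfl | hlt
      · have := Nat.find_min h hlt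
        push Not at this
        simp [this a ha']
      · exact Finset.mem_union_left _ ha'
      · obtain ⟨hve, b, hb, heb⟩ := mem_nextNodes.1 he
        have hgr : IsGreatest (limitTree w ∩ Set.Iic b) v := by
          refine ⟨⟨hvL, hve.le.trans heb⟩, fun t ht => ?_⟩
          rcases IsTreeOrder.le_or_le ht.2 (hve.le.trans heb) with h1 | h1
          · exact h1
          · by_contra h2
            obtain ⟨e', he', het⟩ := exists_covBy_le (lt_of_le_not_ge h1 h2)
            have h3 : e' = e := covBy_unique he' hve (het.trans ht.2) heb
            subst h3
            exact hvS (mem_limitNodes_of_ne hinf ⟨he', mem_limitTree_of_le ht.1 het⟩ hd hed)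
        have := (hφ _ _ hlt).next_subset b hb v hgr hvS d hd a ha'
        simp [this]
    · push Not at h
      refine ⟨0, d, fun a ha => ?_⟩
      rw [nextNodes_biUnion] at ha
      obtain ⟨n, -, hn⟩ := Finset.mem_biUnion.1 ha
      simp [h n a hn]
  -- Outside the limit tree no two of the trees meet.
  · by_cases h : ∃ n, (nextNodes v (w (φ n))).Nonempty
    · obtain ⟨n, e, he⟩ := h
      refine ⟨n, v, fun a ha => Finset.mem_union_left _ ?_⟩
      rw [nextNodes_biUnion] at ha
      obtain ⟨m, -, hm⟩ := Finset.mem_biUnion.1 ha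
      obtain ⟨hve, b, hb, heb⟩ := mem_nextNodes.1 he
      obtain ⟨hva, b', hb', hab⟩ := mem_nextNodes.1 hm
      rcases lt_trichotomy m n with hlt | rfl | hlt
      · exact absurd (mem_limitTree_of_le ((hφ _ _ hlt).inf_mem b' hb' b hb)
          (le_inf (hva.le.trans hab) (hve.le.trans heb))) hvL
      · exact hm
      · exact absurd (mem_limitTree_of_le ((hφ _ _ hlt).inf_mem b hb b' hb')
          (le_inf (hve.le.trans heb) (hva.le.trans hab))) hvL
    · push Not at h
      refine ⟨0, v, fun a ha => ?_⟩
      rw [nextNodes_biUnion] at ha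
      obtain ⟨m, -, hm⟩ := Finset.mem_biUnion.1 ha
      rw [h m] at hm
      simp at hm

/-- The meets of a node with the members of an independent sequence are governed by the projections
of these members to a branch of the limit tree. -/
theorem exists_image_inf_biUnion_subset [DecidableEq T]
    (hinf : ∀ n, ∀ a ∈ w n, ∀ b ∈ w n, a ⊓ b ∈ w n)
    (hfin : (limitNodes w).Finite) {φ : ℕ → ℕ}
    (hφ : ∀ m n, m < n → IsIndependent w (φ m) (φ n)) {n : ℕ} {l : T} (hl : l ∈ w (φ n))
    (x : Finset ℕ) :
    ∃ d ∈ branchStarts w, ∃ p, (x.biUnion fun m => w (φ m)).image (l ⊓ ·) ⊆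
      ((w (φ n)).image (l ⊓ ·) ∪ {p}) ∪ x.biUnion fun m => (w (φ m)).image (proj (branch w d)) := by
  obtain ⟨d, hd, hsub⟩ := exists_branch hfin l
  refine ⟨d, hd, proj (branch w d) l, fun a ha => ?_⟩
  obtain ⟨b, hb, rfl⟩ := Finset.mem_image.1 ha
  obtain ⟨m, hm, hbm⟩ := Finset.mem_biUnion.1 hb
  rcases eq_or_ne m n with rfl | hne
  · exact Finset.mem_union_left _ (Finset.mem_union_left _ (Finset.mem_image_of_mem _ hbm))
  · have hmem : l ⊓ b ∈ limitTree w := by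
      rcases lt_or_gt_of_ne hne with hlt | hlt
      · rw [inf_comm]
        exact (hφ _ _ hlt).inf_mem b hbm l hl
      · exact (hφ _ _ hlt).inf_mem l hl b hbm
    rcases inf_eq_proj (fun s hs t ht => le_or_le_of_mem_branch hinf hs ht)
      (hsub _ hmem inf_le_left) with h | h
    · rw [h]
      simp
    · refine Finset.mem_union_right _ (Finset.mem_biUnion.2 ⟨m, hm, ?_⟩)
      rw [h]
      exact Finset.mem_image_of_mem _ hbm

end Limit

/-! ### Multiplicative classes on trees -/

section TreeClass

variable {T : Type u} [SemilatticeInf T] [OrderBot T] [WellFoundedLT T] [IsTreeOrder T]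
  {q r : T → T → Prop} {𝒞 𝒜 : Ordinal.{u} → Set (Set (Finset T))}

theorem isChain_of_forall_le {B : Set T} (h : ∀ s ∈ B, ∀ t ∈ B, s ≤ t ∨ t ≤ s) :
    IsChain (fun t u : T => t < u) B := fun s hs t ht hne =>
  (h s hs t ht).imp (fun h => lt_of_le_of_ne h hne) fun h => lt_of_le_of_ne h hne.symm

theorem isChain_image_inf [DecidableEq T] (l : T) (s : Finset T) :
    IsChain (fun t u : T => t < u) ((s.image (l ⊓ ·) : Finset T) : Set T) :=
  isChain_of_forall_le fun a ha b hb => by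
    obtain ⟨a, -, rfl⟩ := Finset.mem_image.1 (Finset.mem_coe.1 ha)
    obtain ⟨b, -, rfl⟩ := Finset.mem_image.1 (Finset.mem_coe.1 hb)
    exact IsTreeOrder.le_or_le inf_le_left inf_le_left

theorem isChain_nextNodes (hq : ∀ v : T, IsChain q {d | v ⋖ d}) (v : T) (s : Finset T) :
    IsChain q (nextNodes v s : Set T) :=
  (hq v).mono fun _ hd => (mem_nextNodes.1 (Finset.mem_coe.1 hd)).1

/-- Projections of members of a family to chains are controlled by a larger family of the class. -/
theorem IsMulClass.exists_proj [DecidableEq T] (h𝒞 : IsMulClass (fun t u : T => t < u) 𝒞)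
    {l : Ordinal.{u}} (hl : IsEps l) {C : Set (Finset T)} (hC : C ∈ 𝒞 l) :
    ∃ C' ∈ 𝒞 l, ∀ A, ∀ s ∈ treeFamily C A, ∀ B : Set T, (∀ s ∈ B, ∀ t ∈ B, s ≤ t ∨ t ≤ s) →
      (∀ t ∈ B, ∀ a ≤ t, a ∈ B) → ⊥ ∈ B → s.image (proj B) ∈ C' := by
  obtain ⟨D, hD, hD2⟩ := h𝒞.exists_cube_subset hl 2
  obtain ⟨K, hK, hjoin⟩ := h𝒞.exists_join hl hC hD
  refine ⟨K, hK, fun A s hs B hBc hBd hB => ?_⟩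
  rcases s.eq_empty_or_nonempty with rfl | hne
  · exact h𝒞.empty_mem hK
  · obtain ⟨b, hb, p, hsub⟩ := exists_image_proj_subset hBc hBd hB hne
    have hchain : IsChain (fun t u : T => t < u) ((s.image (proj B) : Finset T) : Set T) :=
      isChain_of_forall_le fun x hx y hy => by
        obtain ⟨x, -, rfl⟩ := Finset.mem_image.1 (Finset.mem_coe.1 hx)
        obtain ⟨y, -, rfl⟩ := Finset.mem_image.1 (Finset.mem_coe.1 hy)
        exact hBc _ (proj_mem hB x).1 _ (proj_mem hB y).1
    refine hjoin _ (by convert hs.1 b hb) {⊥, p} (hD2 ⟨Finset.card_le_two, ?_⟩) _ hchain hsub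
    exact isChain_of_forall_le fun x hx y hy => by
      simp only [Finset.coe_insert, Finset.coe_singleton, Set.mem_insert_iff,
        Set.mem_singleton_iff] at hx hy
      rcases hx with rfl | rfl
      · exact Or.inl bot_le
      · rcases hy with rfl | rfl
        · exact Or.inr bot_le
        · exact Or.inl le_rfl

/-- For `l ∈ s ∪ t` the meets of `l` with members of `t` are the projections of `t` to the chain of all
nodes below `l`, and likewise for `s`. -/
theorem exists_chainJoin_treeFamily_subset (h𝒞 : IsMulClass (fun t u : T => t < u) 𝒞)
    (h𝒜 : IsMulClass q 𝒜) (hq : ∀ v : T, IsChain q {d | v ⋖ d}) {l : Ordinal.{u}} (hl : IsEps l)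
    {C₁ C₂ A₁ A₂ : Set (Finset T)} (hC₁ : C₁ ∈ 𝒞 l) (hC₂ : C₂ ∈ 𝒞 l) (hA₁ : A₁ ∈ 𝒜 l)
    (hA₂ : A₂ ∈ 𝒜 l) : ∃ C ∈ 𝒞 l, ∃ A ∈ 𝒜 l,
      chainJoin r (treeFamily C₁ A₁) (treeFamily C₂ A₂) ⊆ treeFamily C A := by
  classical
  obtain ⟨A, hA, hAj⟩ := h𝒜.exists_join hl hA₁ hA₂
  obtain ⟨E₁, hE₁, hp₁⟩ := h𝒞.exists_proj hl hC₁
  obtain ⟨E₂, hE₂, hp₂⟩ := h𝒞.exists_proj hl hC₂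
  obtain ⟨E, hE, hEj⟩ := h𝒞.exists_join hl hE₁ hE₂
  refine ⟨E, hE, A, hA, ?_⟩
  rintro w ⟨-, s, hs, t, ht, hw⟩
  rw [← Finset.coe_union, Finset.coe_inj] at hw
  subst hw
  refine ⟨fun a _ => ?_, fun v => ?_⟩
  · have hBc : ∀ s ∈ Set.Iic a, ∀ t ∈ Set.Iic a, s ≤ t ∨ t ≤ s :=
      fun _ hs _ ht => IsTreeOrder.le_or_le hs ht
    have h1 := hp₁ _ s hs (Set.Iic a) hBc (fun _ ht _ h => h.trans ht) bot_le
    have h2 := hp₂ _ t ht (Set.Iic a) hBc (fun _ ht _ h => h.trans ht) bot_le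
    simp only [funext (proj_Iic a)] at h1 h2
    convert hEj _ h1 _ h2 _ (isChain_image_inf a (s ∪ t)) (Finset.image_union _ _).subset
  · refine hAj _ (hs.2 v) _ (ht.2 v) _ (isChain_nextNodes hq v _) fun d hd => ?_
    obtain ⟨h1, b, hb, hdb⟩ := mem_nextNodes.1 hd
    rcases Finset.mem_union.1 hb with hb | hb
    · exact Finset.mem_union_left _ (mem_nextNodes.2 ⟨h1, b, hb, hdb⟩)
    · exact Finset.mem_union_right _ (mem_nextNodes.2 ⟨h1, b, hb, hdb⟩)

/-- Families on a tree that are governed by families on chains and on sets of siblings can be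
multiplied.  A sequence in such a family is first made independent; then the finitely many sequences
of projections to branches of the limit tree are multiplied by means of the class on chains, and the
finitely many sequences of directions at branching nodes by means of the class on sets of siblings. -/
theorem exists_unionProperty_treeFamily (h𝒞 : IsMulClass (fun t u : T => t < u) 𝒞)
    (h𝒜 : IsMulClass q 𝒜) (hq : ∀ v : T, IsChain q {d | v ⋖ d}) {l : Ordinal.{u}} (hl : IsEps l)
    {C A : Set (Finset T)} (hC : C ∈ 𝒞 l) (hA : A ∈ 𝒜 l) {H : Set (Finset ℕ)}
    (hH : H ∈ spreadingUniform) (hHl : Ordinal.lift.{u} (srk (fun m n : ℕ => m < n) H) < l) :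
    ∃ C' ∈ 𝒞 l, ∃ A' ∈ 𝒜 l, UnionProperty r (treeFamily C A) H (treeFamily C' A') := by
  classical
  have hCh := h𝒞.hereditary l C hC
  have hAh := h𝒜.hereditary l A hA
  have hCb := h𝒞.bounded l hl C hC
  have hAb := h𝒜.bounded l hl A hA
  have hTn := (bounded_treeFamily hCh hAh hl hCb hAb).noInfinite
  obtain ⟨C₁, hC₁, hproj⟩ := h𝒞.exists_proj hl hC
  obtain ⟨C₂, hC₂, hCU⟩ := h𝒞.mul l hl C₁ hC₁ H hH hHl
  obtain ⟨C₃, hC₃, hCj⟩ := h𝒞.exists_join hl hC hC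
  obtain ⟨C', hC', hCj'⟩ := h𝒞.exists_join hl hC₃ hC₂
  obtain ⟨A₂, hA₂, hAU⟩ := h𝒜.mul l hl A hA H hH hHl
  obtain ⟨A₃, hA₃, hAj⟩ := h𝒜.exists_join hl hA hA
  obtain ⟨A', hA', hAj'⟩ := h𝒜.exists_join hl hA₃ hA₂
  refine ⟨C', hC', A', hA', fun s hs _ => ?_⟩
  let w : ℕ → Finset T := fun n => meets (s n)
  have hw : ∀ n, w n ∈ treeFamily C A := fun n => meets_mem_treeFamily hCh hAh (hs n)
  have hinf : ∀ n, ∀ a ∈ w n, ∀ b ∈ w n, a ⊓ b ∈ w n := fun n _ ha _ hb => inf_mem_meets ha hb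
  have hS := finite_limitNodes hw hCh hAh hTn
  have hQ := finite_branchStarts hS hw hAh hAb.noInfinite
  have hV := finite_branchingNodes hinf hS hQ
  obtain ⟨φ, hφ, hind⟩ := exists_isIndependent hinf
  have hbc := fun d => fun s (hs : s ∈ branch w d) t (ht : t ∈ branch w d) =>
    le_or_le_of_mem_branch hinf hs ht
  obtain ⟨ψ, hψ, hψC⟩ := hCU.exists_forall_biUnion_mem hH.2.1 hQ
    (s := fun d n => (w (φ n)).image (proj (branch w d)))
    (fun d _ n => hproj A _ (hw _) _ (hbc d) (fun t ht a ha => mem_branch_of_le ht ha)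
      (bot_mem_branch w d))
    fun d _ => isChain_of_forall_le fun x hx y hy => by
      obtain ⟨m, hm⟩ := Set.mem_iUnion.1 hx
      obtain ⟨n, hn⟩ := Set.mem_iUnion.1 hy
      obtain ⟨a, -, rfl⟩ := Finset.mem_image.1 (Finset.mem_coe.1 hm)
      obtain ⟨b, -, rfl⟩ := Finset.mem_image.1 (Finset.mem_coe.1 hn)
      exact hbc d _ (proj_mem (bot_mem_branch w d) a).1 _ (proj_mem (bot_mem_branch w d) b).1
  obtain ⟨χ, hχ, hχA⟩ := hAU.exists_forall_biUnion_mem hH.2.1 hV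
    (s := fun v n => nextNodes v (w (φ (ψ n)))) (fun v _ n => (hw _).2 v)
    fun v _ => (hq v).mono (Set.iUnion_subset fun n d hd =>
      (mem_nextNodes.1 (Finset.mem_coe.1 hd)).1)
  have hmono : StrictMono fun n => φ (ψ (χ n)) := hφ.comp (hψ.comp hχ)
  have hind' : ∀ m n, m < n → IsIndependent w (φ (ψ (χ m))) (φ (ψ (χ n))) := fun m n h =>
    hind _ _ ((hψ.comp hχ) h)
  refine ⟨fun n => φ (ψ (χ n)), hmono, fun x hx => ?_⟩
  refine ⟨x.biUnion fun n => s (φ (ψ (χ n))), ?_, by simp⟩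
  refine treeFamily_hereditary (h𝒞.hereditary l C' hC') (h𝒜.hereditary l A' hA')
    (x.biUnion fun n => w (φ (ψ (χ n)))) ⟨fun a ha => ?_, fun v => ?_⟩ _
    (Finset.biUnion_mono fun n _ => subset_meets _)
  · obtain ⟨n, -, han⟩ := Finset.mem_biUnion.1 ha
    obtain ⟨d, hd, p, hsub⟩ := exists_image_inf_biUnion_subset (φ := fun n => φ (ψ (χ n))) hinf hS
      hind' han x
    have h1 : x.biUnion (fun m => (w (φ (ψ (χ m)))).image (proj (branch w d))) ∈ C₂ :=
      biUnion_mem_of_strictMono hH.2.1 (hψC d hd) hχ x hx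
    have hchain := isChain_image_inf a (x.biUnion fun n => w (φ (ψ (χ n))))
    set X := (x.biUnion fun n => w (φ (ψ (χ n)))).image (a ⊓ ·) with hX
    set Y := (w (φ (ψ (χ n)))).image (a ⊓ ·) ∪ {p} with hY
    have h2 : X ∩ Y ∈ C₃ := by
      refine hCj _ (by convert (hw (φ (ψ (χ n)))).1 a han) {p}
        (h𝒞.singleton_mem l C hC (by simp)) _ (hchain.mono ?_) Finset.inter_subset_right
      exact Finset.coe_subset.2 Finset.inter_subset_left
    convert hCj' _ h2 _ h1 X hchain fun y hy => ?_
    rcases Finset.mem_union.1 (hsub hy) with h | h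
    · exact Finset.mem_union_left _ (Finset.mem_inter.2 ⟨hy, h⟩)
    · exact Finset.mem_union_right _ h
  · have hchain := isChain_nextNodes hq v (x.biUnion fun n => w (φ (ψ (χ n))))
    by_cases hv : v ∈ branchingNodes w
    · refine hAj' ∅ (h𝒜.empty_mem hA₃) _ (hχA v hv x hx) _ hchain ?_
      rw [nextNodes_biUnion, Finset.empty_union]
    · obtain ⟨m, d, hsub⟩ := exists_nextNodes_biUnion_subset hinf hind' hv x
      exact hAj' _ (hAj _ ((hw _).2 v) {d} (h𝒜.singleton_mem l A hA (by simp)) _ hchain hsub) ∅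
        (h𝒜.empty_mem hA₂) _ hchain Finset.subset_union_left

/-- Multiplicative classes on the chains of a tree and on its sets of siblings yield one on the
whole tree. -/
theorem IsMulClass.tree (h𝒞 : IsMulClass (fun t u : T => t < u) 𝒞) (h𝒜 : IsMulClass q 𝒜)
    (hq : ∀ v : T, IsChain q {d | v ⋖ d}) (hr : ∀ s : Set T, IsChain r s) :
    IsMulClass r fun l => {F | ∃ C ∈ 𝒞 l, ∃ A ∈ 𝒜 l, F = treeFamily C A} where
  mono := by
    rintro l m hlm _ ⟨C, hC, A, hA, rfl⟩
    exact ⟨C, h𝒞.mono hlm hC, A, h𝒜.mono hlm hA, rfl⟩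
  onChains _ _ _ s _ := hr s
  hereditary := by
    rintro l _ ⟨C, hC, A, hA, rfl⟩
    exact treeFamily_hereditary (h𝒞.hereditary l C hC) (h𝒜.hereditary l A hA)
  singleton_mem := by
    rintro l _ ⟨C, hC, A, hA, rfl⟩ s hs
    classical
    refine ⟨fun a _ => h𝒞.singleton_mem l C hC (Finset.card_image_le.trans hs),
      fun v => h𝒜.singleton_mem l A hA (Finset.card_le_one.2 fun d hd e he => ?_)⟩
    obtain ⟨hvd, b, hb, hdb⟩ := mem_nextNodes.1 hd
    obtain ⟨hve, b', hb', heb⟩ := mem_nextNodes.1 he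
    obtain rfl := Finset.card_le_one.1 hs b hb b' hb'
    exact covBy_unique hvd hve hdb heb
  bounded := by
    rintro l hl _ ⟨C, hC, A, hA, rfl⟩
    exact bounded_treeFamily (h𝒞.hereditary l C hC) (h𝒜.hereditary l A hA) hl
      (h𝒞.bounded l hl C hC) (h𝒜.bounded l hl A hA)
  nonempty l hl := by
    obtain ⟨C, hC⟩ := h𝒞.nonempty l hl
    obtain ⟨A, hA⟩ := h𝒜.nonempty l hl
    exact ⟨_, C, hC, A, hA, rfl⟩
  join := by
    rintro l hl _ ⟨C₁, hC₁, A₁, hA₁, rfl⟩ _ ⟨C₂, hC₂, A₂, hA₂, rfl⟩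
    obtain ⟨C, hC, A, hA, h⟩ :=
      exists_chainJoin_treeFamily_subset (r := r) h𝒞 h𝒜 hq hl hC₁ hC₂ hA₁ hA₂
    exact ⟨_, ⟨C, hC, A, hA, rfl⟩, h⟩
  mul := by
    rintro l hl _ ⟨C, hC, A, hA, rfl⟩ H hH hHl
    obtain ⟨C', hC', A', hA', h⟩ :=
      exists_unionProperty_treeFamily (r := r) h𝒞 h𝒜 hq hl hC hA hH hHl
    exact ⟨_, ⟨C', hC', A', hA', rfl⟩, h⟩

end TreeClass

/-- A basis on a set yields multiplicative classes on chains of any ordering of that set. -/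
theorem HasBasis.exists_isMulClass {I : Type u} (h : HasBasis I) (r : I → I → Prop) :
    ∃ C, IsMulClass r C := by
  obtain ⟨q, hq, hb⟩ := h
  obtain ⟨C, hC⟩ := exists_isMulClass_iff.2 fun _ => hb
  refine ⟨_, hC.restrict fun s _ x _ y _ hxy => ?_⟩
  rcases trichotomous_of q x y with h | h | h
  · exact Or.inl h
  · exact absurd h hxy
  · exact Or.inr h

theorem hasBasis_of_isMulClass {I : Type u} [Infinite I] {r : I → I → Prop}
    [IsStrictTotalOrder I r] {C : Ordinal.{u} → Set (Set (Finset I))} (hC : IsMulClass r C) :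
    HasBasis I :=
  ⟨r, inferInstance, exists_isMulClass_iff.1 ⟨C, hC⟩ ⟨Set.univ, Set.infinite_univ,
    fun x _ y _ hxy => (trichotomous_of r x y).imp_right fun h => h.resolve_left hxy⟩⟩

theorem IsCompleteRootedTree.wellFoundedLT {T : Type u} [PartialOrder T]
    (hT : IsCompleteRootedTree T) : WellFoundedLT T := by
  refine ⟨⟨fun t => ⟨t, ?_⟩⟩⟩
  intro y hy
  have hwf : WellFounded fun a b : Set.Iio t => a < b := (hT.wellOrdered t).wf
  have key : ∀ y : Set.Iio t, Acc (fun a b : T => a < b) y := by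
    intro y
    induction y using hwf.induction with
    | _ a ih => exact ⟨_, fun b hb => ih ⟨b, lt_trans hb a.2⟩ hb⟩
  exact key ⟨y, hy⟩

theorem IsCompleteRootedTree.isTreeOrder {T : Type u} [PartialOrder T]
    (hT : IsCompleteRootedTree T) : IsTreeOrder T where
  le_or_le := by
    intro a b t ha hb
    rcases ha.eq_or_lt with rfl | ha
    · exact Or.inr hb
    rcases hb.eq_or_lt with rfl | hb
    · exact Or.inl ha.le
    have := hT.wellOrdered t
    rcases trichotomous_of (fun a b : Set.Iio t => a < b) ⟨a, ha⟩ ⟨b, hb⟩ with h | h | h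
    · exact Or.inl (le_of_lt h)
    · exact Or.inl (congrArg Subtype.val h).le
    · exact Or.inr (le_of_lt h)

/-- The semilattice structure of a complete rooted tree. -/
abbrev IsCompleteRootedTree.semilatticeInf {T : Type u} [PartialOrder T]
    (hT : IsCompleteRootedTree T) : SemilatticeInf T where
  inf t u := (hT.meet t u).choose
  inf_le_left t u := (hT.meet t u).choose_spec.1.1
  inf_le_right t u := (hT.meet t u).choose_spec.1.2
  le_inf _ b c h h' := (hT.meet b c).choose_spec.2 ⟨h, h'⟩

end FinFamily

end

theorem mainTheorem2 {T : Type u} [PartialOrder T] [Infinite T]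
    (hT : FinFamily.IsCompleteRootedTree T)
    (sib : ∀ v : T, {u : T // v ⋖ u} → {u : T // v ⋖ u} → Prop)
    (hsib : ∀ v : T, IsStrictTotalOrder {u : T // v ⋖ u} (sib v)) :
    FinFamily.HasBasis T ↔
      (FinFamily.HasInfiniteChain (fun t u : T => t < u) →
        FinFamily.HasBasisOnChains (fun t u : T => t < u)) ∧
      (FinFamily.HasInfiniteChain (FinFamily.ltA sib) →
        FinFamily.HasBasisOnChains (FinFamily.ltA sib)) := by
  rw [← FinFamily.exists_isMulClass_iff, ← FinFamily.exists_isMulClass_iff]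
  refine ⟨fun h => ⟨h.exists_isMulClass _, h.exists_isMulClass _⟩, ?_⟩
  rintro ⟨⟨C, hC⟩, A, hA⟩
  let _ : SemilatticeInf T := hT.semilatticeInf
  let _ : OrderBot T := { bot := hT.root.choose, bot_le := hT.root.choose_spec }
  have : WellFoundedLT T := hT.wellFoundedLT
  have : FinFamily.IsTreeOrder T := hT.isTreeOrder
  refine FinFamily.hasBasis_of_isMulClass (r := WellOrderingRel)
    (hC.tree hA (fun v d hd e he hne => ?_) fun s x _ y _ hxy => ?_)
  · have := hsib v
    rcases trichotomous_of (sib v) ⟨d, hd⟩ ⟨e, he⟩ with h | h | h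
    · exact Or.inl ⟨v, hd, he, h⟩
    · exact absurd (congrArg Subtype.val h) hne
    · exact Or.inr ⟨v, he, hd, h⟩
  · exact (trichotomous_of WellOrderingRel x y).imp_right fun h => h.resolve_left hxy
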